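/- **Setting.** Let $\mathrm{St}(d,r)=\{X\in\mathbb R^{d\times r}: X^\top X=I_r\}$, with the metric induced by the Frobenius inner product and tangent spaces $T_X=\{\xi:\xi^\top X+X^\top\xi=0\}$. Let $\mathrm{Retr}$ be a (smooth) retraction on $\mathrm{St}(d,r)$ with $\|\mathrm{Retr}_X(\xi)-X\|\le M_1\|\xi\|$ and $\|\mathrm{Retr}_X(\xi)-(X+\xi)\|\le M_2\|\xi\|^2$ for all $X$ and $\xi\in T_X$. Let $\Gamma$ be a smooth isometric vector transport associated with $\mathrm{Retr}$: if $Y=\mathrm{Retr}_X(\xi)$, then $\Gamma_X^Y:T_X\to T_Y$ (depending smoothly on $X,\xi$) is linear and norm preserving, and it is the identity for $\xi=0$. Consider $\min_{X\in \mathrm{St}(d,r)}F(X)=f(X)+h(X)$, where $f=\frac1n\sum_{i=1}^n f_i$ (finite-sum case) or $f(X)=\mathbb E_\pi f(X;\pi)$ (online case; $f_i$ then stands for $f(\cdot;\pi_i)$). The functions $f_i$ and $f$ are $C^2$ on $\mathbb R^{d\times r}$, $h:\mathbb R^{d\times r}\to\mathbb R$ is convex, and $|h(X)-h(Y)|\le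 L_h\|X-Y\|$, $\|\nabla f_i(X)\|\le G$, $\|\nabla^2 f_i(X)\|\le L_H$ for $X,Y\in\mathrm{St}(d,r)$; in the online case also $\mathbb E_\pi\|\nabla f(X;\pi)-\nabla f(X)\|^2\le\sigma^2$. Let $X^*$ be a global minimizer of $F$ on $\mathrm{St}(d,r)$ and $\mathcal U\subset\mathrm{St}(d,r)$ a totally retractive neighbourhood of $X^*$: for some $\rho>0$ and every $X\in\mathcal U$, $\mathrm{Retr}_X$ is a diffeomorphism from the $\rho$-ball of $T_X$ onto a set containing $\mathcal U$, with inverse $\mathrm{Retr}_X^{-1}$. Assume that $\|\mathrm{Retr}_X^{-1}(Y)\|\le c_E\|\xi\|$ whenever $X,Y\in\mathcal U$ and $\mathrm{Retr}_X(\xi)=Y$ (with $c_E>0$), and that $\frac{d^2}{dt^2}f(\mathrm{Retr}_X(t\xi))\le L_R$ (with $L_R>0$) for $X\in\mathcal U$, unit $\xi\in T_X$ and $t\ge0$ such that $\mathrm{Retr}_X(\tau\xi)\in\mathcal U$ for $\tau\in[0,t]$. **Algorithm (R-ProxSPB).** Given $X_0\in\mathrm{St}(d,r)$, $\eta,\gamma>0$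 and integers $q,T\geq 1$, for $t=0,\dots,T-1$: sample a fresh mini-batch $\mathcal S_t$ (equal to $\mathcal S_t^1$ if $q\mid t$ and to $\mathcal S_t^2$ otherwise), independent of the earlier ones; put $\nabla f_{\mathcal S}=\frac1{|\mathcal S|}\sum_{i\in\mathcal S}\nabla f_i$ and $$V_t=\nabla f_{\mathcal S_t^1}(X_t)\ \text{ if } q\mid t,\qquad V_t=\nabla f_{\mathcal S_t^2}(X_t)-\Gamma_{X_{t-1}}^{X_t}\,\mathrm{Proj}_{T_{X_{t-1}}}\big(\nabla f_{\mathcal S_t^2}(X_{t-1})-V_{t-1}\big)\ \text{ otherwise,}$$ $$\zeta_t=\operatorname*{argmin}_{\zeta\in T_{X_t}}\Big\{\langle V_t,\zeta\rangle+\tfrac1{2\gamma}\|\zeta\|^2+h(X_t+\zeta)\Big\},\qquad X_{t+1}=\mathrm{Retr}_{X_t}(\eta\zeta_t),$$ where $\Gamma_{X_{t-1}}^{X_t}$ is the transport along $\eta\zeta_{t-1}$. The output is $X_\nu$, with $\nu$ uniform on $\{1,\dots,T\}$ and independent of the mini-batches. In the finite-sum case a mini-batch of size $k$ is a uniformly random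 $k$-element subset of $\{1,\dots,n\}$; in the online case it consists of $k$ i.i.d. samples of $\pi$. One IFO call evaluates one $\nabla f_i$ at one point. Assume that, almost surely, $\mathrm{Retr}_{X_t}(\tau\eta\zeta_t)\in\mathcal U$ for all $t<T$, $\tau\in[0,1]$ (so all iterates lie in $\mathcal U$). Let $\xi(X)=\operatorname{argmin}_{\xi\in T_X}\{\langle\nabla f(X),\xi\rangle+\frac1{2\gamma}\|\xi\|^2+h(X+\xi)\}$. The output is an *$\epsilon$-stochastic stationary point* if $\mathbb E\,\|X_\nu-\mathrm{Retr}_{X_\nu}(\xi(X_\nu))\|/\gamma\le\epsilon$. **Theorem.** There is a constant $\Theta_0>0$, depending only on $\mathrm{Retr}$, $\Gamma$ (with $M_1,M_2$), $c_E$, $L_H$ and $G$, such that for every $\Theta\ge\Theta_0$ the following holds for R-ProxSPB with $$\gamma=\tfrac25,\qquad \eta=\min\Big(\frac1{2(L_R/2+L_hM_2)},\frac1{\sqrt{2c_E\Theta^2}}\Big),\qquad |\mathcal S_t^2|=q .$$ Let $F(X_0)-F(X^*)\le\Delta$ and $0<\epsilon\le1$. The constants below depend only on $\mathrm{Retr}$,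 $\Gamma$, $M_1,M_2,c_E,L_H,G,\Theta,L_R,L_h,\Delta$ and, in (ii), on $\sigma,a_1,a_2$ ($C_2$ there also on $b$); they do not depend on $\epsilon$, on $n$ or on the functions. (i) *Finite-sum case*, $q=\sqrt n$ (rounded down or up to an integer), $|\mathcal S_t^1|=n$. There are $C_1,C_2>0$ such that for every $T\ge C_1\epsilon^{-2}$ the output is an $\epsilon$-stochastic stationary point; and with $T=\lceil C_1\epsilon^{-2}\rceil$ iterations the total number of IFO calls is at most $C_2(n+\sqrt n\,\epsilon^{-2})$. (ii) *Online case*, $q$ of order $\epsilon^{-1}$ and $|\mathcal S_t^1|=s$ of order $\epsilon^{-2}$ with a large enough constant. Precisely: for all $a_1,a_2>0$ there are $b_0,C_1>0$ such that for each $b\ge b_0$ there is $C_2>0$ so that, whenever $a_1\epsilon^{-1}\le q\le a_2\epsilon^{-1}$ and $b_0\epsilon^{-2}\le s\le b\,\epsilon^{-2}$, for every $T\ge C_1\epsilon^{-2}$ the output is an $\epsilon$-stochastic stationary point; and with $T=\lceil C_1\epsilon^{-2}\rceil$ iterations the total number of IFO calls is at most $C_2\epsilon^{-3}$. -/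

import Mathlib

open MeasureTheory ProbabilityTheory Set Filter Topology

/-- The ambient Euclidean space of real `d × r` matrices. Its norm and inner product are the
Frobenius norm and the Frobenius (trace) inner product. -/
abbrev Amb (d r : ℕ) : Type := EuclideanSpace ℝ (Fin d × Fin r)

/-- A point of the ambient space as a matrix. -/
def Amb.mat {d r : ℕ} (X : Amb d r) : Matrix (Fin d) (Fin r) ℝ :=
  Matrix.of fun i j => X (i, j)

/-- The Stiefel manifold `St(d, r) = {X : Xᵀ X = I}`. -/
def stiefel (d r : ℕ) : Set (Amb d r) := {X | X.mat.transpose * X.mat = 1}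

/-- The tangent space `{ξ : ξᵀ X + Xᵀ ξ = 0}` of the Stiefel manifold at `X`. -/
def tangent {d r : ℕ} (X : Amb d r) : Submodule ℝ (Amb d r) where
  carrier := {ξ | ξ.mat.transpose * X.mat + X.mat.transpose * ξ.mat = 0}
  zero_mem' := by
    ext i j
    simp [Amb.mat, Matrix.mul_apply]
  add_mem' := by
    intro a b ha hb
    have e : (a + b).mat = a.mat + b.mat := by ext i j; simp [Amb.mat]
    simp only [mem_ofPred_eq] at ha hb ⊢
    rw [e, Matrix.transpose_add, Matrix.add_mul, Matrix.mul_add, add_add_add_comm, ha, hb, add_zero]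
  smul_mem' := by
    intro c a ha
    have e : (c • a).mat = c • a.mat := by ext i j; simp [Amb.mat]
    simp only [mem_ofPred_eq] at ha ⊢
    rw [e, Matrix.transpose_smul, Matrix.smul_mul, Matrix.mul_smul, ← smul_add, ha, smul_zero]

/-- `Retr` (only its values `Retr X ξ` with `X ∈ St(d, r)`, `ξ ∈ T_X` matter) is a retraction on the
Stiefel manifold. The tangent bundle is an embedded submanifold of `Amb d r × Amb d r`, and
`ContDiffOn` on it is smoothness in the sense of manifolds. -/
structure IsRetraction {d r : ℕ} (Retr : Amb d r → Amb d r → Amb d r) : Prop where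
  mapsTo : ∀ X ∈ stiefel d r, ∀ ξ ∈ tangent X, Retr X ξ ∈ stiefel d r
  smooth : ContDiffOn ℝ ((⊤ : ℕ∞) : WithTop ℕ∞) (fun p : Amb d r × Amb d r => Retr p.1 p.2)
    {p | p.1 ∈ stiefel d r ∧ p.2 ∈ tangent p.1}
  zero : ∀ X ∈ stiefel d r, Retr X 0 = X
  first_order : ∀ X ∈ stiefel d r,
    Tendsto (fun ξ => ‖Retr X ξ - (X + ξ)‖ / ‖ξ‖) (𝓝[(tangent X : Set (Amb d r)) \ {0}] 0) (𝓝 0)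

/-- `Γ` is an isometric vector transport associated with `Retr`: `Γ X ξ ζ` is the transport of
`ζ ∈ T_X` from `X` to `Y = Retr X ξ`, usually written `Γ_X^Y ζ`. -/
structure IsIsometricTransport {d r : ℕ} (Retr : Amb d r → Amb d r → Amb d r)
    (Γ : Amb d r → Amb d r → Amb d r → Amb d r) : Prop where
  mapsTo : ∀ X ∈ stiefel d r, ∀ ξ ∈ tangent X, ∀ ζ ∈ tangent X, Γ X ξ ζ ∈ tangent (Retr X ξ)
  smooth : ContDiffOn ℝ ((⊤ : ℕ∞) : WithTop ℕ∞) (fun p : Amb d r × Amb d r × Amb d r => Γ p.1 p.2.1 p.2.2)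
    {p | p.1 ∈ stiefel d r ∧ p.2.1 ∈ tangent p.1 ∧ p.2.2 ∈ tangent p.1}
  zero : ∀ X ∈ stiefel d r, ∀ ζ ∈ tangent X, Γ X 0 ζ = ζ
  add : ∀ X ∈ stiefel d r, ∀ ξ ∈ tangent X, ∀ ζ₁ ∈ tangent X, ∀ ζ₂ ∈ tangent X,
    Γ X ξ (ζ₁ + ζ₂) = Γ X ξ ζ₁ + Γ X ξ ζ₂
  smul : ∀ X ∈ stiefel d r, ∀ ξ ∈ tangent X, ∀ c : ℝ, ∀ ζ ∈ tangent X,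
    Γ X ξ (c • ζ) = c • Γ X ξ ζ
  isometric : ∀ X ∈ stiefel d r, ∀ ξ ∈ tangent X, ∀ ζ ∈ tangent X, ‖Γ X ξ ζ‖ = ‖ζ‖

/-- `U` is totally retractive with radius `ρ`: for every `X ∈ U`, `Retr_X` is a diffeomorphism from
the ball of radius `ρ` in `T_X` onto its image, and this image contains `U`. -/
def IsTotallyRetractive {d r : ℕ} (Retr : Amb d r → Amb d r → Amb d r) (U : Set (Amb d r))
    (ρ : ℝ) : Prop :=
  0 < ρ ∧ ∀ X ∈ U,
    U ⊆ Retr X '' {ξ | ξ ∈ tangent X ∧ ‖ξ‖ < ρ} ∧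
    ∃ inv : Amb d r → Amb d r,
      ContDiffOn ℝ ((⊤ : ℕ∞) : WithTop ℕ∞) inv (Retr X '' {ξ | ξ ∈ tangent X ∧ ‖ξ‖ < ρ}) ∧
      ∀ ξ ∈ tangent X, ‖ξ‖ < ρ → inv (Retr X ξ) = ξ

/-- The standing assumptions on a composite problem `min_{X ∈ St(d,r)} fbar X + h X` with component
functions `f i` (`fbar` is their mean), on the neighbourhood `U` of the optimum `Xs`, and on the
constants. -/
structure ProblemAssumptions {d r : ℕ} (Retr : Amb d r → Amb d r → Amb d r) {ι : Type*}
    (f : ι → Amb d r → ℝ) (fbar h : Amb d r → ℝ) (U : Set (Amb d r)) (ρ : ℝ) (Xs : Amb d r)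
    (cE LH LR G Lh : ℝ) : Prop where
  smooth_component : ∀ i, ContDiff ℝ 2 (f i)
  smooth_mean : ContDiff ℝ 2 fbar
  hessian_bound : ∀ i, ∀ X ∈ stiefel d r, ‖fderiv ℝ (gradient (f i)) X‖ ≤ LH
  gradient_bound : ∀ i, ∀ X ∈ stiefel d r, ‖gradient (f i) X‖ ≤ G
  retr_hessian_upper : ∀ X ∈ U, ∀ ξ ∈ tangent X, ‖ξ‖ = 1 → ∀ t : ℝ, 0 ≤ t →
    (∀ τ ∈ Icc 0 t, Retr X (τ • ξ) ∈ U) →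
    iteratedDeriv 2 (fun s : ℝ => fbar (Retr X (s • ξ))) t ≤ LR
  h_convex : ConvexOn ℝ univ h
  h_lipschitz : ∀ X ∈ stiefel d r, ∀ Y ∈ stiefel d r, |h X - h Y| ≤ Lh * ‖X - Y‖
  optimum_mem : Xs ∈ stiefel d r
  optimum : ∀ Y ∈ stiefel d r, fbar Xs + h Xs ≤ fbar Y + h Y
  nhd_subset : U ⊆ stiefel d r
  nhd : U ∈ 𝓝[stiefel d r] Xs
  totally_retractive : IsTotallyRetractive Retr U ρ
  /-- `‖Retr_X⁻¹ Y‖ ≤ cE ‖ξ‖` whenever `Retr_X ξ = Y`; here `ξ₀ = Retr_X⁻¹ Y`. -/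
  inv_bound : ∀ X ∈ U, ∀ Y ∈ U, ∀ ξ₀ ∈ tangent X, ‖ξ₀‖ < ρ → Retr X ξ₀ = Y →
    ∀ ξ ∈ tangent X, Retr X ξ = Y → ‖ξ₀‖ ≤ cE * ‖ξ‖

/-- `ζ` minimizes `⟨V, ζ⟩ + ‖ζ‖² / (2γ) + h (X + ζ)` over the tangent space at `X`. -/
def IsProxDir {d r : ℕ} (h : Amb d r → ℝ) (γ : ℝ) (X V ζ : Amb d r) : Prop :=
  ζ ∈ tangent X ∧ ∀ ζ' ∈ tangent X,
    inner ℝ V ζ + 1 / (2 * γ) * ‖ζ‖ ^ 2 + h (X + ζ) ≤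
      inner ℝ V ζ' + 1 / (2 * γ) * ‖ζ'‖ ^ 2 + h (X + ζ')

/-- The minimizer of the proximal subproblem (it exists and is unique for convex `h`, `γ > 0`). -/
noncomputable def proxDir {d r : ℕ} (h : Amb d r → ℝ) (γ : ℝ) (X V : Amb d r) : Amb d r :=
  Classical.epsilon (IsProxDir h γ X V)

/-- The stationarity measure `G(X, ∇f(X), γ) = (X - Retr_X ξ) / γ`, where `ξ` solves the proximal
subproblem with the full gradient. -/
noncomputable def gradMap {d r : ℕ} (Retr : Amb d r → Amb d r → Amb d r) (fbar h : Amb d r → ℝ)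
    (γ : ℝ) (X : Amb d r) : Amb d r :=
  γ⁻¹ • (X - Retr X (proxDir h γ X (gradient fbar X)))

/-- The mini-batch gradient `∇f_S(X) = |S|⁻¹ ∑_{i ∈ S} ∇f_i(X)`. -/
noncomputable def batchGrad {d r : ℕ} {ι : Type*} (f : ι → Amb d r → ℝ) (S : Multiset ι)
    (X : Amb d r) : Amb d r :=
  (S.card : ℝ)⁻¹ • (S.map fun i => gradient (f i) X).sum

/-- The memory of the algorithm before iteration `t`: the iterate `X = X_t`, the previous iterate
`Xprev = X_{t-1}`, the previous tangent step `step = η ζ_{t-1}` (so `X = Retr Xprev step`), the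
previous estimator `V = V_{t-1}`, and the number `calls` of oracle calls made so far. -/
structure SPBState (d r : ℕ) where
  X : Amb d r
  Xprev : Amb d r
  step : Amb d r
  V : Amb d r
  calls : ℕ

/-- The gradient estimator of iteration `t` on the mini-batch `S`: a plain mini-batch gradient when
`q ∣ t`, the R-SARAH estimator otherwise. The transport acts on tangent vectors, so it is applied to
the tangential component of its argument. -/
noncomputable def spbEstimator {d r : ℕ} {ι : Type*} (Γ : Amb d r → Amb d r → Amb d r → Amb d r)
    (f : ι → Amb d r → ℝ) (q t : ℕ) (S : Multiset ι) (s : SPBState d r) : Amb d r :=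
  if t % q = 0 then batchGrad f S s.X
  else batchGrad f S s.X -
    Γ s.Xprev s.step ((tangent s.Xprev).starProjection (batchGrad f S s.Xprev - s.V))

/-- Iteration `t` of R-ProxSPB. One oracle call is one evaluation of a component gradient at one
point: `|S|` calls when `q ∣ t`, and `2 |S|` calls (at `X_t` and at `X_{t-1}`) otherwise. -/
noncomputable def spbStep {d r : ℕ} {ι : Type*} (Retr : Amb d r → Amb d r → Amb d r)
    (Γ : Amb d r → Amb d r → Amb d r → Amb d r) (f : ι → Amb d r → ℝ) (h : Amb d r → ℝ)
    (η γ : ℝ) (q t : ℕ) (S : Multiset ι) (s : SPBState d r) : SPBState d r :=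
  let V := spbEstimator Γ f q t S s
  let ζ := proxDir h γ s.X V
  { X := Retr s.X (η • ζ)
    Xprev := s.X
    step := η • ζ
    V := V
    calls := s.calls + if t % q = 0 then S.card else 2 * S.card }

/-- The state of R-ProxSPB after `t` iterations from `X₀` along the mini-batches `S 0, S 1, …`. -/
noncomputable def spbRun {d r : ℕ} {ι : Type*} (Retr : Amb d r → Amb d r → Amb d r)
    (Γ : Amb d r → Amb d r → Amb d r → Amb d r) (f : ι → Amb d r → ℝ) (h : Amb d r → ℝ)
    (η γ : ℝ) (q : ℕ) (X₀ : Amb d r) (S : ℕ → Multiset ι) : ℕ → SPBState d r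
  | 0 => ⟨X₀, X₀, 0, 0, 0⟩
  | t + 1 => spbStep Retr Γ f h η γ q t (S t) (spbRun Retr Γ f h η γ q X₀ S t)

/-- The first `T` iterations stay in `U`, together with the retraction curves that join them. -/
def StaysIn {d r : ℕ} (Retr : Amb d r → Amb d r → Amb d r) (U : Set (Amb d r))
    (run : ℕ → SPBState d r) (T : ℕ) : Prop :=
  ∀ t < T, ∀ τ ∈ Icc (0 : ℝ) 1, Retr (run t).X (τ • (run (t + 1)).step) ∈ U

/-- The step size `η = min(1 / (2 (L_R/2 + L_h M₂)), 1 / √(2 c_E Θ²))`. -/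
noncomputable def spbEta (LR Lh M₂ cE Θ : ℝ) : ℝ :=
  min (1 / (2 * (LR / 2 + Lh * M₂))) (1 / Real.sqrt (2 * cE * Θ ^ 2))

/-- The random point `Y` is an `ε`-stochastic stationary point. -/
def IsEpsStochStationary {d r : ℕ} {Ω : Type*} [MeasurableSpace Ω] (μ : Measure Ω)
    (Retr : Amb d r → Amb d r → Amb d r) (fbar h : Amb d r → ℝ) (γ ε : ℝ) (Y : Ω → Amb d r) :
    Prop :=
  Integrable (fun ω => ‖gradMap Retr fbar h γ (Y ω)‖) μ ∧
    ∫ ω, ‖gradMap Retr fbar h γ (Y ω)‖ ∂μ ≤ ε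

/-- The discrete measurable structure on the (finitely many) subsets of `{1, …, n}`. -/
instance instMeasurableSpaceFinsetFin (n : ℕ) : MeasurableSpace (Finset (Fin n)) := ⊤

/-- `S` is a uniformly random `k`-element subset of `{1, …, n}`. -/
def IsUniformSubset {Ω : Type*} [MeasurableSpace Ω] (μ : Measure Ω) {n : ℕ}
    (S : Ω → Finset (Fin n)) (k : ℕ) : Prop :=
  Measurable S ∧ (∀ ω, (S ω).card = k) ∧
    ∀ A : Finset (Fin n), A.card = k → μ (S ⁻¹' {A}) = ((n.choose k : ℕ) : ENNReal)⁻¹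

/-- `ν` is uniformly distributed on `{1, …, T}`. -/
def IsUniformIndex {Ω : Type*} [MeasurableSpace Ω] (μ : Measure Ω) (ν : Ω → ℕ) (T : ℕ) : Prop :=
  Measurable ν ∧ (∀ ω, ν ω ∈ Icc 1 T) ∧ ∀ k ∈ Icc 1 T, μ (ν ⁻¹' {k}) = ((T : ℕ) : ENNReal)⁻¹

/-- The online mini-batch of size `k`: the first `k` of the samples `x 0, x 1, …`. -/
def onlineBatch {ι : Type*} (k : ℕ) (x : ℕ → ι) : Multiset ι := (Multiset.range k).map x

/-! Write `e_t` for the tangential part at `X_t` of `V_t - ∇f(X_t)`. The proximal problem is posed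
on the tangent space, so `ζ_t` feels an error of `V_t` only through `e_t` (`IsProxDir.norm_sub_le`),
and everything reduces to playing `‖e_t‖²` against `‖η ζ_t‖²`.

Error. Between restarts, `e_{t+1}` is the transport of `e_t` plus the fluctuation of a mini-batch
mean of transported gradient differences. Given the past this fluctuation is centred, with second
moment at most `K² / q * ‖η ζ_t‖²`, where `K` is the Lipschitz constant of the tangential gradients
up to transport (`exists_transport_lipschitz`). The transport is isometric and the cross term
vanishes, so the errors add without amplification (`lintegral_error_recursion`). A step influences
at most `q` later errors, which cancels the `1 / q`: the sum of `E‖e_t‖²` over `T` iterations is at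
most `T v + K²` times the sum of `E‖η ζ_t‖²` (`sum_le_of_restarted_recursion`), where `v` is the
variance of a restart.

Descent. One iteration lowers `F` by `3 / (8 η) * ‖η ζ_t‖²`, up to a loss `2 η ‖e_t‖²`
(`spb_descent`). The choice of `Θ₀` gives `16 K² η² ≤ 1`, so the two inequalities close up and bound
the sum of the expected squared stationarity measures by a constant times `Δ / η + T v`
(`sum_integral_gradMap_sq_le`). With full restarts `v = 0`; online `v = σ² / s`, of order `ε²`.
Young's inequality then passes from squares to the mean at a uniform index.

Two points need care because little is known off the manifold. First, `h` is Lipschitz only on the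
Stiefel manifold, while the proximal model evaluates it at `X + ξ`. Convexity repairs this: the
polar factor of `X + ξ` is a convex combination of `X + ξ` and of Stiefel points obtained by
flipping one singular direction (`exists_near_stiefel_le_add_tangent`). The price is an absolute
multiple of `L_h ‖ξ‖²`, absorbed into `L_h M₂ ‖ξ‖²` because `M₂ ≥ 1/3` whenever a nonzero tangent
vector exists (`third_le_of_retraction`). Second, online, gradients are bounded only on the
manifold, so the mean and the gradient are interchanged only in tangent directions, by
differentiating along retraction curves (`starProjection_gradient_mean`); this is enough since only
tangential errors matter.

Probabilistically, each state is a measurable function of the earlier batches. The proximal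
direction is an arbitrary choice of minimizer, but it is unique and depends continuously on its data
(`continuousOn_proxDir`), which makes it measurable. -/

/-! ### The Stiefel manifold, its tangent spaces and their orthogonal projections. -/

section Geometry

variable {d r : ℕ}

/-- The point of the ambient space with a given matrix. -/
noncomputable def Amb.ofMat (A : Matrix (Fin d) (Fin r) ℝ) : Amb d r :=
  WithLp.toLp 2 fun p => A p.1 p.2

@[simp] lemma Amb.mat_ofMat (A : Matrix (Fin d) (Fin r) ℝ) : (Amb.ofMat A).mat = A := rfl

@[simp] lemma Amb.ofMat_mat (X : Amb d r) : Amb.ofMat X.mat = X := rfl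

@[simp] lemma Amb.mat_add (X Y : Amb d r) : (X + Y).mat = X.mat + Y.mat := rfl

@[simp] lemma Amb.mat_sub (X Y : Amb d r) : (X - Y).mat = X.mat - Y.mat := rfl

@[simp] lemma Amb.mat_smul (c : ℝ) (X : Amb d r) : (c • X).mat = c • X.mat := rfl

lemma Amb.mat_injective : Function.Injective (Amb.mat : Amb d r → Matrix (Fin d) (Fin r) ℝ) :=
  fun X Y h => by rw [← Amb.ofMat_mat X, h, Amb.ofMat_mat]

lemma Amb.inner_eq_trace (X Y : Amb d r) : inner ℝ X Y = (X.mat.transpose * Y.mat).trace := by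
  rw [PiLp.inner_apply, Fintype.sum_prod_type, Finset.sum_comm]
  simp [Matrix.trace, Matrix.mul_apply, Amb.mat, mul_comm]

lemma Amb.norm_sq_eq_trace (X : Amb d r) : ‖X‖ ^ 2 = (X.mat.transpose * X.mat).trace := by
  rw [← real_inner_self_eq_norm_sq, Amb.inner_eq_trace]

lemma Amb.norm_sq_eq_sum (X : Amb d r) : ‖X‖ ^ 2 = ∑ j, ∑ i, X.mat i j ^ 2 := by
  rw [Amb.norm_sq_eq_trace]
  simp [Matrix.trace, Matrix.mul_apply, sq]

lemma mem_stiefel {X : Amb d r} : X ∈ stiefel d r ↔ X.mat.transpose * X.mat = 1 := Iff.rfl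

lemma mem_tangent {X ξ : Amb d r} :
    ξ ∈ tangent X ↔ ξ.mat.transpose * X.mat + X.mat.transpose * ξ.mat = 0 := Iff.rfl

lemma norm_sq_of_mem_stiefel {X : Amb d r} (hX : X ∈ stiefel d r) : ‖X‖ ^ 2 = r := by
  rw [Amb.norm_sq_eq_trace, mem_stiefel.1 hX]; simp

lemma norm_of_mem_stiefel {X : Amb d r} (hX : X ∈ stiefel d r) : ‖X‖ = √r := by
  rw [← norm_sq_of_mem_stiefel hX, Real.sqrt_sq (norm_nonneg _)]

open scoped Matrix.Norms.Frobenius in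
lemma Amb.norm_mat (X : Amb d r) : ‖X.mat‖ = ‖X‖ := by
  rw [Matrix.frobenius_norm_def, EuclideanSpace.norm_eq, Real.sqrt_eq_rpow, Fintype.sum_prod_type]
  simp [Amb.mat]

lemma Amb.continuous_mat : Continuous (Amb.mat : Amb d r → Matrix (Fin d) (Fin r) ℝ) := by
  refine continuous_pi fun i => continuous_pi fun j => ?_
  exact (EuclideanSpace.proj (𝕜 := ℝ) (i, j)).continuous

lemma Amb.continuous_ofMat : Continuous (Amb.ofMat : Matrix (Fin d) (Fin r) ℝ → Amb d r) := by
  refine (PiLp.continuous_toLp 2 _).comp (continuous_pi fun p => ?_)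
  exact (continuous_apply p.2).comp (continuous_apply p.1)

lemma isClosed_stiefel : IsClosed (stiefel d r) :=
  isClosed_eq ((Amb.continuous_mat.matrix_transpose).matrix_mul Amb.continuous_mat)
    continuous_const

lemma isCompact_stiefel : IsCompact (stiefel d r) :=
  Metric.isCompact_of_isClosed_isBounded isClosed_stiefel
    (isBounded_iff_forall_norm_le.2 ⟨√r, fun _ hX => (norm_of_mem_stiefel hX).le⟩)

lemma isClosed_tangentBundle :
    IsClosed {p : Amb d r × Amb d r | p.1 ∈ stiefel d r ∧ p.2 ∈ tangent p.1} := by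
  have h1 := Amb.continuous_mat.comp (continuous_fst (X := Amb d r) (Y := Amb d r))
  have h2 := Amb.continuous_mat.comp (continuous_snd (X := Amb d r) (Y := Amb d r))
  refine (isClosed_stiefel.preimage continuous_fst).inter ?_
  exact isClosed_eq ((h2.matrix_transpose.matrix_mul h1).add (h1.matrix_transpose.matrix_mul h2))
    continuous_const

/-- The explicit formula `g - X (Xᵀ g + gᵀ X) / 2` for the projection onto the tangent space. -/
noncomputable def tangentProj (X g : Amb d r) : Amb d r :=
  g - (1 / 2 : ℝ) • Amb.ofMat (X.mat * (X.mat.transpose * g.mat + g.mat.transpose * X.mat))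

/-- The inner product is the trace of `S * (Xᵀ τ)`; tangency makes `Xᵀ τ` skew, and a symmetric
matrix is orthogonal to a skew one. So the matrices `X S` with `S` symmetric are normal directions.
-/
lemma inner_eq_zero_of_mem_tangent {X τ : Amb d r} (hτ : τ ∈ tangent X)
    {S : Matrix (Fin r) (Fin r) ℝ} (hS : S.transpose = S) :
    inner ℝ (Amb.ofMat (X.mat * S)) τ = 0 := by
  have h := mem_tangent.1 hτ
  have e1 : (S * (X.mat.transpose * τ.mat)).trace = (S * (τ.mat.transpose * X.mat)).trace := by
    rw [← Matrix.trace_transpose, Matrix.transpose_mul, hS, Matrix.transpose_mul,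
      Matrix.transpose_transpose, Matrix.trace_mul_comm]
  have e2 := congrArg (fun A => (S * A).trace) h
  simp only [Matrix.mul_add, Matrix.trace_add, Matrix.mul_zero, Matrix.trace_zero] at e2
  rw [Amb.inner_eq_trace, Amb.mat_ofMat, Matrix.transpose_mul, hS, Matrix.mul_assoc]
  linarith

lemma starProjection_tangent {X : Amb d r} (hX : X ∈ stiefel d r) (g : Amb d r) :
    (tangent X).starProjection g = tangentProj X g := by
  have hX' := mem_stiefel.1 hX
  have hS : (X.mat.transpose * g.mat + g.mat.transpose * X.mat).transpose
      = X.mat.transpose * g.mat + g.mat.transpose * X.mat := by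
    simp [Matrix.transpose_add, Matrix.transpose_mul, add_comm]
  refine Submodule.eq_starProjection_of_mem_of_inner_eq_zero ?_ ?_
  · rw [mem_tangent]
    have e : X.mat.transpose * (X.mat * (X.mat.transpose * g.mat + g.mat.transpose * X.mat))
        = X.mat.transpose * g.mat + g.mat.transpose * X.mat := by
      rw [← Matrix.mul_assoc, hX', Matrix.one_mul]
    have e' := congrArg Matrix.transpose e
    rw [Matrix.transpose_mul, Matrix.transpose_transpose, hS] at e'
    simp only [tangentProj, Amb.mat_sub, Amb.mat_smul, Amb.mat_ofMat, Matrix.mul_sub,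
      Matrix.transpose_sub, Matrix.sub_mul, Matrix.mul_smul, Matrix.smul_mul,
      Matrix.transpose_smul, e, e']
    module
  · intro w hw
    have : g - tangentProj X g = (1 / 2 : ℝ) • Amb.ofMat
        (X.mat * (X.mat.transpose * g.mat + g.mat.transpose * X.mat)) := by simp [tangentProj]
    rw [this, inner_smul_left, inner_eq_zero_of_mem_tangent hw hS, mul_zero]

lemma continuous_tangentProj : Continuous fun p : Amb d r × Amb d r => tangentProj p.1 p.2 := by
  have h1 := Amb.continuous_mat.comp (continuous_fst (X := Amb d r) (Y := Amb d r))
  have h2 := Amb.continuous_mat.comp (continuous_snd (X := Amb d r) (Y := Amb d r))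
  refine continuous_snd.sub ((Amb.continuous_ofMat.comp ?_).const_smul (1 / 2 : ℝ))
  exact h1.matrix_mul ((h1.matrix_transpose.matrix_mul h2).add (h2.matrix_transpose.matrix_mul h1))

-- The normal part `X (Xᵀ g + gᵀ X) / 2` is quadratic in `X`, so its increment splits into two
-- terms, each with one factor `Y - X` and one Stiefel factor of norm `√r`.
open scoped Matrix.Norms.Frobenius in
lemma norm_starProjection_sub_le {X Y : Amb d r} (hX : X ∈ stiefel d r) (hY : Y ∈ stiefel d r)
    (g : Amb d r) :
    ‖(tangent Y).starProjection g - (tangent X).starProjection g‖ ≤ 2 * √r * ‖Y - X‖ * ‖g‖ := by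
  rw [starProjection_tangent hX, starProjection_tangent hY]
  set S : Amb d r → Matrix (Fin r) (Fin r) ℝ :=
    fun Z => Z.mat.transpose * g.mat + g.mat.transpose * Z.mat with hS
  have hSn : ∀ Z, ‖S Z‖ ≤ 2 * (‖Z‖ * ‖g‖) := by
    intro Z
    refine (norm_add_le _ _).trans ?_
    have h1 := Matrix.frobenius_norm_mul Z.mat.transpose g.mat
    have h2 := Matrix.frobenius_norm_mul g.mat.transpose Z.mat
    rw [Matrix.frobenius_norm_transpose, Amb.norm_mat, Amb.norm_mat] at h1 h2
    linarith
  have key : tangentProj Y g - tangentProj X g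
      = -((1 / 2 : ℝ) • (Amb.ofMat ((Y - X).mat * S Y + X.mat * S (Y - X)))) := by
    apply Amb.mat_injective
    simp only [tangentProj, hS, ← neg_smul, Amb.mat_sub, Amb.mat_smul, Amb.mat_ofMat, Matrix.sub_mul, Matrix.mul_sub,
      Matrix.transpose_sub, Matrix.mul_add]
    module
  rw [key, norm_neg, norm_smul, ← Amb.norm_mat, Amb.mat_ofMat]
  have h1 := Matrix.frobenius_norm_mul (Y - X).mat (S Y)
  have h2 := Matrix.frobenius_norm_mul X.mat (S (Y - X))
  have h3 := norm_add_le ((Y - X).mat * S Y) (X.mat * S (Y - X))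
  rw [Amb.norm_mat] at h1 h2
  have h4 := mul_le_mul_of_nonneg_left (hSn Y) (norm_nonneg (Y - X))
  have h5 := mul_le_mul_of_nonneg_left (hSn (Y - X)) (norm_nonneg X)
  rw [norm_of_mem_stiefel hX] at h2 h5
  rw [norm_of_mem_stiefel hY] at h4
  have : ‖(1 / 2 : ℝ)‖ = 1 / 2 := by norm_num
  rw [this]
  nlinarith

end Geometry

/-! ### Comparing a convex function on and off the manifold. -/

section OffManifold

variable {d r : ℕ}

/-- The stretching of the singular values of `X + ξ` for a tangent vector `ξ`: the map `Ψ` sends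
a list of (signed) singular values to the matrix with these singular values and the singular
vectors of `X + ξ`. -/
lemma exists_singular_frame {X ξ : Amb d r} (hX : X ∈ stiefel d r) (hξ : ξ ∈ tangent X) :
    ∃ (Ψ : (Fin r → ℝ) →ₗ[ℝ] Amb d r) (u : Fin r → ℝ), (∀ i, 0 ≤ u i) ∧
      (∀ m, ‖Ψ m‖ ^ 2 = ∑ i, m i ^ 2) ∧ (∀ m, (∀ i, m i * m i = 1) → Ψ m ∈ stiefel d r) ∧
      Ψ (fun i => 1 + u i) = X + ξ ∧ ∑ i, u i ≤ ‖ξ‖ ^ 2 / 2 := by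
  have hA : (ξ.mat.transpose * ξ.mat).IsHermitian := by
    simpa using Matrix.isHermitian_conjTranspose_mul_self ξ.mat
  have hpos : (ξ.mat.transpose * ξ.mat).PosSemidef := by
    simpa using Matrix.posSemidef_conjTranspose_mul_self ξ.mat
  set A := ξ.mat.transpose * ξ.mat with hAdef
  set V : Matrix (Fin r) (Fin r) ℝ := (hA.eigenvectorUnitary : Matrix (Fin r) (Fin r) ℝ) with hV
  have hVV : V.transpose * V = 1 := by
    have := Unitary.coe_star_mul_self hA.eigenvectorUnitary
    simpa [Matrix.star_eq_conjTranspose] using this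
  have hVV' : V * V.transpose = 1 := mul_eq_one_comm.1 hVV
  set l := hA.eigenvalues with hl
  have hl0 : ∀ i, 0 ≤ l i := hpos.eigenvalues_nonneg
  have hspec : A = V * Matrix.diagonal l * V.transpose := by
    have := hA.spectral_theorem
    rw [Unitary.conjStarAlgAut_apply] at this
    simpa [Matrix.star_eq_conjTranspose, Function.comp_def] using this
  set s : Fin r → ℝ := fun i => √(1 + l i) with hs
  have hs0 : ∀ i, 0 < s i := fun i => Real.sqrt_pos.2 (by linarith [hl0 i])
  have hss : ∀ i, s i * s i = 1 + l i := fun i => Real.mul_self_sqrt (by linarith [hl0 i])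
  set Z := (X + ξ).mat with hZ
  have hZZ : Z.transpose * Z = 1 + A := by
    have h1 := mem_stiefel.1 hX
    have h2 := mem_tangent.1 hξ
    rw [hZ, Amb.mat_add, Matrix.transpose_add, Matrix.add_mul, Matrix.mul_add, Matrix.mul_add, h1,
      ← hAdef]
    calc _ = 1 + (ξ.mat.transpose * X.mat + X.mat.transpose * ξ.mat) + A := by abel
      _ = _ := by rw [h2, add_zero]
  -- `Q diag(s) Vᵀ` is a singular value decomposition of `X + ξ`: tangency gives `Zᵀ Z = 1 + ξᵀ ξ`,
  -- so the singular values are `√(1 + l i) ≥ 1`.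
  set Q := Z * V * Matrix.diagonal (fun i => (s i)⁻¹) with hQ
  have hVAV : V.transpose * (1 + A) * V = Matrix.diagonal (fun i => 1 + l i) := by
    rw [Matrix.mul_add, Matrix.add_mul, Matrix.mul_one, hVV, hspec]
    calc _ = 1 + (V.transpose * V) * Matrix.diagonal l * (V.transpose * V) := by
          simp only [Matrix.mul_assoc]
      _ = _ := by
          rw [hVV, Matrix.one_mul, Matrix.mul_one, ← Matrix.diagonal_one, Matrix.diagonal_add]
  have hQQ : Q.transpose * Q = 1 := by
    calc Q.transpose * Q = Matrix.diagonal (fun i => (s i)⁻¹) *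
          (V.transpose * (Z.transpose * Z) * V) * Matrix.diagonal (fun i => (s i)⁻¹) := by
          simp only [hQ, Matrix.transpose_mul, Matrix.diagonal_transpose, Matrix.mul_assoc]
      _ = 1 := by
          rw [hZZ, hVAV, Matrix.diagonal_mul_diagonal, Matrix.diagonal_mul_diagonal,
            ← Matrix.diagonal_one]
          congr 1
          funext i
          have := (hs0 i).ne'
          rw [← hss i]
          field_simp
  have hgram : ∀ m : Fin r → ℝ, (Q * Matrix.diagonal m * V.transpose).transpose *
      (Q * Matrix.diagonal m * V.transpose)
      = V * Matrix.diagonal (fun i => m i * m i) * V.transpose := by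
    intro m
    calc _ = V * (Matrix.diagonal m * (Q.transpose * Q) * Matrix.diagonal m) * V.transpose := by
          simp only [Matrix.transpose_mul, Matrix.diagonal_transpose, Matrix.mul_assoc,
            Matrix.transpose_transpose]
      _ = _ := by rw [hQQ, Matrix.mul_one, Matrix.diagonal_mul_diagonal]
  refine ⟨⟨⟨fun m => Amb.ofMat (Q * Matrix.diagonal m * V.transpose), ?_⟩, ?_⟩,
    fun i => s i - 1, ?_, ?_, ?_, ?_, ?_⟩
  · intro m m'
    apply Amb.mat_injective
    rw [Amb.mat_add, Amb.mat_ofMat, Amb.mat_ofMat, Amb.mat_ofMat, ← Matrix.add_mul,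
      ← Matrix.mul_add, Matrix.diagonal_add]
    rfl
  · intro c m
    apply Amb.mat_injective
    simp only [RingHom.id_apply, Amb.mat_smul, Amb.mat_ofMat, Matrix.diagonal_smul,
      Matrix.mul_smul, Matrix.smul_mul]
  · intro i
    have : 1 ≤ s i := Real.one_le_sqrt.2 (by linarith [hl0 i])
    linarith
  · intro m
    simp only [LinearMap.coe_mk, AddHom.coe_mk]
    rw [Amb.norm_sq_eq_trace, Amb.mat_ofMat, hgram, Matrix.trace_mul_comm, ← Matrix.mul_assoc, hVV,
      Matrix.one_mul, Matrix.trace_diagonal]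
    simp only [sq]
  · intro m hm
    simp only [LinearMap.coe_mk, AddHom.coe_mk]
    rw [mem_stiefel, Amb.mat_ofMat, hgram]
    simp only [hm, Matrix.diagonal_one, Matrix.mul_one, hVV']
  · apply Amb.mat_injective
    simp only [LinearMap.coe_mk, AddHom.coe_mk, Amb.mat_ofMat, add_sub_cancel]
    rw [← hZ, hQ, Matrix.mul_assoc (Z * V), Matrix.diagonal_mul_diagonal]
    have : (fun i => (s i)⁻¹ * s i) = fun _ => (1 : ℝ) :=
      funext fun i => inv_mul_cancel₀ (hs0 i).ne'
    rw [this, Matrix.diagonal_one, Matrix.mul_one, Matrix.mul_assoc, hVV', Matrix.mul_one]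
  · have h1 : ‖ξ‖ ^ 2 = ∑ i, l i := by
      rw [Amb.norm_sq_eq_trace, ← hAdef, hA.trace_eq_sum_eigenvalues]; rfl
    rw [h1, Finset.sum_div]
    refine Finset.sum_le_sum fun i _ => ?_
    have := hss i
    nlinarith [sq_nonneg (s i - 1)]

/-- A convex function that is Lipschitz on the Stiefel manifold cannot drop fast along tangent
vectors, although nothing is assumed about it off the manifold. -/
lemma exists_near_stiefel_le_add_tangent {h : Amb d r → ℝ} (hc : ConvexOn ℝ univ h) {L : ℝ}
    (hL0 : 0 ≤ L) (hL : ∀ X ∈ stiefel d r, ∀ Y ∈ stiefel d r, |h X - h Y| ≤ L * ‖X - Y‖)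
    {X ξ : Amb d r} (hX : X ∈ stiefel d r) (hξ : ξ ∈ tangent X) :
    ∃ P ∈ stiefel d r, ‖P - (X + ξ)‖ ≤ ‖ξ‖ ^ 2 / 2 ∧ h P ≤ h (X + ξ) + L * (‖ξ‖ ^ 2 / 2) := by
  obtain ⟨Ψ, u, hu, hnorm, hmem, hZ, hsum⟩ := exists_singular_frame hX hξ
  have hP : Ψ (fun _ => 1) ∈ stiefel d r := hmem _ fun _ => by norm_num
  refine ⟨Ψ fun _ => 1, hP, ?_, ?_⟩
  · rw [← hZ, ← map_sub]
    refine le_trans (abs_le_of_sq_le_sq' ?_ (Finset.sum_nonneg fun i _ => hu i)).2 hsum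
    rw [hnorm]
    simp only [Pi.sub_apply, sub_add_cancel_left, neg_sq]
    exact Finset.sum_sq_le_sq_sum_of_nonneg fun i _ => hu i
  · have hJmem : ∀ k, Ψ (Function.update (fun _ => 1) k (-1)) ∈ stiefel d r := by
      intro k
      refine hmem _ fun i => ?_
      by_cases hik : i = k <;> simp [hik]
    have hdist : ∀ k, ‖Ψ (Function.update (fun _ => 1) k (-1)) - Ψ (fun _ => 1)‖ = 2 := by
      intro k
      have : ‖Ψ (Function.update (fun _ => 1) k (-1)) - Ψ (fun _ => 1)‖ ^ 2 = 2 ^ 2 := by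
        rw [← map_sub, hnorm, Finset.sum_eq_single k]
        · simp; norm_num
        · intro i _ hik; simp [hik]
        · simp
      exact (pow_left_inj₀ (norm_nonneg _) (by norm_num) (by norm_num)).1 this
    have hJ : ∀ k, h (Ψ (Function.update (fun _ => 1) k (-1))) ≤ h (Ψ fun _ => 1) + 2 * L := by
      intro k
      have := (abs_le.1 (hL _ (hJmem k) _ hP)).2
      rw [hdist k] at this
      linarith
    set c := ∑ i, u i / 2 with hcdef
    have hc0 : 0 ≤ c := Finset.sum_nonneg fun i _ => by have := hu i; positivity
    have hc2 : 2 * c = ∑ i, u i := by rw [hcdef, ← Finset.sum_div]; ring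
    -- In coordinate `i` the flips with weights `u k / 2` sum to `c - u i`, which cancels the excess
    -- of `1 + u i` and leaves `1 + c`. The weights `(1 + c)⁻¹` and `(1 + c)⁻¹ u k / 2` sum to `1`.
    have hcomb : (fun _ => 1 : Fin r → ℝ) = (1 + c)⁻¹ • (fun i => 1 + u i) +
        ∑ k, ((1 + c)⁻¹ * (u k / 2)) • Function.update (fun _ => (1 : ℝ)) k (-1) := by
      funext i
      have e : ∑ k, (1 + c)⁻¹ * (u k / 2) * Function.update (fun _ => (1 : ℝ)) k (-1) i
          = (1 + c)⁻¹ * (c - u i) := by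
        simp_rw [mul_assoc, ← Finset.mul_sum]
        congr 1
        have : ∀ k, u k / 2 * Function.update (fun _ => (1 : ℝ)) k (-1) i
            = u k / 2 - if k = i then u k else 0 := by
          intro k
          by_cases hik : i = k
          · subst hik; simp; ring
          · simp [hik, Ne.symm hik]
        simp_rw [this]
        rw [Finset.sum_sub_distrib]
        simp [hcdef]
      simp only [Pi.add_apply, Pi.smul_apply, Finset.sum_apply, smul_eq_mul]
      rw [e]
      have : 1 + c ≠ 0 := by positivity
      field_simp
      ring
    have hconv : h (Ψ fun _ => 1) ≤ (1 + c)⁻¹ * h (X + ξ) +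
        ∑ k, ((1 + c)⁻¹ * (u k / 2)) * h (Ψ (Function.update (fun _ => 1) k (-1))) := by
      have hj := hc.map_sum_le (t := (Finset.univ : Finset (Option (Fin r))))
        (w := fun o => o.elim (1 + c)⁻¹ fun k => (1 + c)⁻¹ * (u k / 2))
        (p := fun o => o.elim (X + ξ) fun k => Ψ (Function.update (fun _ => 1) k (-1)))
        ?_ ?_ fun _ _ => mem_univ _
      · simp only [Fintype.sum_option, Option.elim, smul_eq_mul] at hj
        rw [← hZ] at hj ⊢
        rw [← map_smul] at hj
        simp_rw [← map_smul] at hj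
        rwa [← map_sum, ← map_add, ← hcomb] at hj
      · rintro (_ | k) _
        · simp only [Option.elim]; positivity
        · have := hu k; simp only [Option.elim]; positivity
      · simp only [Fintype.sum_option, Option.elim]
        rw [← Finset.mul_sum, ← hcdef]
        have : 1 + c ≠ 0 := by positivity
        field_simp
    have h2 : ∑ k, ((1 + c)⁻¹ * (u k / 2)) * h (Ψ (Function.update (fun _ => 1) k (-1)))
        ≤ (1 + c)⁻¹ * c * (h (Ψ fun _ => 1) + 2 * L) := by
      rw [hcdef, Finset.mul_sum, Finset.sum_mul, ← hcdef]
      refine Finset.sum_le_sum fun k _ => mul_le_mul_of_nonneg_left (hJ k) ?_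
      have := hu k; positivity
    have h3 : (1 + c) * h (Ψ fun _ => 1) ≤ h (X + ξ) + c * (h (Ψ fun _ => 1) + 2 * L) := by
      have h4 := mul_le_mul_of_nonneg_left (hconv.trans (add_le_add_right h2 _))
        (by positivity : 0 ≤ 1 + c)
      have : 1 + c ≠ 0 := by positivity
      calc _ ≤ _ := h4
        _ = _ := by field_simp
    have h5 : L * (2 * c) ≤ L * (‖ξ‖ ^ 2 / 2) :=
      mul_le_mul_of_nonneg_left (hc2.le.trans hsum) hL0
    linarith

lemma sum_col_sq_add {X ξ : Amb d r} (hX : X ∈ stiefel d r) (hξ : ξ ∈ tangent X) (j : Fin r) :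
    ∑ i, (X + ξ).mat i j ^ 2 = 1 + ∑ i, ξ.mat i j ^ 2 := by
  have h1 := congrFun (congrFun (mem_stiefel.1 hX) j) j
  have h2 := congrFun (congrFun (mem_tangent.1 hξ) j) j
  simp only [Matrix.mul_apply, Matrix.transpose_apply, Matrix.one_apply_eq, Matrix.add_apply,
    Matrix.zero_apply, ← Finset.sum_add_distrib] at h1 h2
  have h3 : ∑ i, (X + ξ).mat i j ^ 2 = ∑ i, X.mat i j * X.mat i j
      + ∑ i, (ξ.mat i j * X.mat i j + X.mat i j * ξ.mat i j) + ∑ i, ξ.mat i j ^ 2 := by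
    rw [← Finset.sum_add_distrib, ← Finset.sum_add_distrib]
    refine Finset.sum_congr rfl fun i _ => ?_
    simp only [Amb.mat_add, Matrix.add_apply]
    ring
  rw [h3, h1, h2, add_zero]

/-- Each column of a Stiefel point `Y` is at least `√(1 + |ξⱼ|²) - 1` away from that of `X + ξ`. -/
lemma sqrt_sub_one_sq_le_sum_col {X ξ Y : Amb d r} (hX : X ∈ stiefel d r) (hξ : ξ ∈ tangent X)
    (hY : Y ∈ stiefel d r) (j : Fin r) :
    (√(1 + ∑ i, ξ.mat i j ^ 2) - 1) ^ 2 ≤ ∑ i, (Y - (X + ξ)).mat i j ^ 2 := by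
  set a : EuclideanSpace ℝ (Fin d) := WithLp.toLp 2 fun i => Y.mat i j
  set b : EuclideanSpace ℝ (Fin d) := WithLp.toLp 2 fun i => (X + ξ).mat i j
  have ha : ‖a‖ = 1 := by
    have h1 := congrFun (congrFun (mem_stiefel.1 hY) j) j
    simp only [Matrix.mul_apply, Matrix.transpose_apply, Matrix.one_apply_eq] at h1
    rw [EuclideanSpace.norm_eq]
    simp [a, sq, h1]
  have hb : ‖b‖ = √(1 + ∑ i, ξ.mat i j ^ 2) := by
    rw [← sum_col_sq_add hX hξ j, EuclideanSpace.norm_eq]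
    simp [b]
  have hab : ∑ i, (Y - (X + ξ)).mat i j ^ 2 = ‖a - b‖ ^ 2 := by
    rw [EuclideanSpace.norm_sq_eq]
    simp [a, b]
  rw [hab, ← hb, ← ha, norm_sub_rev]
  exact sq_le_sq' (by linarith [abs_norm_sub_norm_le b a, neg_abs_le (‖b‖ - ‖a‖)])
    (norm_sub_norm_le b a)

lemma mul_mem_tangent {X : Amb d r} (hX : X ∈ stiefel d r) {W : Matrix (Fin r) (Fin r) ℝ}
    (hW : W.transpose = -W) : Amb.ofMat (X.mat * W) ∈ tangent X := by
  rw [mem_tangent, Amb.mat_ofMat, Matrix.transpose_mul, hW, Matrix.mul_assoc,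
    mem_stiefel.1 hX, ← Matrix.mul_assoc, mem_stiefel.1 hX]
  simp

lemma sum_col_sq_mul {X : Amb d r} (hX : X ∈ stiefel d r) (W : Matrix (Fin r) (Fin r) ℝ)
    (j : Fin r) : ∑ i, (X.mat * W) i j ^ 2 = ∑ k, W k j ^ 2 := by
  have : (X.mat * W).transpose * (X.mat * W) = W.transpose * W := by
    rw [Matrix.transpose_mul, Matrix.mul_assoc, ← Matrix.mul_assoc _ X.mat, mem_stiefel.1 hX,
      Matrix.one_mul]
  have := congrFun (congrFun this j) j
  simpa only [Matrix.mul_apply, Matrix.transpose_apply, ← sq] using this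

/-- The second-order constant of a retraction cannot be small, unless the manifold is discrete. -/
lemma third_le_of_retraction {Retr : Amb d r → Amb d r → Amb d r}
    (hmaps : ∀ X ∈ stiefel d r, ∀ ξ ∈ tangent X, Retr X ξ ∈ stiefel d r) {M₂ : ℝ}
    (hRetr₂ : ∀ X ∈ stiefel d r, ∀ ξ ∈ tangent X, ‖Retr X ξ - (X + ξ)‖ ≤ M₂ * ‖ξ‖ ^ 2)
    {X ξ : Amb d r} (hX : X ∈ stiefel d r) (hξ : ξ ∈ tangent X) (hξ0 : ξ ≠ 0) :
    1 / 3 ≤ M₂ := by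
  -- Test vectors have some columns of squared length `1/16` and the others zero. Each nonzero
  -- column of `X + τ` is then at distance at least `3/100` from every unit vector, which bounds
  -- `M₂` from below.
  have hs : (103 / 100 : ℝ) ≤ √(1 + 1 / 16) := Real.le_sqrt_of_sq_le (by norm_num)
  have main : ∀ τ ∈ tangent X, ∀ J : Finset (Fin r), (∀ j ∈ J, ∑ i, τ.mat i j ^ 2 = 1 / 16) →
      ‖τ‖ ^ 2 = J.card * (1 / 16) → J.card * (3 / 100 : ℝ) ^ 2 ≤ (M₂ * (J.card * (1 / 16))) ^ 2 := by
    intro τ hτ J hJ hn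
    have h1 := hRetr₂ X hX τ hτ
    have h2 := Amb.norm_sq_eq_sum (Retr X τ - (X + τ))
    rw [hn] at h1
    refine le_trans ?_ (pow_le_pow_left₀ (norm_nonneg _) h1 2)
    rw [h2]
    calc (J.card : ℝ) * (3 / 100 : ℝ) ^ 2 = ∑ j ∈ J, (3 / 100 : ℝ) ^ 2 := by
          rw [Finset.sum_const, nsmul_eq_mul]
      _ ≤ ∑ j ∈ J, ∑ i, (Retr X τ - (X + τ)).mat i j ^ 2 := by
          refine Finset.sum_le_sum fun j hj => ?_
          refine le_trans ?_ (sqrt_sub_one_sq_le_sum_col hX hτ (hmaps X hX τ hτ) j)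
          rw [hJ j hj]
          exact pow_le_pow_left₀ (by norm_num) (by linarith) 2
      _ ≤ _ := Finset.sum_le_sum_of_subset_of_nonneg (Finset.subset_univ _)
          fun j _ _ => Finset.sum_nonneg fun i _ => sq_nonneg _
  have hM0 : 0 ≤ M₂ := by
    have h1 := (norm_nonneg _).trans (hRetr₂ X hX ξ hξ)
    exact nonneg_of_mul_nonneg_left h1 (by positivity)
  -- For `r ≥ 2` a rotation generator in two columns is a test vector at every `X`, and two columns
  -- still give `M₂ ≥ 1/3`. For `r = 1` the given `ξ`, rescaled, serves. For `r = 0` there is no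
  -- nonzero `ξ`.
  rcases Nat.lt_or_ge 1 r with hr | hr
  · let a : Fin r := ⟨0, by omega⟩
    let b : Fin r := ⟨1, hr⟩
    have hab : a ≠ b := by simp [a, b]
    set W : Matrix (Fin r) (Fin r) ℝ :=
      Matrix.single a b (1 / 4) - Matrix.single b a (1 / 4) with hW
    have hWt : W.transpose = -W := by simp [hW]
    have hWc : ∀ j, ∑ k, W k j ^ 2 = if j ∈ ({a, b} : Finset (Fin r)) then 1 / 16 else 0 := by
      intro j
      by_cases hja : j = a
      · subst hja
        rw [Finset.sum_eq_single b]
        · simp [hW, hab, hab.symm]; norm_num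
        · intro k _ hk; simp [hW, hab.symm, Ne.symm hk]
        · simp
      · by_cases hjb : j = b
        · subst hjb
          rw [Finset.sum_eq_single a]
          · simp [hW, hab]; norm_num
          · intro k _ hk; simp [hW, hab, Ne.symm hk]
          · simp
        · rw [Finset.sum_eq_zero]
          · simp [hja, hjb]
          · intro k _; simp [hW, Ne.symm hja, Ne.symm hjb]
    have hcol : ∀ j, ∑ i, (Amb.ofMat (X.mat * W)).mat i j ^ 2
        = if j ∈ ({a, b} : Finset (Fin r)) then 1 / 16 else 0 := by
      intro j; rw [Amb.mat_ofMat, sum_col_sq_mul hX, hWc]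
    have := main _ (mul_mem_tangent hX hWt) {a, b} (fun j hj => by rw [hcol, if_pos hj]) (by
      rw [Amb.norm_sq_eq_sum]
      simp_rw [hcol]
      rw [Finset.sum_ite_mem, Finset.univ_inter, Finset.sum_const, nsmul_eq_mul])
    rw [Finset.card_pair hab] at this
    norm_num at this
    nlinarith
  · have hn : 0 < ‖ξ‖ := norm_pos_iff.2 hξ0
    have hr1 : r = 1 := by
      by_contra hne
      have hr0 : r = 0 := by omega
      subst hr0
      exact hξ0 (Subsingleton.elim _ _)
    subst hr1
    have hn' : ‖(1 / (4 * ‖ξ‖)) • ξ‖ ^ 2 = 1 / 16 := by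
      rw [norm_smul, Real.norm_of_nonneg (by positivity)]
      field_simp
      norm_num
    have := main _ ((tangent X).smul_mem (1 / (4 * ‖ξ‖)) hξ) {0} (fun j _ => by
      rw [← hn', Amb.norm_sq_eq_sum, Fin.sum_univ_one, Subsingleton.elim j 0]) (by
      rw [hn']; simp)
    rw [Finset.card_singleton] at this
    norm_num at this
    nlinarith

/-- The detour through the polar factor `P` costs `L ‖ξ‖² / 2` for the value and `L ‖ξ‖² / 2` for
the distance, besides `L M₂ ‖ξ‖²` for the retraction. Since `1 ≤ 3 M₂` when `ξ ≠ 0`, the total is at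
most `4 L M₂ ‖ξ‖²`. -/
lemma h_retr_le {Retr : Amb d r → Amb d r → Amb d r}
    (hmaps : ∀ X ∈ stiefel d r, ∀ ξ ∈ tangent X, Retr X ξ ∈ stiefel d r) {M₂ : ℝ}
    (hRetr₂ : ∀ X ∈ stiefel d r, ∀ ξ ∈ tangent X, ‖Retr X ξ - (X + ξ)‖ ≤ M₂ * ‖ξ‖ ^ 2)
    (hzero : ∀ X ∈ stiefel d r, Retr X 0 = X)
    {h : Amb d r → ℝ} (hc : ConvexOn ℝ univ h) {L : ℝ}
    (hL0 : 0 ≤ L) (hL : ∀ X ∈ stiefel d r, ∀ Y ∈ stiefel d r, |h X - h Y| ≤ L * ‖X - Y‖)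
    {X ξ : Amb d r} (hX : X ∈ stiefel d r) (hξ : ξ ∈ tangent X) :
    h (Retr X ξ) ≤ h (X + ξ) + 4 * (L * M₂) * ‖ξ‖ ^ 2 := by
  by_cases hξ0 : ξ = 0
  · simp [hξ0, hzero X hX]
  have hM := third_le_of_retraction hmaps hRetr₂ hX hξ hξ0
  obtain ⟨P, hP, hPn, hPh⟩ := exists_near_stiefel_le_add_tangent hc hL0 hL hX hξ
  have h1 := (abs_le.1 (hL _ (hmaps X hX ξ hξ) P hP)).2
  have h2 : ‖Retr X ξ - P‖ ≤ M₂ * ‖ξ‖ ^ 2 + ‖ξ‖ ^ 2 / 2 := by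
    calc _ = ‖(Retr X ξ - (X + ξ)) - (P - (X + ξ))‖ := by congr 1; abel
      _ ≤ _ := (norm_sub_le _ _).trans (add_le_add (hRetr₂ X hX ξ hξ) hPn)
  have h3 := mul_le_mul_of_nonneg_left h2 hL0
  have h4 : L * ‖ξ‖ ^ 2 * 1 ≤ L * ‖ξ‖ ^ 2 * (3 * M₂) :=
    mul_le_mul_of_nonneg_left (by linarith) (by positivity)
  nlinarith

end OffManifold

/-! ### The proximal subproblem: existence, strong minimality, continuity in the data. -/

section Prox

variable {d r : ℕ} {h : Amb d r → ℝ} {γ : ℝ}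

lemma ConvexOn.continuous_amb (hc : ConvexOn ℝ univ h) : Continuous h :=
  hc.locallyLipschitz.continuous

/-- Along a ray from `X`, convexity bounds the drop at distance `‖ζ‖ > 1` by `‖ζ‖` times the drop at
distance `1`, and the latter is uniformly bounded by compactness. The quadratic term of the
subproblem therefore dominates, uniformly in `X`. -/
lemma exists_h_sub_le (hc : ConvexOn ℝ univ h) :
    ∃ C, 0 ≤ C ∧ ∀ X ∈ stiefel d r, ∀ ζ, h X - h (X + ζ) ≤ C * (1 + ‖ζ‖) := by
  obtain ⟨C, hC⟩ := (isCompact_closedBall (0 : Amb d r) (√r + 1)).exists_bound_of_continuousOn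
    hc.continuous_amb.continuousOn
  have hmem : ∀ X ∈ stiefel d r, ∀ ζ : Amb d r, ‖ζ‖ ≤ 1 →
      |h (X + ζ)| ≤ C := by
    intro X hX ζ hζ
    refine hC _ (mem_closedBall_zero_iff.2 ((norm_add_le _ _).trans ?_))
    rw [norm_of_mem_stiefel hX]
    linarith
  have key : ∀ X ∈ stiefel d r, ∀ ζ : Amb d r, ‖ζ‖ ≤ 1 → h X - h (X + ζ) ≤ 2 * |C| := by
    intro X hX ζ hζ
    have h1 := hmem X hX 0 (by simp)
    have h2 := hmem X hX ζ hζ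
    rw [add_zero] at h1
    linarith [(abs_le.1 h1).2, (abs_le.1 h2).1, le_abs_self C]
  refine ⟨2 * |C|, by positivity, fun X hX ζ => ?_⟩
  rcases le_or_gt ‖ζ‖ 1 with hζ | hζ
  · refine (key X hX ζ hζ).trans ?_
    nlinarith [norm_nonneg ζ, abs_nonneg C]
  · have hn : 0 < ‖ζ‖ := by linarith
    have h1 := key X hX (‖ζ‖⁻¹ • ζ) (by
      rw [norm_smul, norm_inv, norm_norm, inv_mul_cancel₀ hn.ne'])
    have hle : ‖ζ‖⁻¹ ≤ 1 := inv_le_one_of_one_le₀ hζ.le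
    have h2 := hc.2 (mem_univ X) (mem_univ (X + ζ)) (sub_nonneg.2 hle) (inv_nonneg.2 hn.le)
      (by ring)
    have e : (1 - ‖ζ‖⁻¹) • X + ‖ζ‖⁻¹ • (X + ζ) = X + ‖ζ‖⁻¹ • ζ := by module
    rw [e, smul_eq_mul, smul_eq_mul] at h2
    have h3 : ‖ζ‖⁻¹ * (h X - h (X + ζ)) ≤ 2 * |C| := by linarith
    rw [inv_mul_le_iff₀ hn] at h3
    nlinarith [abs_nonneg C]

lemma prox_coercive (hγ : 0 < γ) {C : ℝ} (hC0 : 0 ≤ C) {X V ζ : Amb d r}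
    (hC : h X - h (X + ζ) ≤ C * (1 + ‖ζ‖)) (hζ : 1 + 2 * γ * (‖V‖ + 2 * C) < ‖ζ‖) :
    h X < inner ℝ V ζ + 1 / (2 * γ) * ‖ζ‖ ^ 2 + h (X + ζ) := by
  have h1 := (abs_le.1 (abs_real_inner_le_norm V ζ)).1
  have hR : 0 ≤ 2 * γ * (‖V‖ + 2 * C) := by positivity
  have hn : 1 < ‖ζ‖ := by linarith
  have h2 : (‖V‖ + 2 * C) * ‖ζ‖ < 1 / (2 * γ) * ‖ζ‖ ^ 2 := by
    have : ‖V‖ + 2 * C < 1 / (2 * γ) * ‖ζ‖ := by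
      rw [one_div, ← div_eq_inv_mul, lt_div_iff₀ (by positivity)]; linarith
    nlinarith
  nlinarith

lemma exists_isProxDir (hc : ConvexOn ℝ univ h) (hγ : 0 < γ) {X : Amb d r} (hX : X ∈ stiefel d r)
    (V : Amb d r) : ∃ ζ, IsProxDir h γ X V ζ := by
  obtain ⟨C, hC0, hC⟩ := exists_h_sub_le hc
  set R := 1 + 2 * γ * (‖V‖ + 2 * C) with hR
  have hR0 : 0 ≤ R := by positivity
  have hcomp : IsCompact (Metric.closedBall (0 : Amb d r) R ∩ (tangent X : Set (Amb d r))) :=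
    (isCompact_closedBall _ _).inter_right (Submodule.closed_of_finiteDimensional _)
  have hcont : Continuous fun ζ : Amb d r =>
      inner ℝ V ζ + 1 / (2 * γ) * ‖ζ‖ ^ 2 + h (X + ζ) := by
    have := hc.continuous_amb
    fun_prop
  obtain ⟨ζ, hζ, hmin⟩ := hcomp.exists_isMinOn ⟨0, by simp [hR0]⟩ hcont.continuousOn
  refine ⟨ζ, hζ.2, fun ζ' hζ' => ?_⟩
  rcases le_or_gt ‖ζ'‖ R with hle | hlt
  · exact hmin ⟨mem_closedBall_zero_iff.2 hle, hζ'⟩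
  · have h0 := hmin (show (0 : Amb d r) ∈ _ from ⟨by simp [hR0], (tangent X).zero_mem⟩)
    have h1 := prox_coercive (V := V) hγ hC0 (hC X hX ζ') hlt
    simp only [inner_zero_right, norm_zero, add_zero, mem_ofPred_eq] at h0
    linarith

lemma isProxDir_proxDir (hc : ConvexOn ℝ univ h) (hγ : 0 < γ) {X : Amb d r}
    (hX : X ∈ stiefel d r) (V : Amb d r) : IsProxDir h γ X V (proxDir h γ X V) :=
  Classical.epsilon_spec (exists_isProxDir hc hγ hX V)

/-- Strong convexity: compare the minimizer with the point at parameter `t` on the segment towards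
`ζ'`, divide by `t`, and let `t` tend to `0`. -/
lemma IsProxDir.strong (hc : ConvexOn ℝ univ h) (hγ : 0 < γ) {X V ζ ζ' : Amb d r}
    (hζ : IsProxDir h γ X V ζ) (hζ' : ζ' ∈ tangent X) :
    inner ℝ V ζ + 1 / (2 * γ) * ‖ζ‖ ^ 2 + h (X + ζ) + 1 / (2 * γ) * ‖ζ' - ζ‖ ^ 2 ≤
      inner ℝ V ζ' + 1 / (2 * γ) * ‖ζ'‖ ^ 2 + h (X + ζ') := by
  have key : ∀ t : ℝ, 0 < t → t < 1 →
      inner ℝ V ζ + 1 / (2 * γ) * ‖ζ‖ ^ 2 + h (X + ζ) + 1 / (2 * γ) * ‖ζ' - ζ‖ ^ 2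
        - (inner ℝ V ζ' + 1 / (2 * γ) * ‖ζ'‖ ^ 2 + h (X + ζ'))
        ≤ t * (1 / (2 * γ) * ‖ζ' - ζ‖ ^ 2) := by
    intro t ht0 ht1
    have h1 := hζ.2 _ ((tangent X).add_mem hζ.1
      ((tangent X).smul_mem t ((tangent X).sub_mem hζ' hζ.1)))
    have h2 := hc.2 (mem_univ (X + ζ)) (mem_univ (X + ζ')) (sub_nonneg.2 ht1.le) ht0.le (by ring)
    have e : (1 - t) • (X + ζ) + t • (X + ζ') = X + (ζ + t • (ζ' - ζ)) := by module
    rw [e, smul_eq_mul, smul_eq_mul] at h2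
    have h3 : ‖ζ + t • (ζ' - ζ)‖ ^ 2
        = (1 - t) * ‖ζ‖ ^ 2 + t * ‖ζ'‖ ^ 2 - t * (1 - t) * ‖ζ' - ζ‖ ^ 2 := by
      have e' : ζ' = ζ + (ζ' - ζ) := by abel
      have h5 : ‖ζ'‖ ^ 2 = ‖ζ‖ ^ 2 + 2 * inner ℝ ζ (ζ' - ζ) + ‖ζ' - ζ‖ ^ 2 := by
        conv_lhs => rw [e']
        exact norm_add_sq_real _ _
      rw [norm_add_sq_real, inner_smul_right, norm_smul, mul_pow, Real.norm_eq_abs, sq_abs, h5]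
      ring
    have h4 : inner ℝ V (ζ + t • (ζ' - ζ)) = (1 - t) * inner ℝ V ζ + t * inner ℝ V ζ' := by
      rw [inner_add_right, inner_smul_right, inner_sub_right]; ring
    rw [h3, h4] at h1
    have h6 : 0 ≤ t * (inner ℝ V ζ' + 1 / (2 * γ) * ‖ζ'‖ ^ 2 + h (X + ζ') -
        (inner ℝ V ζ + 1 / (2 * γ) * ‖ζ‖ ^ 2 + h (X + ζ)) -
        (1 - t) * (1 / (2 * γ) * ‖ζ' - ζ‖ ^ 2)) := by linarith
    have h7 := nonneg_of_mul_nonneg_right h6 ht0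
    linarith
  by_contra hcon
  rw [not_le, ← sub_pos] at hcon
  set B := 1 / (2 * γ) * ‖ζ' - ζ‖ ^ 2 with hB
  have hB0 : 0 ≤ B := by positivity
  set A := inner ℝ V ζ + 1 / (2 * γ) * ‖ζ‖ ^ 2 + h (X + ζ) + B
        - (inner ℝ V ζ' + 1 / (2 * γ) * ‖ζ'‖ ^ 2 + h (X + ζ'))
  -- In place of a limit: if the gap `A` were positive, this `t` lies in `(0, 1)` and makes `t * B <
  -- A`.
  have h1 := key (A / (2 * (A + B))) (by positivity) (by
    rw [div_lt_one (by positivity)]; linarith)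
  have h2 : A / (2 * (A + B)) * B < A := by
    rw [div_mul_eq_mul_div, div_lt_iff₀ (by positivity)]
    nlinarith
  linarith

lemma IsProxDir.inner_add_le (hc : ConvexOn ℝ univ h) (hγ : 0 < γ) {X V ζ : Amb d r}
    (hζ : IsProxDir h γ X V ζ) : inner ℝ V ζ + 1 / γ * ‖ζ‖ ^ 2 + h (X + ζ) ≤ h X := by
  have := hζ.strong hc hγ (tangent X).zero_mem
  simp only [inner_zero_right, norm_zero, add_zero, zero_sub, norm_neg] at this
  have e : 1 / γ * ‖ζ‖ ^ 2 = 1 / (2 * γ) * ‖ζ‖ ^ 2 + 1 / (2 * γ) * ‖ζ‖ ^ 2 := by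
    field_simp; ring
  rw [e]; linarith

/-- Adding the two strong minimality inequalities leaves the pairing of `V - V'` with a tangent
vector, so only the tangential part of the difference counts. Equal data give uniqueness. -/
lemma IsProxDir.norm_sub_le (hc : ConvexOn ℝ univ h) (hγ : 0 < γ) {X V V' ζ ζ' : Amb d r}
    (hζ : IsProxDir h γ X V ζ) (hζ' : IsProxDir h γ X V' ζ') :
    ‖ζ - ζ'‖ ≤ γ * ‖(tangent X).starProjection (V - V')‖ := by
  have h1 := hζ.strong hc hγ hζ'.1
  have h2 := hζ'.strong hc hγ hζ.1
  have h3 : inner ℝ ((tangent X).starProjection (V - V')) (ζ' - ζ) = inner ℝ (V - V') (ζ' - ζ) := by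
    rw [Submodule.inner_starProjection_left_eq_right,
      Submodule.starProjection_eq_self_iff.2 ((tangent X).sub_mem hζ'.1 hζ.1)]
  have h4 := real_inner_le_norm ((tangent X).starProjection (V - V')) (ζ' - ζ)
  rw [h3, inner_sub_left, inner_sub_right, inner_sub_right] at h4
  rw [norm_sub_rev ζ ζ'] at h2 ⊢
  have h5 : 1 / γ * ‖ζ' - ζ‖ ^ 2 = 1 / (2 * γ) * ‖ζ' - ζ‖ ^ 2 + 1 / (2 * γ) * ‖ζ' - ζ‖ ^ 2 := by
    field_simp; ring
  have h6 : 1 / γ * ‖ζ' - ζ‖ ^ 2 ≤ ‖(tangent X).starProjection (V - V')‖ * ‖ζ' - ζ‖ := by linarith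
  rcases (norm_nonneg (ζ' - ζ)).eq_or_lt with h0 | h0
  · rw [← h0]; positivity
  · have h7 : 1 / γ * ‖ζ' - ζ‖ ≤ ‖(tangent X).starProjection (V - V')‖ := by
      refine le_of_mul_le_mul_right ?_ h0
      calc _ = 1 / γ * ‖ζ' - ζ‖ ^ 2 := by ring
        _ ≤ _ := h6
    rwa [one_div, inv_mul_le_iff₀ hγ] at h7

lemma IsProxDir.eq_proxDir (hc : ConvexOn ℝ univ h) (hγ : 0 < γ) {X V ζ : Amb d r}
    (hX : X ∈ stiefel d r) (hζ : IsProxDir h γ X V ζ) : proxDir h γ X V = ζ := by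
  have := (isProxDir_proxDir hc hγ hX V).norm_sub_le hc hγ hζ
  simpa [sub_eq_zero] using this

lemma exists_norm_proxDir_le (hc : ConvexOn ℝ univ h) (hγ : 0 < γ) :
    ∃ C, 0 ≤ C ∧ ∀ X ∈ stiefel d r, ∀ V, ‖proxDir h γ X V‖ ≤ 1 + 2 * γ * (‖V‖ + C) := by
  obtain ⟨C, hC0, hC⟩ := exists_h_sub_le hc
  refine ⟨2 * C, by positivity, fun X hX V => ?_⟩
  by_contra hcon
  have h1 := prox_coercive (V := V) hγ hC0 (hC X hX (proxDir h γ X V)) (not_le.1 hcon)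
  have h2 := (isProxDir_proxDir hc hγ hX V).2 0 (tangent X).zero_mem
  simp only [inner_zero_right, norm_zero, add_zero] at h2
  linarith

/-- Minimizers along a convergent sequence stay bounded, and every cluster point solves the limit
problem, so uniqueness identifies it. This is what makes the iterates measurable. -/
lemma continuousOn_proxDir (hc : ConvexOn ℝ univ h) (hγ : 0 < γ) :
    ContinuousOn (fun p : Amb d r × Amb d r => proxDir h γ p.1 p.2) (stiefel d r ×ˢ univ) := by
  obtain ⟨C, hC0, hC⟩ := exists_norm_proxDir_le (d := d) (r := r) hc hγ
  have hcont := hc.continuous_amb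
  rw [continuousOn_iff_continuous_domRestrict]
  refine continuous_iff_seqContinuous.2 fun x p hx => ?_
  refine tendsto_of_subseq_tendsto fun ns hns => ?_
  have hx' : Tendsto (fun n => (x (ns n) : Amb d r × Amb d r)) atTop (𝓝 p) :=
    ((continuous_subtype_val.tendsto p).comp hx).comp hns
  set y : ℕ → Amb d r × Amb d r := fun n => x (ns n) with hy
  have hyS : ∀ n, (y n).1 ∈ stiefel d r := fun n => (x (ns n)).2.1
  have hX := (continuous_fst.tendsto _).comp hx'
  have hV := (continuous_snd.tendsto _).comp hx'
  obtain ⟨B, hB⟩ := (Metric.isBounded_range_of_tendsto _ hV).exists_norm_le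
  have hbd : ∀ n, ‖proxDir h γ (y n).1 (y n).2‖ ≤ 1 + 2 * γ * (B + C) := by
    intro n
    refine (hC _ (hyS n) _).trans ?_
    have := hB _ (mem_range_self n)
    simp only [Function.comp_apply] at this
    gcongr
  obtain ⟨ζ, -, φ, hφ, hζ⟩ := tendsto_subseq_of_bounded Metric.isBounded_closedBall
    (fun n => mem_closedBall_zero_iff.2 (hbd n))
  refine ⟨φ, ?_⟩
  have hXφ := hX.comp hφ.tendsto_atTop
  have hVφ := hV.comp hφ.tendsto_atTop
  have hprox : ∀ n, IsProxDir h γ (y (φ n)).1 (y (φ n)).2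
      (proxDir h γ (y (φ n)).1 (y (φ n)).2) := fun n => isProxDir_proxDir hc hγ (hyS _) _
  have hlim : IsProxDir h γ p.1.1 p.1.2 ζ := by
    constructor
    · have := isClosed_tangentBundle.mem_of_tendsto (hXφ.prodMk_nhds hζ)
        (Eventually.of_forall fun n => ⟨hyS _, (hprox n).1⟩)
      exact this.2
    · intro ζ' hζ'
      -- The feasible set moves with the base point: a competitor at the limit is approximated by
      -- its projections onto the nearby tangent spaces.
      have hπ : Tendsto (fun n => tangentProj (y (φ n)).1 ζ') atTop (𝓝 ζ') := by
        have := (continuous_tangentProj.tendsto (p.1.1, ζ')).comp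
          (hXφ.prodMk_nhds (tendsto_const_nhds (x := ζ')))
        rwa [← starProjection_tangent p.2.1,
          Submodule.starProjection_eq_self_iff.2 hζ'] at this
      have hΦ : Continuous fun a : Amb d r × Amb d r × Amb d r =>
          inner ℝ a.2.1 a.2.2 + 1 / (2 * γ) * ‖a.2.2‖ ^ 2 + h (a.1 + a.2.2) := by
        fun_prop
      refine le_of_tendsto_of_tendsto'
        ((hΦ.tendsto (p.1.1, p.1.2, ζ)).comp (hXφ.prodMk_nhds (hVφ.prodMk_nhds hζ)))
        ((hΦ.tendsto (p.1.1, p.1.2, ζ')).comp (hXφ.prodMk_nhds (hVφ.prodMk_nhds hπ)))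
        fun n => ?_
      refine (hprox n).2 _ ?_
      change tangentProj (y (φ n)).1 ζ' ∈ _
      rw [← starProjection_tangent (hyS _)]
      exact Submodule.starProjection_apply_mem _ _
  have := hlim.eq_proxDir hc hγ p.2.1
  simp only [domRestrict_apply]
  rw [this]
  exact hζ

end Prox

/-! ### Uniform estimates for the retraction and the transport. -/

section Retraction

/-- Within a submanifold the derivative need not be unique, so some derivative is chosen locally,
where it is continuous, and compactness turns the local bounds into one constant. Curves inside the
set make the choice irrelevant. -/
lemma ContDiffOn.exists_bound_hasFDerivWithinAt {E F : Type*} [NormedAddCommGroup E]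
    [NormedSpace ℝ E] [NormedAddCommGroup F] [NormedSpace ℝ F] {f : E → F} {s K : Set E}
    (hf : ContDiffOn ℝ 1 f s) (hK : IsCompact K) (hKs : K ⊆ s) :
    ∃ C : ℝ, ∀ x ∈ K, ∃ f' : E →L[ℝ] F, HasFDerivWithinAt f f' s x ∧ ‖f'‖ ≤ C := by
  refine hK.induction_on (p := fun K => ∃ C : ℝ, ∀ x ∈ K, ∃ f' : E →L[ℝ] F,
    HasFDerivWithinAt f f' s x ∧ ‖f'‖ ≤ C) ⟨0, fun _ h => h.elim⟩ ?_ ?_ ?_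
  · rintro A B hAB ⟨C, hC⟩
    exact ⟨C, fun x hx => hC x (hAB hx)⟩
  · rintro A B ⟨C, hC⟩ ⟨C', hC'⟩
    refine ⟨max C C', ?_⟩
    rintro x (hx | hx)
    · obtain ⟨f', h1, h2⟩ := hC x hx
      exact ⟨f', h1, h2.trans (le_max_left _ _)⟩
    · obtain ⟨f', h1, h2⟩ := hC' x hx
      exact ⟨f', h1, h2.trans (le_max_right _ _)⟩
  · intro x hx
    have h0 : ContDiffWithinAt ℝ (0 + 1) f s x := by
      rw [zero_add]; exact hf x (hKs hx)
    obtain ⟨u, hu, -, -, f', hf', hcd⟩ :=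
      (contDiffWithinAt_succ_iff_hasFDerivWithinAt' (by simp)).1 h0
    rw [insert_eq_of_mem (hKs hx)] at hu
    have hcont := hcd.continuousWithinAt
    have hbd : ∀ᶠ y in 𝓝[s] x, ‖f' y‖ < ‖f' x‖ + 1 :=
      hcont.norm.eventually (gt_mem_nhds (by linarith))
    refine ⟨u ∩ {y | ‖f' y‖ < ‖f' x‖ + 1}, nhdsWithin_mono x hKs (inter_mem hu hbd),
      ‖f' x‖ + 1, fun y hy => ⟨f' y, hf' y hy.1, hy.2.le⟩⟩

variable {d r : ℕ} {Retr : Amb d r → Amb d r → Amb d r}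

lemma IsRetraction.contDiff_curve (hRetr : IsRetraction Retr) {X ξ : Amb d r}
    (hX : X ∈ stiefel d r) (hξ : ξ ∈ tangent X) :
    ContDiff ℝ ((⊤ : ℕ∞) : WithTop ℕ∞) fun t : ℝ => Retr X (t • ξ) := by
  have h1 : ContDiffOn ℝ ((⊤ : ℕ∞) : WithTop ℕ∞) (fun t : ℝ => (X, t • ξ)) univ := by
    apply ContDiff.contDiffOn; fun_prop
  exact contDiffOn_univ.1 (hRetr.smooth.comp h1 fun t _ => ⟨hX, (tangent X).smul_mem t hξ⟩)

lemma IsRetraction.exists_curve_speed_bound (hRetr : IsRetraction Retr) :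
    ∃ C : ℝ, 0 ≤ C ∧ ∀ X ∈ stiefel d r, ∀ ξ ∈ tangent X, ‖ξ‖ ≤ 1 → ∀ t : ℝ, |t| ≤ 1 →
      ‖deriv (fun t : ℝ => Retr X (t • ξ)) t‖ ≤ C * ‖ξ‖ := by
  obtain ⟨C, hC⟩ := (hRetr.smooth.of_le (by exact_mod_cast le_top)
    : ContDiffOn ℝ 1 _ _).exists_bound_hasFDerivWithinAt
    (((isCompact_stiefel (d := d) (r := r)).prod (isCompact_closedBall (0 : Amb d r) 1)).inter_left
      isClosed_tangentBundle) inter_subset_left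
  refine ⟨|C|, abs_nonneg C, fun X hX ξ hξ hn t ht => ?_⟩
  obtain ⟨f', hf', hfC⟩ := hC (X, t • ξ) ⟨⟨hX, (tangent X).smul_mem t hξ⟩, hX, by
    rw [mem_closedBall_zero_iff, norm_smul, Real.norm_eq_abs]
    exact mul_le_one₀ ht (norm_nonneg _) hn⟩
  have hc : HasDerivAt (fun s : ℝ => (X, s • ξ)) ((0 : Amb d r), ξ) t := by
    have := (hasDerivAt_id t).smul_const ξ
    simp only [id, one_smul] at this
    exact (hasDerivAt_const t X).prodMk this
  have hd : HasDerivAt (fun s : ℝ => Retr X (s • ξ)) (f' (0, ξ)) t :=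
    HasFDerivWithinAt.comp_hasDerivAt (f := fun s : ℝ => (X, s • ξ))
      (l := fun p : Amb d r × Amb d r => Retr p.1 p.2) t hf' hc
      (by exact Eventually.of_forall fun s => ⟨hX, (tangent X).smul_mem s hξ⟩)
  rw [hd.deriv]
  have e : ‖((0 : Amb d r), ξ)‖ = ‖ξ‖ := by simp [Prod.norm_def]
  calc ‖f' (0, ξ)‖ ≤ ‖f'‖ * ‖((0 : Amb d r), ξ)‖ := f'.le_opNorm _
    _ ≤ |C| * ‖ξ‖ := by
        rw [e]
        exact mul_le_mul_of_nonneg_right (hfC.trans (le_abs_self C)) (norm_nonneg _)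

/-- Integrate the derivative of `t ↦ Γ X (t ξ) ζ`, which starts at `ζ` and has speed `O(‖ξ‖)`
uniformly for `‖ζ‖ ≤ 1`; homogeneity in `ζ` gives the factor `‖ζ‖`. -/
lemma IsIsometricTransport.exists_norm_sub_le {Γ : Amb d r → Amb d r → Amb d r → Amb d r}
    (hΓ : IsIsometricTransport Retr Γ) :
    ∃ C : ℝ, 0 ≤ C ∧ ∀ X ∈ stiefel d r, ∀ ξ ∈ tangent X, ‖ξ‖ ≤ 1 → ∀ ζ ∈ tangent X,
      ‖Γ X ξ ζ - ζ‖ ≤ C * ‖ξ‖ * ‖ζ‖ := by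
  set s := {p : Amb d r × Amb d r × Amb d r |
    p.1 ∈ stiefel d r ∧ p.2.1 ∈ tangent p.1 ∧ p.2.2 ∈ tangent p.1} with hs
  have hclosed : IsClosed s := by
    have h1 := (isClosed_tangentBundle (d := d) (r := r)).preimage
      (show Continuous fun p : Amb d r × Amb d r × Amb d r => (p.1, p.2.1) by fun_prop)
    have h2 := (isClosed_tangentBundle (d := d) (r := r)).preimage
      (show Continuous fun p : Amb d r × Amb d r × Amb d r => (p.1, p.2.2) by fun_prop)
    convert h1.inter h2 using 1
    ext p
    simp only [hs, mem_ofPred_eq, mem_inter_iff, mem_preimage]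
    tauto
  obtain ⟨C, hC⟩ := (hΓ.smooth.of_le (by exact_mod_cast le_top)
    : ContDiffOn ℝ 1 _ _).exists_bound_hasFDerivWithinAt
    (((isCompact_stiefel (d := d) (r := r)).prod ((isCompact_closedBall (0 : Amb d r) 1).prod
      (isCompact_closedBall (0 : Amb d r) 1))).inter_left hclosed) inter_subset_left
  have key : ∀ X ∈ stiefel d r, ∀ ξ ∈ tangent X, ‖ξ‖ ≤ 1 → ∀ ζ ∈ tangent X, ‖ζ‖ ≤ 1 →
      ‖Γ X ξ ζ - ζ‖ ≤ |C| * ‖ξ‖ := by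
    intro X hX ξ hξ hn ζ hζ hnζ
    have hd : ∀ t ∈ Icc (0 : ℝ) 1, ∃ v, HasDerivAt (fun s : ℝ => Γ X (s • ξ) ζ) v t ∧
        ‖v‖ ≤ |C| * ‖ξ‖ := by
      intro t ht
      obtain ⟨f', hf', hfC⟩ := hC (X, t • ξ, ζ) ⟨⟨hX, (tangent X).smul_mem t hξ, hζ⟩, hX, by
        rw [mem_closedBall_zero_iff, norm_smul, Real.norm_eq_abs, abs_of_nonneg ht.1]
        exact mul_le_one₀ ht.2 (norm_nonneg _) hn, mem_closedBall_zero_iff.2 hnζ⟩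
      have hc : HasDerivAt (fun s : ℝ => (X, s • ξ, ζ)) ((0 : Amb d r), ξ, (0 : Amb d r)) t := by
        have := (hasDerivAt_id t).smul_const ξ
        simp only [id, one_smul] at this
        exact (hasDerivAt_const t X).prodMk (this.prodMk (hasDerivAt_const t ζ))
      refine ⟨_, HasFDerivWithinAt.comp_hasDerivAt (f := fun s : ℝ => (X, s • ξ, ζ))
        (l := fun p : Amb d r × Amb d r × Amb d r => Γ p.1 p.2.1 p.2.2) t hf' hc
        (by exact Eventually.of_forall fun s => ⟨hX, (tangent X).smul_mem s hξ, hζ⟩), ?_⟩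
      have e : ‖((0 : Amb d r), ξ, (0 : Amb d r))‖ = ‖ξ‖ := by simp [Prod.norm_def]
      refine (f'.le_opNorm _).trans ?_
      rw [e]
      exact mul_le_mul_of_nonneg_right (hfC.trans (le_abs_self C)) (norm_nonneg _)
    choose! v hv hvC using hd
    have := norm_image_sub_le_of_norm_deriv_le_segment_01'
      (fun t ht => (hv t ht).hasDerivWithinAt) (fun t ht => hvC t (Ico_subset_Icc_self ht))
    simpa [hΓ.zero X hX ζ hζ] using this
  refine ⟨|C|, abs_nonneg C, fun X hX ξ hξ hn ζ hζ => ?_⟩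
  rcases eq_or_ne ζ 0 with h0 | h0
  · have := hΓ.isometric X hX ξ hξ 0 (tangent X).zero_mem
    rw [norm_zero, norm_eq_zero] at this
    simp [h0, this]
  · have hz : 0 < ‖ζ‖ := norm_pos_iff.2 h0
    have hm := (tangent X).smul_mem ‖ζ‖⁻¹ hζ
    have h1 := key X hX ξ hξ hn _ hm (by
      rw [norm_smul, norm_inv, norm_norm, inv_mul_cancel₀ hz.ne'])
    rw [hΓ.smul X hX ξ hξ _ ζ hζ, ← smul_sub, norm_smul, norm_inv, norm_norm,
      inv_mul_le_iff₀ hz] at h1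
    linarith

lemma contDiff_gradient {f : Amb d r → ℝ} (hf : ContDiff ℝ 2 f) : ContDiff ℝ 1 (gradient f) :=
  (InnerProductSpace.toDual ℝ (Amb d r)).symm.toContinuousLinearEquiv.contDiff.comp
    (hf.fderiv_right (by norm_num))

lemma hasFDerivAt_gradient {f : Amb d r → ℝ} (hf : ContDiff ℝ 2 f) (X : Amb d r) :
    HasFDerivAt f (InnerProductSpace.toDual ℝ (Amb d r) (gradient f X)) X :=
  ((hf.differentiable (by norm_num)) X).hasGradientAt.hasFDerivAt

/-- The tangential gradient is Lipschitz up to transport, with a constant that depends only on the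
retraction, the transport and the bounds on the derivatives. -/
lemma exists_transport_lipschitz {Γ : Amb d r → Amb d r → Amb d r → Amb d r}
    (hRetr : IsRetraction Retr) (hΓ : IsIsometricTransport Retr Γ) {M₁ : ℝ} (hM₁ : 0 < M₁)
    (hRetr₁ : ∀ X ∈ stiefel d r, ∀ ξ ∈ tangent X, ‖Retr X ξ - X‖ ≤ M₁ * ‖ξ‖) {LH G : ℝ}
    (hLH : 0 ≤ LH) (hG : 0 ≤ G) :
    ∃ C : ℝ, 0 < C ∧ ∀ f : Amb d r → ℝ, ContDiff ℝ 2 f →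
      (∀ X ∈ stiefel d r, ‖fderiv ℝ (gradient f) X‖ ≤ LH) →
      (∀ X ∈ stiefel d r, ‖gradient f X‖ ≤ G) → ∀ X ∈ stiefel d r, ∀ ξ ∈ tangent X,
      ‖(tangent (Retr X ξ)).starProjection (gradient f (Retr X ξ)) -
        Γ X ξ ((tangent X).starProjection (gradient f X))‖ ≤ C * ‖ξ‖ := by
  obtain ⟨CR, hCR0, hCR⟩ := hRetr.exists_curve_speed_bound
  obtain ⟨CT, hCT0, hCT⟩ := hΓ.exists_norm_sub_le
  refine ⟨LH * CR + 2 * √r * M₁ * G + CT * G + 2 * G + 1, by positivity,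
    fun f hf hH hg X hX ξ hξ => ?_⟩
  have hY := hRetr.mapsTo X hX ξ hξ
  have hP : (tangent X).starProjection (gradient f X) ∈ tangent X :=
    Submodule.starProjection_apply_mem _ _
  have hPn : ‖(tangent X).starProjection (gradient f X)‖ ≤ G :=
    ((tangent X).norm_starProjection_apply_le _).trans (hg X hX)
  have hn := norm_nonneg ξ
  have hs : 0 ≤ √(r : ℝ) := Real.sqrt_nonneg _
  rcases le_or_gt ‖ξ‖ 1 with h1 | h1
  -- The Hessian is bounded only on the manifold, so the mean value inequality is applied along the
  -- retraction curve and not along the chord.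
  · have hgrad : ‖gradient f (Retr X ξ) - gradient f X‖ ≤ LH * (CR * ‖ξ‖) := by
      have hc := fun t : ℝ => ((hRetr.contDiff_curve hX hξ).differentiable (by simp) t).hasDerivAt
      have := norm_image_sub_le_of_norm_deriv_le_segment_01'
        (f := fun t : ℝ => gradient f (Retr X (t • ξ))) (C := LH * (CR * ‖ξ‖))
        (fun t _ => (HasFDerivAt.comp_hasDerivAt t
          (((contDiff_gradient hf).differentiable (by norm_num) _).hasFDerivAt)
          (hc t)).hasDerivWithinAt) (fun t ht => ?_)
      · simpa [hRetr.zero X hX] using this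
      · refine (ContinuousLinearMap.le_opNorm _ _).trans ?_
        exact mul_le_mul (hH _ (hRetr.mapsTo X hX _ ((tangent X).smul_mem t hξ)))
          (hCR X hX ξ hξ h1 t (abs_le.2 ⟨by linarith [ht.1], ht.2.le⟩)) (norm_nonneg _) hLH
    have e1 : ‖(tangent (Retr X ξ)).starProjection (gradient f (Retr X ξ) - gradient f X)‖
        ≤ LH * (CR * ‖ξ‖) := ((tangent _).norm_starProjection_apply_le _).trans hgrad
    have e2 : ‖(tangent (Retr X ξ)).starProjection (gradient f X) -
        (tangent X).starProjection (gradient f X)‖ ≤ 2 * √r * (M₁ * ‖ξ‖) * G := by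
      refine (norm_starProjection_sub_le hX hY _).trans ?_
      have := hRetr₁ X hX ξ hξ
      have := hg X hX
      gcongr
    have e3 : ‖Γ X ξ ((tangent X).starProjection (gradient f X)) -
        (tangent X).starProjection (gradient f X)‖ ≤ CT * ‖ξ‖ * G :=
      (hCT X hX ξ hξ h1 _ hP).trans (mul_le_mul_of_nonneg_left hPn (by positivity))
    have e : (tangent (Retr X ξ)).starProjection (gradient f (Retr X ξ)) -
        Γ X ξ ((tangent X).starProjection (gradient f X))
        = (tangent (Retr X ξ)).starProjection (gradient f (Retr X ξ) - gradient f X)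
          + ((tangent (Retr X ξ)).starProjection (gradient f X) -
            (tangent X).starProjection (gradient f X))
          - (Γ X ξ ((tangent X).starProjection (gradient f X)) -
            (tangent X).starProjection (gradient f X)) := by
      rw [map_sub]; abel
    rw [e]
    refine (norm_sub_le _ _).trans ?_
    have := norm_add_le ((tangent (Retr X ξ)).starProjection (gradient f (Retr X ξ) - gradient f X))
      ((tangent (Retr X ξ)).starProjection (gradient f X) -
            (tangent X).starProjection (gradient f X))
    nlinarith [mul_nonneg hG hn]
  -- Long steps lie outside the compactness estimates, but there the trivial bound `2 G` is at most
  -- `2 G ‖ξ‖`.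
  · have e1 : ‖(tangent (Retr X ξ)).starProjection (gradient f (Retr X ξ))‖ ≤ G :=
      ((tangent _).norm_starProjection_apply_le _).trans (hg _ hY)
    have e2 : ‖Γ X ξ ((tangent X).starProjection (gradient f X))‖ ≤ G := by
      rw [hΓ.isometric X hX ξ hξ _ hP]; exact hPn
    have h3 := norm_sub_le ((tangent (Retr X ξ)).starProjection (gradient f (Retr X ξ)))
      (Γ X ξ ((tangent X).starProjection (gradient f X)))
    have h4 : 0 ≤ LH * CR + 2 * √r * M₁ * G + CT * G + 1 := by positivity
    nlinarith [mul_nonneg h4 hn, mul_nonneg hG hn]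

lemma hasDerivAt_curve_zero {M₂ : ℝ}
    (hRetr₂ : ∀ X ∈ stiefel d r, ∀ ξ ∈ tangent X, ‖Retr X ξ - (X + ξ)‖ ≤ M₂ * ‖ξ‖ ^ 2)
    {X ξ : Amb d r} (hX : X ∈ stiefel d r) (hξ : ξ ∈ tangent X) :
    HasDerivAt (fun t : ℝ => Retr X (t • ξ)) ξ 0 := by
  have h1 : (fun t : ℝ => Retr X (t • ξ) - (X + t • ξ)) =O[𝓝 0] fun t => ‖t - 0‖ ^ 2 := by
    refine Asymptotics.IsBigO.of_bound (M₂ * ‖ξ‖ ^ 2) (Eventually.of_forall fun t => ?_)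
    refine (hRetr₂ X hX _ ((tangent X).smul_mem t hξ)).trans (le_of_eq ?_)
    rw [norm_smul, sub_zero, norm_pow, norm_norm]
    ring
  have h2 : HasDerivAt (fun t : ℝ => Retr X (t • ξ) - (X + t • ξ)) 0 0 := by
    simpa using (h1.hasFDerivAt (by norm_num)).hasDerivAt
  have h3 : HasDerivAt (fun t : ℝ => X + t • ξ) ξ 0 := by
    simpa using ((hasDerivAt_id (0 : ℝ)).smul_const ξ).const_add X
  have h4 := h2.add h3
  rw [zero_add] at h4
  exact h4.congr_of_eventuallyEq (Eventually.of_forall fun t => by simp)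

lemma le_quadratic_of_iteratedDeriv_two_le {φ : ℝ → ℝ} (hφ : ContDiff ℝ 2 φ) {L a : ℝ}
    (ha : 0 ≤ a) (hL : ∀ t ∈ Icc 0 a, iteratedDeriv 2 φ t ≤ L) :
    φ a ≤ φ 0 + deriv φ 0 * a + L / 2 * a ^ 2 := by
  have hd0 : Differentiable ℝ φ := hφ.differentiable (by norm_num)
  have hd1 : Differentiable ℝ (deriv φ) := by
    have : ContDiff ℝ (1 + 1) φ := by rwa [one_add_one_eq_two]
    exact (contDiff_succ_iff_deriv.1 this).2.2.differentiable (by norm_num)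
  have hψ : ∀ t, HasDerivAt (fun t => deriv φ t - L * t) (deriv (deriv φ) t - L) t := fun t =>
    ((hd1 t).hasDerivAt.sub ((hasDerivAt_id t).const_mul L)).congr_deriv (by simp)
  have h1 : AntitoneOn (fun t => deriv φ t - L * t) (Icc 0 a) := by
    refine antitoneOn_of_deriv_nonpos (convex_Icc 0 a)
      (fun t _ => (hψ t).continuousAt.continuousWithinAt)
      (fun t _ => (hψ t).differentiableAt.differentiableWithinAt) fun t ht => ?_
    rw [(hψ t).deriv]
    have := hL t (interior_subset ht)
    rw [iteratedDeriv_succ, iteratedDeriv_one] at this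
    linarith
  have hχ : ∀ t, HasDerivAt (fun t => φ t - deriv φ 0 * t - L / 2 * t ^ 2)
      (deriv φ t - deriv φ 0 - L * t) t := fun t => by
    have := ((hd0 t).hasDerivAt.sub ((hasDerivAt_id t).const_mul (deriv φ 0))).sub
      ((hasDerivAt_pow 2 t).const_mul (L / 2))
    refine this.congr_deriv ?_
    simp; ring
  have h2 : AntitoneOn (fun t => φ t - deriv φ 0 * t - L / 2 * t ^ 2) (Icc 0 a) := by
    refine antitoneOn_of_deriv_nonpos (convex_Icc 0 a)
      (fun t _ => (hχ t).continuousAt.continuousWithinAt)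
      (fun t _ => (hχ t).differentiableAt.differentiableWithinAt) fun t ht => ?_
    rw [(hχ t).deriv]
    have ht' := interior_subset ht
    have := h1 ⟨le_rfl, ha⟩ ht' ht'.1
    simp only [mul_zero, sub_zero] at this
    linarith
  have := h2 ⟨le_rfl, ha⟩ ⟨ha, le_rfl⟩ ha
  simp only [mul_zero, sub_zero] at this
  norm_num at this
  linarith

/-- Second-order Taylor bound along the retraction curve of the unit vector `ξ / ‖ξ‖` up to time
`‖ξ‖`. Its velocity at `0` is that unit vector. -/
lemma retr_descent (hRetr : IsRetraction Retr) {M₂ : ℝ}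
    (hRetr₂ : ∀ X ∈ stiefel d r, ∀ ξ ∈ tangent X, ‖Retr X ξ - (X + ξ)‖ ≤ M₂ * ‖ξ‖ ^ 2)
    {f : Amb d r → ℝ} (hf : ContDiff ℝ 2 f) {U : Set (Amb d r)} {LR : ℝ}
    (hU : ∀ X ∈ U, ∀ ξ ∈ tangent X, ‖ξ‖ = 1 → ∀ t : ℝ, 0 ≤ t →
      (∀ τ ∈ Icc 0 t, Retr X (τ • ξ) ∈ U) →
      iteratedDeriv 2 (fun s : ℝ => f (Retr X (s • ξ))) t ≤ LR)
    {X ξ : Amb d r} (hX : X ∈ stiefel d r) (hξ : ξ ∈ tangent X)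
    (hcurve : ∀ τ ∈ Icc (0 : ℝ) 1, Retr X (τ • ξ) ∈ U) :
    f (Retr X ξ) ≤ f X + inner ℝ (gradient f X) ξ + LR / 2 * ‖ξ‖ ^ 2 := by
  rcases eq_or_ne ξ 0 with h0 | h0
  · simp [h0, hRetr.zero X hX]
  have hn : 0 < ‖ξ‖ := norm_pos_iff.2 h0
  have hXU : X ∈ U := by
    simpa [hRetr.zero X hX] using hcurve 0 (by simp)
  set e := ‖ξ‖⁻¹ • ξ with he
  have hem : e ∈ tangent X := (tangent X).smul_mem _ hξ
  have hξe : ‖ξ‖ • e = ξ := smul_inv_smul₀ hn.ne' ξ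
  have hφ : ContDiff ℝ 2 fun s : ℝ => f (Retr X (s • e)) :=
    hf.comp (by exact_mod_cast contDiff_infty.1 (hRetr.contDiff_curve hX hem) 2)
  have hmem : ∀ τ ∈ Icc 0 ‖ξ‖, Retr X (τ • e) ∈ U := by
    intro τ hτ
    rw [he, smul_smul]
    refine hcurve _ ⟨mul_nonneg hτ.1 (inv_nonneg.2 hn.le), ?_⟩
    rw [← div_eq_mul_inv]
    exact div_le_one_of_le₀ hτ.2 hn.le
  have key := le_quadratic_of_iteratedDeriv_two_le hφ hn.le (L := LR) fun t ht =>
    hU X hXU e hem (by rw [norm_smul, norm_inv, norm_norm, inv_mul_cancel₀ hn.ne']) t ht.1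
      fun τ hτ => hmem τ ⟨hτ.1, hτ.2.trans ht.2⟩
  have hd : HasDerivAt (fun s : ℝ => f (Retr X (s • e))) (inner ℝ (gradient f X) e) 0 := by
    have h1 := hasFDerivAt_gradient hf (Retr X ((0 : ℝ) • e))
    have h2 := h1.comp_hasDerivAt 0 (hasDerivAt_curve_zero hRetr₂ hX hem)
    rw [zero_smul, hRetr.zero X hX] at h2
    exact h2
  rw [hd.deriv, hξe, zero_smul, hRetr.zero X hX] at key
  have : inner ℝ (gradient f X) e * ‖ξ‖ = inner ℝ (gradient f X) ξ := by
    rw [he, inner_smul_right]; field_simp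
  rwa [this] at key

end Retraction

/-! ### Measurability of sampled gradients and the gradient of the mean. -/

section MeanGradient

variable {d r : ℕ} {ι : Type*} [MeasurableSpace ι] {f : ι → Amb d r → ℝ}

/-- Only the values of `f` are measurable in the sample; each directional derivative is a limit of
difference quotients of such values. -/
lemma measurable_gradient_apply (hf : ∀ i, ContDiff ℝ 2 (f i))
    (hm : ∀ X, Measurable fun z => f z X) (X : Amb d r) :
    Measurable fun z => gradient (f z) X := by
  have h1 : ∀ v : Amb d r, Measurable fun z => inner ℝ (gradient (f z) X) v := by
    intro v
    have hlim : ∀ z, Tendsto (fun n : ℕ => (1 / ((n : ℝ) + 1))⁻¹ •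
        (f z (X + (1 / ((n : ℝ) + 1)) • v) - f z X)) atTop (𝓝 (inner ℝ (gradient (f z) X) v)) := by
      intro z
      have h2 := ((hasFDerivAt_gradient (hf z) X).hasLineDerivAt v).tendsto_slope_zero
      refine h2.comp (tendsto_nhdsWithin_iff.2 ⟨tendsto_one_div_add_atTop_nhds_zero_nat,
        Eventually.of_forall fun n => ?_⟩)
      simp only [mem_compl_iff, mem_singleton_iff]
      positivity
    refine measurable_of_tendsto_metrizable (fun n => ?_) (tendsto_pi_nhds.2 hlim)
    simp only [smul_eq_mul]
    exact ((hm _).sub (hm _)).const_mul _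
  have h2 : (fun z => gradient (f z) X) = fun z => ∑ p,
      (inner ℝ (gradient (f z) X) (EuclideanSpace.basisFun (Fin d × Fin r) ℝ p)) •
        EuclideanSpace.basisFun (Fin d × Fin r) ℝ p := by
    funext z
    conv_lhs => rw [← (EuclideanSpace.basisFun (Fin d × Fin r) ℝ).sum_repr' (gradient (f z) X)]
    simp_rw [real_inner_comm]
  rw [h2]
  exact Finset.measurable_sum _ fun p _ => (h1 _).smul_const _

lemma measurable_gradient_uncurry (hf : ∀ i, ContDiff ℝ 2 (f i))
    (hm : ∀ X, Measurable fun z => f z X) :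
    Measurable fun p : Amb d r × ι => gradient (f p.2) p.1 :=
  measurable_uncurry_of_continuous_of_measurable (u := fun X z => gradient (f z) X)
    (fun z => (contDiff_gradient (hf z)).continuous) (measurable_gradient_apply hf hm)

variable {P : Measure ι} [IsProbabilityMeasure P] {fbar : Amb d r → ℝ} {G : ℝ}

lemma integrable_gradient (hf : ∀ i, ContDiff ℝ 2 (f i))
    (hm : ∀ X, Measurable fun z => f z X) (hG : ∀ i, ∀ X ∈ stiefel d r, ‖gradient (f i) X‖ ≤ G)
    {X : Amb d r} (hX : X ∈ stiefel d r) : Integrable (fun z => gradient (f z) X) P :=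
  Integrable.of_bound (measurable_gradient_apply hf hm X).aestronglyMeasurable G
    (Eventually.of_forall fun z => hG z X hX)

variable {Retr : Amb d r → Amb d r → Amb d r}

/-- Differentiation under the integral sign, in tangent directions. Nothing is assumed on the
gradients off the manifold, so the normal component need not be the mean of the components. -/
lemma inner_gradient_mean (hRetr : IsRetraction Retr) {M₂ : ℝ}
    (hRetr₂ : ∀ X ∈ stiefel d r, ∀ ξ ∈ tangent X, ‖Retr X ξ - (X + ξ)‖ ≤ M₂ * ‖ξ‖ ^ 2)
    (hf : ∀ i, ContDiff ℝ 2 (f i)) (hfbar : ContDiff ℝ 2 fbar)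
    (hm : ∀ X, Measurable fun z => f z X) (hi : ∀ X, Integrable (fun z => f z X) P)
    (hmean : ∀ X, fbar X = ∫ z, f z X ∂P)
    (hG : ∀ i, ∀ X ∈ stiefel d r, ‖gradient (f i) X‖ ≤ G)
    {X τ : Amb d r} (hX : X ∈ stiefel d r) (hτ : τ ∈ tangent X) :
    inner ℝ (gradient fbar X) τ = ∫ z, inner ℝ (gradient (f z) X) τ ∂P := by
  obtain ⟨C, hC0, hC⟩ := hRetr.exists_curve_speed_bound
  have key : ∀ ξ ∈ tangent X, ‖ξ‖ ≤ 1 →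
      inner ℝ (gradient fbar X) ξ = ∫ z, inner ℝ (gradient (f z) X) ξ ∂P := by
    intro ξ hξ hn
    have hcd : ∀ t : ℝ, HasDerivAt (fun s : ℝ => Retr X (s • ξ))
        (deriv (fun s : ℝ => Retr X (s • ξ)) t) t := fun t =>
      ((hRetr.contDiff_curve hX hξ).differentiable (by simp) t).hasDerivAt
    have h0 := hasDerivAt_curve_zero hRetr₂ hX hξ
    have hchain : ∀ {g : Amb d r → ℝ}, ContDiff ℝ 2 g → ∀ t : ℝ,
        HasDerivAt (fun s : ℝ => g (Retr X (s • ξ))) (inner ℝ (gradient g (Retr X (t • ξ)))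
          (deriv (fun s : ℝ => Retr X (s • ξ)) t)) t := fun {g} hg t =>
      HasFDerivAt.comp_hasDerivAt (l := g) (f := fun s : ℝ => Retr X (s • ξ)) t
        (hasFDerivAt_gradient hg (Retr X (t • ξ))) (hcd t)
    -- The curve stays on the manifold, where gradients are bounded by `G` and the speed by `C ‖ξ‖`:
    -- this gives the dominating constant.
    have hD := hasDerivAt_integral_of_dominated_loc_of_deriv_le (μ := P) (𝕜 := ℝ) (E := ℝ)
      (F := fun (s : ℝ) z => f z (Retr X (s • ξ)))
      (F' := fun s z => inner ℝ (gradient (f z) (Retr X (s • ξ)))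
          (deriv (fun s : ℝ => Retr X (s • ξ)) s))
      (x₀ := 0) (s := Icc (-1) 1) (bound := fun _ => G * (C * ‖ξ‖))
      (Icc_mem_nhds (by norm_num) (by norm_num))
      (Eventually.of_forall fun s => (hm _).aestronglyMeasurable) (hi _)
      ((measurable_gradient_apply hf hm _).inner_const).aestronglyMeasurable
      (Eventually.of_forall fun z s hs => ?_) (integrable_const _)
      (Eventually.of_forall fun z s _ => hchain (hf z) s)
    · have h1 := hD.2
      simp_rw [← hmean] at h1
      have h2 := h1.unique (hchain hfbar 0)
      rw [zero_smul, hRetr.zero X hX, h0.deriv] at h2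
      exact h2.symm
    · rw [Real.norm_eq_abs]
      refine (abs_real_inner_le_norm _ _).trans ?_
      have hY := hRetr.mapsTo X hX _ ((tangent X).smul_mem s hξ)
      exact mul_le_mul (hG z _ hY) (hC X hX ξ hξ hn s (abs_le.2 hs)) (norm_nonneg _)
        ((norm_nonneg _).trans (hG z _ hY))
  rcases eq_or_ne τ 0 with h0 | h0
  · simp [h0]
  have hn : 0 < ‖τ‖ := norm_pos_iff.2 h0
  have h1 := key (‖τ‖⁻¹ • τ) ((tangent X).smul_mem _ hτ)
    (by rw [norm_smul, norm_inv, norm_norm, inv_mul_cancel₀ hn.ne'])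
  simp_rw [inner_smul_right, integral_const_mul] at h1
  exact mul_left_cancel₀ (inv_ne_zero hn.ne') h1

lemma starProjection_gradient_mean (hRetr : IsRetraction Retr) {M₂ : ℝ}
    (hRetr₂ : ∀ X ∈ stiefel d r, ∀ ξ ∈ tangent X, ‖Retr X ξ - (X + ξ)‖ ≤ M₂ * ‖ξ‖ ^ 2)
    (hf : ∀ i, ContDiff ℝ 2 (f i)) (hfbar : ContDiff ℝ 2 fbar)
    (hm : ∀ X, Measurable fun z => f z X) (hi : ∀ X, Integrable (fun z => f z X) P)
    (hmean : ∀ X, fbar X = ∫ z, f z X ∂P)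
    (hG : ∀ i, ∀ X ∈ stiefel d r, ‖gradient (f i) X‖ ≤ G)
    {X : Amb d r} (hX : X ∈ stiefel d r) :
    (tangent X).starProjection (gradient fbar X)
      = ∫ z, (tangent X).starProjection (gradient (f z) X) ∂P := by
  have hint := integrable_gradient (P := P) hf hm hG hX
  rw [ContinuousLinearMap.integral_comp_comm _ hint]
  refine ext_inner_right ℝ fun w => ?_
  rw [Submodule.inner_starProjection_left_eq_right, Submodule.inner_starProjection_left_eq_right,
    inner_gradient_mean hRetr hRetr₂ hf hfbar hm hi hmean hG hX
      (Submodule.starProjection_apply_mem _ _), real_inner_comm, ← integral_inner hint]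
  simp_rw [real_inner_comm]

end MeanGradient

/-! ### Deterministic analysis of a single run. -/

section Run

variable {d r : ℕ} {Retr : Amb d r → Amb d r → Amb d r}
  {Γ : Amb d r → Amb d r → Amb d r → Amb d r} {ι : Type*} {f : ι → Amb d r → ℝ}
  {fbar h : Amb d r → ℝ} {η γ : ℝ} {q : ℕ} {X₀ : Amb d r} {S : ℕ → Multiset ι}

lemma norm_batchGrad_le {G : ℝ} (hG0 : 0 ≤ G) (S : Multiset ι) {X : Amb d r}
    (hG : ∀ i, ‖gradient (f i) X‖ ≤ G) : ‖batchGrad f S X‖ ≤ G := by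
  rw [batchGrad, norm_smul, norm_inv, Real.norm_natCast]
  have h1 : ‖(S.map fun i => gradient (f i) X).sum‖ ≤ S.card * G := by
    refine (norm_multiset_sum_le _).trans ?_
    rw [Multiset.map_map]
    refine (Multiset.sum_le_card_nsmul _ G ?_).trans ?_
    · intro x hx
      obtain ⟨i, -, rfl⟩ := Multiset.mem_map.1 hx
      exact hG i
    · rw [Multiset.card_map, nsmul_eq_mul]
  rcases Nat.eq_zero_or_pos S.card with h0 | h0
  · simp [h0, hG0]
  · rwa [inv_mul_le_iff₀ (by exact_mod_cast h0)]

lemma spbRun_mem (hRetr : IsRetraction Retr) (hc : ConvexOn ℝ univ h) (hγ : 0 < γ)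
    (hX₀ : X₀ ∈ stiefel d r) (t : ℕ) :
    (spbRun Retr Γ f h η γ q X₀ S t).Xprev ∈ stiefel d r ∧
    (spbRun Retr Γ f h η γ q X₀ S t).step ∈ tangent (spbRun Retr Γ f h η γ q X₀ S t).Xprev ∧
    (spbRun Retr Γ f h η γ q X₀ S t).X = Retr (spbRun Retr Γ f h η γ q X₀ S t).Xprev
      (spbRun Retr Γ f h η γ q X₀ S t).step := by
  induction t with
  | zero => exact ⟨hX₀, (tangent X₀).zero_mem, (hRetr.zero X₀ hX₀).symm⟩
  | succ t ih =>
    have hX : (spbRun Retr Γ f h η γ q X₀ S t).X ∈ stiefel d r := by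
      rw [ih.2.2]; exact hRetr.mapsTo _ ih.1 _ ih.2.1
    exact ⟨hX, (tangent _).smul_mem _ (isProxDir_proxDir hc hγ hX _).1, rfl⟩

lemma spbRun_X_mem (hRetr : IsRetraction Retr) (hc : ConvexOn ℝ univ h) (hγ : 0 < γ)
    (hX₀ : X₀ ∈ stiefel d r) (t : ℕ) : (spbRun Retr Γ f h η γ q X₀ S t).X ∈ stiefel d r :=
  (spbRun_mem hRetr hc hγ hX₀ (t + 1)).1

/-- A crude bound growing with `t`; it serves only to make all the random variables bounded, hence
integrable. -/
lemma norm_spbRun_V_le (hRetr : IsRetraction Retr) (hΓ : IsIsometricTransport Retr Γ)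
    (hc : ConvexOn ℝ univ h) (hγ : 0 < γ) (hX₀ : X₀ ∈ stiefel d r) {G : ℝ} (hG0 : 0 ≤ G)
    (hG : ∀ i, ∀ X ∈ stiefel d r, ‖gradient (f i) X‖ ≤ G) (t : ℕ) :
    ‖(spbRun Retr Γ f h η γ q X₀ S t).V‖ ≤ 2 * t * G := by
  induction t with
  | zero => simp [spbRun]
  | succ t ih =>
    change ‖spbEstimator Γ f q t (S t) (spbRun Retr Γ f h η γ q X₀ S t)‖ ≤ _
    have hm := spbRun_mem (Γ := Γ) (f := f) (η := η) (q := q) (S := S) hRetr hc hγ hX₀ t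
    have hX := spbRun_X_mem (Γ := Γ) (f := f) (η := η) (q := q) (S := S) hRetr hc hγ hX₀ t
    set s := spbRun Retr Γ f h η γ q X₀ S t
    have h1 := norm_batchGrad_le hG0 (S t) (fun i => hG i _ hX)
    have h2 := norm_batchGrad_le hG0 (S t) (fun i => hG i _ hm.1)
    have ht : (0 : ℝ) ≤ t := Nat.cast_nonneg t
    push_cast
    rw [spbEstimator]
    split_ifs
    · nlinarith [mul_nonneg ht hG0]
    · refine (norm_sub_le _ _).trans ?_
      rw [hΓ.isometric _ hm.1 _ hm.2.1 _ (Submodule.starProjection_apply_mem _ _)]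
      have h3 := (tangent s.Xprev).norm_starProjection_apply_le (batchGrad f (S t) s.Xprev - s.V)
      have h4 := norm_sub_le (batchGrad f (S t) s.Xprev) s.V
      linarith

/-- The tangential error of the gradient estimator. -/
noncomputable def tangentError (fbar : Amb d r → ℝ) (s : SPBState d r) : Amb d r :=
  (tangent s.Xprev).starProjection (s.V - gradient fbar s.Xprev)

/-- Balance of the coefficients of `η ‖ζ‖²`: the proximal step with `γ = 2/5` gains `5/2`; the
curvature terms `η (LR / 2 + 4 Lh M₂)` cost at most `4 * 1/2 = 2`; Young's inequality on the pairing
of the error with `ζ` costs `1/8`. What remains is `3/8`. The condition `η ≤ 1` lets convexity of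
`h` pass from `ζ` to `η ζ`. -/
lemma spb_descent (hRetr : IsRetraction Retr) {M₂ : ℝ}
    (hRetr₂ : ∀ X ∈ stiefel d r, ∀ ξ ∈ tangent X, ‖Retr X ξ - (X + ξ)‖ ≤ M₂ * ‖ξ‖ ^ 2)
    (hfbar : ContDiff ℝ 2 fbar) {U : Set (Amb d r)} {LR Lh : ℝ} (hLR : 0 ≤ LR) (hLh : 0 ≤ Lh)
    (hU : ∀ X ∈ U, ∀ ξ ∈ tangent X, ‖ξ‖ = 1 → ∀ t : ℝ, 0 ≤ t →
      (∀ τ ∈ Icc 0 t, Retr X (τ • ξ) ∈ U) →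
      iteratedDeriv 2 (fun s : ℝ => fbar (Retr X (s • ξ))) t ≤ LR)
    (hc : ConvexOn ℝ univ h)
    (hL : ∀ X ∈ stiefel d r, ∀ Y ∈ stiefel d r, |h X - h Y| ≤ Lh * ‖X - Y‖)
    (hη0 : 0 < η) (hη1 : η ≤ 1) (hη : η * (LR / 2 + Lh * M₂) ≤ 1 / 2)
    {X : Amb d r} (hX : X ∈ stiefel d r) (V : Amb d r)
    (hcurve : ∀ τ ∈ Icc (0 : ℝ) 1, Retr X (τ • (η • proxDir h (2 / 5) X V)) ∈ U) :
    fbar (Retr X (η • proxDir h (2 / 5) X V)) + h (Retr X (η • proxDir h (2 / 5) X V))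
      + 3 / (8 * η) * ‖η • proxDir h (2 / 5) X V‖ ^ 2 ≤
    fbar X + h X + 2 * η * ‖(tangent X).starProjection (V - gradient fbar X)‖ ^ 2 := by
  have hp := isProxDir_proxDir hc (by norm_num : (0 : ℝ) < 2 / 5) hX V
  set ζ := proxDir h (2 / 5) X V
  set e := (tangent X).starProjection (V - gradient fbar X) with he
  have hm := (tangent X).smul_mem η hp.1
  have h1 := retr_descent hRetr hRetr₂ hfbar hU hX hm hcurve
  have h2 := h_retr_le hRetr.mapsTo hRetr₂ hRetr.zero hc hLh hL hX hm
  have h3 := hc.2 (mem_univ X) (mem_univ (X + ζ)) (sub_nonneg.2 hη1) hη0.le (by ring)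
  have e3 : (1 - η) • X + η • (X + ζ) = X + η • ζ := by module
  rw [e3, smul_eq_mul, smul_eq_mul] at h3
  have h4 := mul_le_mul_of_nonneg_left (hp.inner_add_le hc (by norm_num)) hη0.le
  have h5 : inner ℝ e ζ = inner ℝ V ζ - inner ℝ (gradient fbar X) ζ := by
    rw [he, Submodule.inner_starProjection_left_eq_right,
      Submodule.starProjection_eq_self_iff.2 hp.1, inner_sub_left]
  have h6 := (abs_le.1 (abs_real_inner_le_norm e ζ)).1
  have h7 : ‖e‖ * ‖ζ‖ ≤ 2 * ‖e‖ ^ 2 + ‖ζ‖ ^ 2 / 8 := by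
    nlinarith [sq_nonneg (4 * ‖e‖ - ‖ζ‖)]
  have h8 : ‖η • ζ‖ ^ 2 = η ^ 2 * ‖ζ‖ ^ 2 := by
    rw [norm_smul, mul_pow, Real.norm_eq_abs, sq_abs]
  rw [inner_smul_right] at h1
  rw [h8] at h1 h2 ⊢
  have h9 : 3 / (8 * η) * (η ^ 2 * ‖ζ‖ ^ 2) = 3 / 8 * (η * ‖ζ‖ ^ 2) := by
    field_simp
  rw [h9]
  have h10 : (η * ‖ζ‖ ^ 2) * (η * (LR / 2 + Lh * M₂)) ≤ (η * ‖ζ‖ ^ 2) * (1 / 2) :=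
    mul_le_mul_of_nonneg_left hη (by positivity)
  have h11 : 0 ≤ LR * (η ^ 2 * ‖ζ‖ ^ 2) := by positivity
  have h12 : η * (inner ℝ (gradient fbar X) ζ - inner ℝ V ζ)
      ≤ η * (2 * ‖e‖ ^ 2 + ‖ζ‖ ^ 2 / 8) := mul_le_mul_of_nonneg_left (by linarith) hη0.le
  norm_num at h4
  nlinarith

lemma norm_gradMap_le {M₁ : ℝ} (hM₁ : 0 < M₁)
    (hRetr₁ : ∀ X ∈ stiefel d r, ∀ ξ ∈ tangent X, ‖Retr X ξ - X‖ ≤ M₁ * ‖ξ‖)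
    (hc : ConvexOn ℝ univ h) (hγ : 0 < γ) {X : Amb d r} (hX : X ∈ stiefel d r) (V : Amb d r) :
    ‖gradMap Retr fbar h γ X‖ ≤ γ⁻¹ * (M₁ * (‖proxDir h γ X V‖ +
      γ * ‖(tangent X).starProjection (V - gradient fbar X)‖)) := by
  have hp := isProxDir_proxDir hc hγ hX (gradient fbar X)
  rw [gradMap, norm_smul, norm_inv, Real.norm_of_nonneg hγ.le]
  refine mul_le_mul_of_nonneg_left ?_ (inv_nonneg.2 hγ.le)
  rw [norm_sub_rev]
  refine (hRetr₁ X hX _ hp.1).trans (mul_le_mul_of_nonneg_left ?_ hM₁.le)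
  have h1 := (isProxDir_proxDir hc hγ hX V).norm_sub_le hc hγ hp
  have h2 := norm_sub_norm_le (proxDir h γ X (gradient fbar X)) (proxDir h γ X V)
  rw [norm_sub_rev] at h2
  linarith

/-- Both points lie on the sphere of radius `√r`. This handles integrability and the last iterate,
which the descent sum does not reach. -/
lemma norm_gradMap_le_sqrt (hRetr : IsRetraction Retr)
    (hc : ConvexOn ℝ univ h) (hγ : 0 < γ) {X : Amb d r} (hX : X ∈ stiefel d r) :
    ‖gradMap Retr fbar h γ X‖ ≤ γ⁻¹ * (2 * √r) := by
  have hp := isProxDir_proxDir hc hγ hX (gradient fbar X)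
  rw [gradMap, norm_smul, norm_inv, Real.norm_of_nonneg hγ.le]
  refine mul_le_mul_of_nonneg_left ((norm_sub_le _ _).trans ?_) (inv_nonneg.2 hγ.le)
  rw [norm_of_mem_stiefel hX, norm_of_mem_stiefel (hRetr.mapsTo X hX _ hp.1)]
  linarith

lemma continuousOn_gradMap (hRetr : IsRetraction Retr) (hfbar : ContDiff ℝ 2 fbar)
    (hc : ConvexOn ℝ univ h) (hγ : 0 < γ) :
    ContinuousOn (gradMap Retr fbar h γ) (stiefel d r) := by
  have h1 : ContinuousOn (fun X => proxDir h γ X (gradient fbar X)) (stiefel d r) :=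
    ContinuousOn.comp (g := fun p : Amb d r × Amb d r => proxDir h γ p.1 p.2)
      (f := fun X => (X, gradient fbar X)) (t := stiefel d r ×ˢ univ)
      (continuousOn_proxDir hc hγ)
      (continuousOn_id.prodMk (contDiff_gradient hfbar).continuous.continuousOn)
      fun X hX => ⟨hX, mem_univ _⟩
  have h2 : ContinuousOn (fun X => Retr X (proxDir h γ X (gradient fbar X))) (stiefel d r) :=
    ContinuousOn.comp (g := fun p : Amb d r × Amb d r => Retr p.1 p.2)
      (f := fun X => (X, proxDir h γ X (gradient fbar X)))
      (t := {p | p.1 ∈ stiefel d r ∧ p.2 ∈ tangent p.1})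
      hRetr.smooth.continuousOn (continuousOn_id.prodMk h1)
      fun X hX => ⟨hX, (isProxDir_proxDir hc hγ hX _).1⟩
  exact ContinuousOn.const_smul (continuousOn_id.sub h2) (γ⁻¹ : ℝ)

/-- Summing an error recursion that is restarted every `q` steps. -/
lemma sum_le_of_restarted_recursion {a z : ℕ → ℝ} {v κ : ℝ} {q : ℕ} (hq : 1 ≤ q) (hκ : 0 ≤ κ)
    (hz : ∀ t, 0 ≤ z t) (T : ℕ) (hres : ∀ t < T, t % q = 0 → a t ≤ v)
    (hrec : ∀ t, t + 1 < T → (t + 1) % q ≠ 0 → a (t + 1) ≤ a t + κ * z t) :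
    ∑ t ∈ Finset.range T, a t ≤ T * v + q * κ * ∑ t ∈ Finset.range T, z t := by
  -- Unrolled back to the last restart, only steps of the same block of length `q` contribute. After
  -- exchanging the sums, each `z j` is counted at most `q` times.
  have key : ∀ t < T, a t ≤ v + κ * ∑ j ∈ Finset.range t, if j / q = t / q then z j else 0 := by
    intro t
    induction t with
    | zero => intro h0; simpa using hres 0 h0 (Nat.zero_mod q)
    | succ t ih =>
      intro ht
      by_cases hdvd : (t + 1) % q = 0
      · have hsum : 0 ≤ ∑ j ∈ Finset.range (t + 1), if j / q = (t + 1) / q then z j else 0 :=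
          Finset.sum_nonneg fun j _ => by split_ifs <;> simp [hz]
        linarith [hres _ ht hdvd, mul_nonneg hκ hsum]
      · have hdiv : (t + 1) / q = t / q :=
          Nat.succ_div_of_not_dvd fun hd => hdvd (Nat.mod_eq_zero_of_dvd hd)
        have := ih (by omega)
        rw [Finset.sum_range_succ, hdiv, if_pos rfl, mul_add]
        linarith [hrec t ht hdvd]
  calc ∑ t ∈ Finset.range T, a t
      ≤ ∑ t ∈ Finset.range T,
          (v + κ * ∑ j ∈ Finset.range T, if j / q = t / q then z j else 0) := by
        refine Finset.sum_le_sum fun t ht => (key t (Finset.mem_range.1 ht)).trans ?_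
        refine add_le_add le_rfl (mul_le_mul_of_nonneg_left
          (Finset.sum_le_sum_of_subset_of_nonneg
            (Finset.range_subset_range.2 (Finset.mem_range.1 ht).le) fun j _ _ => ?_) hκ)
        split_ifs <;> simp [hz]
    _ = T * v + κ * ∑ j ∈ Finset.range T, ∑ t ∈ Finset.range T,
          if j / q = t / q then z j else 0 := by
        rw [Finset.sum_add_distrib, Finset.sum_const, Finset.card_range, nsmul_eq_mul,
          ← Finset.mul_sum, Finset.sum_comm]
    _ ≤ T * v + κ * ∑ j ∈ Finset.range T, q * z j := by
        gcongr with j _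
        rw [← Finset.sum_filter, Finset.sum_const, nsmul_eq_mul]
        refine mul_le_mul_of_nonneg_right ?_ (hz j)
        have hsub : {t ∈ Finset.range T | j / q = t / q} ⊆
            Finset.Ico (j / q * q) (j / q * q + q) := by
          intro t ht
          have ht' := (Finset.mem_filter.1 ht).2
          rw [Finset.mem_Ico, ht']
          have h1 := Nat.div_add_mod t q
          have h2 := Nat.mod_lt t (by omega : q > 0)
          rw [mul_comm] at h1
          omega
        have := Finset.card_le_card hsub
        rw [Nat.card_Ico, Nat.add_sub_cancel_left] at this
        exact_mod_cast this
    _ = _ := by rw [← Finset.mul_sum]; ring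

/-- The number of restarts among the first `T` iterations is at most `T / q + 1`. -/
lemma calls_le {f : ι → Amb d r → ℝ} {q N k : ℕ} (hq : 1 ≤ q)
    (hS : ∀ t, (S t).card = if t % q = 0 then N else k) (T : ℕ) :
    ((spbRun Retr Γ f h η γ q X₀ S T).calls : ℝ) ≤ (T / q + 1) * N + 2 * k * T := by
  -- The natural quotient `(T + (q - 1)) / q` is `T / q` rounded up: the number of multiples of `q`
  -- below `T`, including `0`.
  have hcount : ∀ T, (spbRun Retr Γ f h η γ q X₀ S T).calls ≤ ((T + (q - 1)) / q) * N + 2 * k * T := by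
    intro T
    induction T with
    | zero =>
      simp [spbRun]
    | succ t ih =>
      change (spbRun Retr Γ f h η γ q X₀ S t).calls
        + (if t % q = 0 then (S t).card else 2 * (S t).card) ≤ _
      rw [hS t]
      by_cases h0 : t % q = 0
      · rw [if_pos h0, if_pos h0]
        have h1 : (t + 1 + (q - 1)) / q = (t + (q - 1)) / q + 1 := by
          obtain ⟨c, rfl⟩ := Nat.dvd_of_mod_eq_zero h0
          have e1 : q * c + 1 + (q - 1) = q * (c + 1) := by rw [mul_add]; omega
          rw [e1, Nat.mul_div_cancel_left _ (by omega), Nat.mul_add_div (by omega),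
            Nat.div_eq_of_lt (by omega : q - 1 < q)]
        rw [h1]
        nlinarith
      · rw [if_neg h0, if_neg h0]
        have h1 : (t + (q - 1)) / q ≤ (t + 1 + (q - 1)) / q := Nat.div_le_div_right (by omega)
        nlinarith [Nat.mul_le_mul_right N h1]
  have h1 : ((spbRun Retr Γ f h η γ q X₀ S T).calls : ℝ) ≤
      (((T + (q - 1)) / q : ℕ) : ℝ) * N + 2 * k * T := by exact_mod_cast hcount T
  refine h1.trans ?_
  gcongr
  have hq' : (0 : ℝ) < q := by exact_mod_cast hq
  refine Nat.cast_div_le.trans ?_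
  rw [div_add_one hq'.ne']
  gcongr
  rw [Nat.cast_add]
  gcongr
  exact_mod_cast Nat.sub_le q 1

end Run

/-! ### Measurability of the random run and the conditional error estimates. -/

section RandomRun

/-- The retraction, the transport and the proximal map are controlled only on the manifold, so
measurability passes through the subtype in which the argument takes its values. -/
lemma measurable_comp_of_continuousOn {A B Ω : Type*} [TopologicalSpace A] [MeasurableSpace A]
    [BorelSpace A] [TopologicalSpace B] [MeasurableSpace B] [BorelSpace B]
    {m : MeasurableSpace Ω} {g : A → B} {s : Set A} (hg : ContinuousOn g s) {u : Ω → A}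
    (hu : Measurable[m] u) (hus : ∀ ω, u ω ∈ s) : Measurable[m] fun ω => g (u ω) :=
  (continuousOn_iff_continuous_domRestrict.1 hg).measurable.comp (hu.subtype_mk (h := hus))

/-- Integrating out a random variable that is independent of the rest. -/
lemma lintegral_le_of_indep {Ω A E : Type*} {m mΩ : MeasurableSpace Ω} {μ : Measure Ω}
    [IsProbabilityMeasure μ] [MeasurableSpace A] [MeasurableSpace E]
    (hm : m ≤ mΩ) {u : Ω → A} (hu : Measurable[m] u) {W : Ω → E} (hW : Measurable W)
    (hind : Indep m (MeasurableSpace.comap W inferInstance) μ) {ψ : A × E → ENNReal}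
    (hψ : Measurable ψ) {g : A → ENNReal} (hg : ∀ a, ∫⁻ e, ψ (a, e) ∂(μ.map W) ≤ g a) :
    ∫⁻ ω, ψ (u ω, W ω) ∂μ ≤ ∫⁻ ω, g (u ω) ∂μ := by
  have hu' : Measurable u := hu.mono hm le_rfl
  have hI : IndepFun u W μ := by
    rw [IndepFun_iff_Indep]
    exact indep_of_indep_of_le_left hind hu.comap_le
  have hprod := (indepFun_iff_map_prod_eq_prod_map_map hu'.aemeasurable hW.aemeasurable).1 hI
  have : IsProbabilityMeasure (μ.map W) := Measure.isProbabilityMeasure_map hW.aemeasurable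
  calc ∫⁻ ω, ψ (u ω, W ω) ∂μ = ∫⁻ p, ψ p ∂(μ.map fun ω => (u ω, W ω)) :=
        (lintegral_map hψ (hu'.prodMk hW)).symm
    _ = ∫⁻ a, ∫⁻ e, ψ (a, e) ∂(μ.map W) ∂(μ.map u) := by
        rw [hprod, lintegral_prod _ hψ.aemeasurable]
    _ = ∫⁻ ω, ∫⁻ e, ψ (u ω, e) ∂(μ.map W) ∂μ := by
        rw [lintegral_map hψ.lintegral_prod_right' hu']
    _ ≤ ∫⁻ ω, g (u ω) ∂μ := lintegral_mono fun ω => hg (u ω)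

variable {d r : ℕ} {Retr : Amb d r → Amb d r → Amb d r}
  {Γ : Amb d r → Amb d r → Amb d r → Amb d r} {ι : Type*} {f : ι → Amb d r → ℝ}
  {fbar h : Amb d r → ℝ} {η γ : ℝ} {q : ℕ} {X₀ : Amb d r}

lemma IsIsometricTransport.sub (hΓ : IsIsometricTransport Retr Γ) {X ξ ζ₁ ζ₂ : Amb d r}
    (hX : X ∈ stiefel d r) (hξ : ξ ∈ tangent X) (h₁ : ζ₁ ∈ tangent X) (h₂ : ζ₂ ∈ tangent X) :
    Γ X ξ (ζ₁ - ζ₂) = Γ X ξ ζ₁ - Γ X ξ ζ₂ := by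
  have e : ζ₁ - ζ₂ = ζ₁ + (-1 : ℝ) • ζ₂ := by module
  rw [e, hΓ.add X hX ξ hξ _ h₁ _ ((tangent X).smul_mem _ h₂), hΓ.smul X hX ξ hξ _ _ h₂]
  module

variable {E Ω : Type*} [MeasurableSpace E] {B : ℕ → E → Multiset ι}

lemma measurable_transported {m : MeasurableSpace Ω} (hΓ : IsIsometricTransport Retr Γ)
    {X ξ g : Ω → Amb d r} (hX : Measurable[m] X) (hξ : Measurable[m] ξ) (hg : Measurable[m] g)
    (hmem : ∀ ω, X ω ∈ stiefel d r ∧ ξ ω ∈ tangent (X ω)) :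
    Measurable[m] fun ω => Γ (X ω) (ξ ω) ((tangent (X ω)).starProjection (g ω)) := by
  have h1 : Measurable[m] fun ω => (tangent (X ω)).starProjection (g ω) := by
    have : (fun ω => (tangent (X ω)).starProjection (g ω)) = fun ω => tangentProj (X ω) (g ω) :=
      funext fun ω => starProjection_tangent (hmem ω).1 _
    rw [this]
    exact continuous_tangentProj.measurable.comp (hX.prodMk hg)
  exact measurable_comp_of_continuousOn hΓ.smooth.continuousOn (hX.prodMk (hξ.prodMk h1))
    fun ω => ⟨(hmem ω).1, (hmem ω).2, Submodule.starProjection_apply_mem _ _⟩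

lemma measurable_retr {m : MeasurableSpace Ω} (hRetr : IsRetraction Retr)
    {X ξ : Ω → Amb d r} (hX : Measurable[m] X) (hξ : Measurable[m] ξ)
    (hmem : ∀ ω, X ω ∈ stiefel d r ∧ ξ ω ∈ tangent (X ω)) :
    Measurable[m] fun ω => Retr (X ω) (ξ ω) :=
  measurable_comp_of_continuousOn hRetr.smooth.continuousOn (hX.prodMk hξ) hmem

lemma measurable_proxDir {m : MeasurableSpace Ω} (hc : ConvexOn ℝ univ h) (hγ : 0 < γ)
    {X V : Ω → Amb d r} (hX : Measurable[m] X) (hV : Measurable[m] V)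
    (hmem : ∀ ω, X ω ∈ stiefel d r) : Measurable[m] fun ω => proxDir h γ (X ω) (V ω) :=
  measurable_comp_of_continuousOn (g := fun p : Amb d r × Amb d r => proxDir h γ p.1 p.2)
    (s := stiefel d r ×ˢ univ) (u := fun ω => (X ω, V ω)) (continuousOn_proxDir hc hγ)
    (hX.prodMk hV) fun ω => ⟨hmem ω, mem_univ _⟩

variable {mΩ : MeasurableSpace Ω} {μ : Measure Ω} {W : ℕ → Ω → E} {m : ℕ → MeasurableSpace Ω}

lemma measurable_spbRun (hRetr : IsRetraction Retr) (hΓ : IsIsometricTransport Retr Γ)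
    (hc : ConvexOn ℝ univ h) (hγ : 0 < γ) (hX₀ : X₀ ∈ stiefel d r)
    (hmono : ∀ t, m t ≤ m (t + 1)) (hW : ∀ t, Measurable[m (t + 1)] (W t))
    (hB : ∀ t, Measurable fun p : Amb d r × E => batchGrad f (B t p.2) p.1) (t : ℕ) :
    Measurable[m t] (fun ω => (spbRun Retr Γ f h η γ q X₀ (fun t => B t (W t ω)) t).Xprev) ∧
    Measurable[m t] (fun ω => (spbRun Retr Γ f h η γ q X₀ (fun t => B t (W t ω)) t).step) ∧
    Measurable[m t] (fun ω => (spbRun Retr Γ f h η γ q X₀ (fun t => B t (W t ω)) t).V) ∧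
    Measurable[m t] (fun ω => (spbRun Retr Γ f h η γ q X₀ (fun t => B t (W t ω)) t).X) := by
  induction t with
  | zero => exact ⟨measurable_const, measurable_const, measurable_const, measurable_const⟩
  | succ t ih =>
    set run := fun ω => spbRun Retr Γ f h η γ q X₀ (fun t => B t (W t ω))
    have hmem : ∀ ω t, (run ω t).Xprev ∈ stiefel d r ∧ (run ω t).step ∈ tangent (run ω t).Xprev ∧
        (run ω t).X = Retr (run ω t).Xprev (run ω t).step :=
      fun ω t => spbRun_mem hRetr hc hγ hX₀ t
    have h1 := ih.1.mono (hmono t) le_rfl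
    have h2 := ih.2.1.mono (hmono t) le_rfl
    have h3 := ih.2.2.1.mono (hmono t) le_rfl
    have h4 := ih.2.2.2.mono (hmono t) le_rfl
    have hV : Measurable[m (t + 1)] fun ω => (run ω (t + 1)).V := by
      change Measurable[m (t + 1)] fun ω => spbEstimator Γ f q t (B t (W t ω)) (run ω t)
      have hb1 := (hB t).comp (h4.prodMk (hW t))
      by_cases h0 : t % q = 0
      · simp only [spbEstimator, h0, if_true]
        exact hb1
      · simp only [spbEstimator, h0, if_false]
        have hb2 := (hB t).comp (h1.prodMk (hW t))
        exact hb1.sub (measurable_transported hΓ h1 h2 (hb2.sub h3)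
          fun ω => ⟨(hmem ω t).1, (hmem ω t).2.1⟩)
    have hs : Measurable[m (t + 1)] fun ω => (run ω (t + 1)).step := by
      change Measurable[m (t + 1)] fun ω => η • proxDir h γ (run ω t).X (run ω (t + 1)).V
      have hp : Measurable[m (t + 1)] fun ω => proxDir h γ (run ω t).X (run ω (t + 1)).V :=
        measurable_proxDir hc hγ h4 hV fun ω => (hmem ω (t + 1)).1
      exact hp.const_smul η
    exact ⟨h4, hs, hV, measurable_retr hRetr h4 hs
      fun ω => ⟨(hmem ω (t + 1)).1, (hmem ω (t + 1)).2.1⟩⟩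

variable [IsProbabilityMeasure μ]

/-- The batch is independent of the current iterate, so that point may be frozen and the uniform
variance bound applied to it. State `t + 1` stores `V_t` together with `X_t` as `Xprev`, hence the
shift. -/
lemma lintegral_error_restart (hRetr : IsRetraction Retr) (hΓ : IsIsometricTransport Retr Γ)
    (hc : ConvexOn ℝ univ h) (hγ : 0 < γ) (hX₀ : X₀ ∈ stiefel d r) (hfbar : ContDiff ℝ 2 fbar)
    (hm : ∀ t, m t ≤ mΩ) (hmono : ∀ t, m t ≤ m (t + 1)) (hW : ∀ t, Measurable[m (t + 1)] (W t))
    (hind : ∀ t, Indep (m t) (MeasurableSpace.comap (W t) inferInstance) μ)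
    (hB : ∀ t, Measurable fun p : Amb d r × E => batchGrad f (B t p.2) p.1) {v : ℝ} {t : ℕ}
    (ht : t % q = 0)
    (hres : ∀ X ∈ stiefel d r, ∫⁻ e, ENNReal.ofReal (‖(tangent X).starProjection
      (batchGrad f (B t e) X - gradient fbar X)‖ ^ 2) ∂(μ.map (W t)) ≤ ENNReal.ofReal v) :
    ∫⁻ ω, ENNReal.ofReal (‖tangentError fbar
      (spbRun Retr Γ f h η γ q X₀ (fun t => B t (W t ω)) (t + 1))‖ ^ 2) ∂μ ≤ ENNReal.ofReal v := by
  set run := fun ω => spbRun Retr Γ f h η γ q X₀ (fun t => B t (W t ω))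
  have hmem : ∀ ω, (run ω t).X ∈ stiefel d r := fun ω => spbRun_X_mem hRetr hc hγ hX₀ t
  have hX := (measurable_spbRun (η := η) (q := q) hRetr hΓ hc hγ hX₀ hmono hW hB t).2.2.2
  have hψ : Measurable fun p : stiefel d r × E => ENNReal.ofReal
      (‖tangentProj (p.1 : Amb d r) (batchGrad f (B t p.2) p.1 - gradient fbar p.1)‖ ^ 2) := by
    have h1 : Measurable fun p : stiefel d r × E => (p.1 : Amb d r) :=
      measurable_subtype_coe.comp measurable_fst
    have h2 := (hB t).comp (h1.prodMk measurable_snd)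
    have h3 := (contDiff_gradient hfbar).continuous.measurable.comp h1
    exact ((continuous_tangentProj.measurable.comp (h1.prodMk (h2.sub h3))).norm.pow_const
      2).ennreal_ofReal
  have key := lintegral_le_of_indep (hm t) (u := fun ω => (⟨(run ω t).X, hmem ω⟩ : stiefel d r))
    (hX.subtype_mk) ((hW t).mono (hm _) le_rfl) (hind t) hψ (g := fun _ => ENNReal.ofReal v)
    (fun a => by
      refine le_trans (le_of_eq (lintegral_congr fun e => ?_)) (hres a a.2)
      rw [starProjection_tangent a.2])
  rw [lintegral_const, measure_univ, mul_one] at key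
  refine le_trans (le_of_eq (lintegral_congr fun ω => ?_)) key
  have hV : (run ω (t + 1)).V = batchGrad f (B t (W t ω)) (run ω t).X := by
    change spbEstimator Γ f q t (B t (W t ω)) (run ω t) = _
    rw [spbEstimator, if_pos ht]
  change ENNReal.ofReal (‖(tangent (run ω t).X).starProjection
    ((run ω (t + 1)).V - gradient fbar (run ω t).X)‖ ^ 2) = _
  rw [hV, starProjection_tangent (hmem ω)]

/-- With the past frozen, the new error is the transported old error plus the batch fluctuation of
the transported gradient difference. In `hrec` the vector `a` stands for the transported old error,
whose norm is the old one because the transport is isometric. -/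
lemma lintegral_error_recursion (hRetr : IsRetraction Retr) (hΓ : IsIsometricTransport Retr Γ)
    (hc : ConvexOn ℝ univ h) (hγ : 0 < γ) (hX₀ : X₀ ∈ stiefel d r) (hfbar : ContDiff ℝ 2 fbar)
    (hm : ∀ t, m t ≤ mΩ) (hmono : ∀ t, m t ≤ m (t + 1)) (hW : ∀ t, Measurable[m (t + 1)] (W t))
    (hind : ∀ t, Indep (m t) (MeasurableSpace.comap (W t) inferInstance) μ)
    (hB : ∀ t, Measurable fun p : Amb d r × E => batchGrad f (B t p.2) p.1) {κ : ℝ} {t : ℕ}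
    (ht : t % q ≠ 0)
    (hrec : ∀ X ∈ stiefel d r, ∀ ξ ∈ tangent X, ∀ a : Amb d r,
      ∫⁻ e, ENNReal.ofReal (‖a +
        (((tangent (Retr X ξ)).starProjection (batchGrad f (B t e) (Retr X ξ)) -
            Γ X ξ ((tangent X).starProjection (batchGrad f (B t e) X))) -
          ((tangent (Retr X ξ)).starProjection (gradient fbar (Retr X ξ)) -
            Γ X ξ ((tangent X).starProjection (gradient fbar X))))‖ ^ 2) ∂(μ.map (W t)) ≤
        ENNReal.ofReal (‖a‖ ^ 2 + κ * ‖ξ‖ ^ 2)) :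
    ∫⁻ ω, ENNReal.ofReal (‖tangentError fbar
      (spbRun Retr Γ f h η γ q X₀ (fun t => B t (W t ω)) (t + 1))‖ ^ 2) ∂μ ≤
    ∫⁻ ω, ENNReal.ofReal
      (‖tangentError fbar (spbRun Retr Γ f h η γ q X₀ (fun t => B t (W t ω)) t)‖ ^ 2 +
        κ * ‖(spbRun Retr Γ f h η γ q X₀ (fun t => B t (W t ω)) t).step‖ ^ 2) ∂μ := by
  set run := fun ω => spbRun Retr Γ f h η γ q X₀ (fun t => B t (W t ω))
  have hmem : ∀ ω, (run ω t).Xprev ∈ stiefel d r ∧ (run ω t).step ∈ tangent (run ω t).Xprev ∧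
      (run ω t).X = Retr (run ω t).Xprev (run ω t).step := fun ω => spbRun_mem hRetr hc hγ hX₀ t
  obtain ⟨hXp, hst, hV, -⟩ :=
    measurable_spbRun (η := η) (q := q) hRetr hΓ hc hγ hX₀ hmono hW hB t
  let A := {p : Amb d r × Amb d r × Amb d r // p.1 ∈ stiefel d r ∧ p.2.1 ∈ tangent p.1}
  let ψ : A × E → Amb d r := fun p => tangentProj (Retr p.1.1.1 p.1.1.2.1)
    (batchGrad f (B t p.2) (Retr p.1.1.1 p.1.1.2.1) - Γ p.1.1.1 p.1.1.2.1
      ((tangent p.1.1.1).starProjection (batchGrad f (B t p.2) p.1.1.1 - p.1.1.2.2)) -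
      gradient fbar (Retr p.1.1.1 p.1.1.2.1))
  have hψ : Measurable fun p : A × E => ENNReal.ofReal (‖ψ p‖ ^ 2) := by
    have h0 : Measurable fun p : A × E => (p.1 : Amb d r × Amb d r × Amb d r) :=
      measurable_subtype_coe.comp measurable_fst
    have h1 := measurable_fst.comp h0
    have h2 := measurable_fst.comp (measurable_snd.comp h0)
    have h3 := measurable_snd.comp (measurable_snd.comp h0)
    have h4 := measurable_retr hRetr h1 h2 fun p => p.1.2
    have h5 := (hB t).comp (h4.prodMk measurable_snd)
    have h6 := (hB t).comp (h1.prodMk measurable_snd)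
    have h7 := measurable_transported hΓ h1 h2 (h6.sub h3) fun p => p.1.2
    have h8 := (contDiff_gradient hfbar).continuous.measurable.comp h4
    exact ((continuous_tangentProj.measurable.comp
      (h4.prodMk ((h5.sub h7).sub h8))).norm.pow_const 2).ennreal_ofReal
  have hu : Measurable[m t] fun ω => (⟨((run ω t).Xprev, (run ω t).step, (run ω t).V),
      (hmem ω).1, (hmem ω).2.1⟩ : A) := (hXp.prodMk (hst.prodMk hV)).subtype_mk
  have hP : ∀ X g : Amb d r, (tangent X).starProjection g ∈ tangent X :=
    fun X g => Submodule.starProjection_apply_mem _ _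
  -- The frozen data are the previous point, the step and the estimator. Projecting at the new point
  -- leaves transported vectors unchanged, which gives the decomposition required by `hrec`.
  have key := lintegral_le_of_indep (hm t) hu ((hW t).mono (hm _) le_rfl) (hind t) hψ
    (g := fun a => ENNReal.ofReal (‖(tangent a.1.1).starProjection
      (a.1.2.2 - gradient fbar a.1.1)‖ ^ 2 + κ * ‖a.1.2.1‖ ^ 2)) (fun a => by
      obtain ⟨⟨X, ξ, V⟩, hX, hξ⟩ := a
      refine le_trans (le_of_eq (lintegral_congr fun e => ?_))
        ((hrec X hX ξ hξ (Γ X ξ ((tangent X).starProjection (V - gradient fbar X)))).trans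
          (le_of_eq ?_))
      · simp only [ψ]
        rw [← starProjection_tangent (hRetr.mapsTo X hX ξ hξ), map_sub, map_sub,
          Submodule.starProjection_eq_self_iff.2 (hΓ.mapsTo X hX ξ hξ _ (hP X _)),
          map_sub, map_sub, hΓ.sub hX hξ (hP X _) (hP X _), hΓ.sub hX hξ (hP X _) (hP X _)]
        congr 3
        abel
      · simp only
        rw [hΓ.isometric X hX ξ hξ _ (hP X _)])
  refine le_trans (le_of_eq (lintegral_congr fun ω => ?_)) key
  have hV : (run ω (t + 1)).V = batchGrad f (B t (W t ω)) (run ω t).X -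
      Γ (run ω t).Xprev (run ω t).step ((tangent (run ω t).Xprev).starProjection
        (batchGrad f (B t (W t ω)) (run ω t).Xprev - (run ω t).V)) := by
    change spbEstimator Γ f q t (B t (W t ω)) (run ω t) = _
    rw [spbEstimator, if_neg ht]
  change ENNReal.ofReal (‖(tangent (run ω t).X).starProjection
    ((run ω (t + 1)).V - gradient fbar (run ω t).X)‖ ^ 2) = _
  have hXm : (run ω t).X ∈ stiefel d r := spbRun_X_mem hRetr hc hγ hX₀ t
  rw [hV, starProjection_tangent hXm]
  change _ = ENNReal.ofReal (‖tangentProj (Retr (run ω t).Xprev (run ω t).step)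
    (batchGrad f (B t (W t ω)) (Retr (run ω t).Xprev (run ω t).step) -
      Γ (run ω t).Xprev (run ω t).step ((tangent (run ω t).Xprev).starProjection
        (batchGrad f (B t (W t ω)) (run ω t).Xprev - (run ω t).V)) -
      gradient fbar (Retr (run ω t).Xprev (run ω t).step))‖ ^ 2)
  rw [← (hmem ω).2.2]

end RandomRun

/-! ### From the error recursion and descent to stationarity. -/

section Convergence

variable {d r : ℕ} {Retr : Amb d r → Amb d r → Amb d r}
  {Γ : Amb d r → Amb d r → Amb d r → Amb d r} {ι : Type*} {f : ι → Amb d r → ℝ}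
  {fbar h : Amb d r → ℝ} {η γ : ℝ} {q : ℕ} {X₀ : Amb d r}
  {E Ω : Type*} [MeasurableSpace E] {B : ℕ → E → Multiset ι}
  {mΩ : MeasurableSpace Ω} {μ : Measure Ω} {W : ℕ → Ω → E} {m : ℕ → MeasurableSpace Ω}

/-- Random mini-batches `B t (W t)`, adapted to the filtration `m` and independent of the past, with
the second moment bounds that drive the estimator: `v` is the variance of a restart and `κ ‖ξ‖²`
the variance added by a recursive step along `ξ`. -/
structure IsBatchSampling (Retr : Amb d r → Amb d r → Amb d r)
    (Γ : Amb d r → Amb d r → Amb d r → Amb d r) (f : ι → Amb d r → ℝ) (fbar : Amb d r → ℝ) (q : ℕ)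
    {mΩ : MeasurableSpace Ω} (μ : Measure Ω) (B : ℕ → E → Multiset ι) (W : ℕ → Ω → E)
    (m : ℕ → MeasurableSpace Ω) (κ v : ℝ) : Prop where
  le : ∀ t, m t ≤ mΩ
  mono : ∀ t, m t ≤ m (t + 1)
  measurable : ∀ t, Measurable[m (t + 1)] (W t)
  indep : ∀ t, Indep (m t) (MeasurableSpace.comap (W t) inferInstance) μ
  measurable_grad : ∀ t, Measurable fun p : Amb d r × E => batchGrad f (B t p.2) p.1
  restart : ∀ t, t % q = 0 → ∀ X ∈ stiefel d r, ∫⁻ e, ENNReal.ofReal (‖(tangent X).starProjection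
      (batchGrad f (B t e) X - gradient fbar X)‖ ^ 2) ∂(μ.map (W t)) ≤ ENNReal.ofReal v
  recursion : ∀ t, t % q ≠ 0 → ∀ X ∈ stiefel d r, ∀ ξ ∈ tangent X, ∀ a : Amb d r,
      ∫⁻ e, ENNReal.ofReal (‖a +
        (((tangent (Retr X ξ)).starProjection (batchGrad f (B t e) (Retr X ξ)) -
            Γ X ξ ((tangent X).starProjection (batchGrad f (B t e) X))) -
          ((tangent (Retr X ξ)).starProjection (gradient fbar (Retr X ξ)) -
            Γ X ξ ((tangent X).starProjection (gradient fbar X))))‖ ^ 2) ∂(μ.map (W t)) ≤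
        ENNReal.ofReal (‖a‖ ^ 2 + κ * ‖ξ‖ ^ 2)

lemma measurable_tangentError {m : MeasurableSpace Ω} (hfbar : ContDiff ℝ 2 fbar)
    {s : Ω → SPBState d r} (hX : Measurable[m] fun ω => (s ω).Xprev)
    (hV : Measurable[m] fun ω => (s ω).V) (hmem : ∀ ω, (s ω).Xprev ∈ stiefel d r) :
    Measurable[m] fun ω => tangentError fbar (s ω) := by
  have : (fun ω => tangentError fbar (s ω))
      = fun ω => tangentProj (s ω).Xprev ((s ω).V - gradient fbar (s ω).Xprev) :=
    funext fun ω => starProjection_tangent (hmem ω) _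
  rw [this]
  exact continuous_tangentProj.measurable.comp
    (hX.prodMk (hV.sub ((contDiff_gradient hfbar).continuous.measurable.comp hX)))

lemma Integrable.sq_norm_of_bounded [IsProbabilityMeasure μ] {F : Ω → Amb d r} (hF : Measurable F)
    {C : ℝ} (hC : ∀ ω, ‖F ω‖ ≤ C) : Integrable (fun ω => ‖F ω‖ ^ 2) μ :=
  Integrable.of_bound (hF.norm.pow_const 2).aestronglyMeasurable (C ^ 2)
    (Eventually.of_forall fun ω => by
      rw [norm_pow, norm_norm]
      exact pow_le_pow_left₀ (norm_nonneg _) (hC ω) 2)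

lemma integral_le_of_lintegral_ofReal_le {F H : Ω → ℝ} (hF : Integrable F μ) (hH : Integrable H μ)
    (hF0 : ∀ ω, 0 ≤ F ω) (hH0 : ∀ ω, 0 ≤ H ω)
    (hle : ∫⁻ ω, ENNReal.ofReal (F ω) ∂μ ≤ ∫⁻ ω, ENNReal.ofReal (H ω) ∂μ) :
    ∫ ω, F ω ∂μ ≤ ∫ ω, H ω ∂μ := by
  rw [← ofReal_integral_eq_lintegral_ofReal hF (Eventually.of_forall hF0),
    ← ofReal_integral_eq_lintegral_ofReal hH (Eventually.of_forall hH0)] at hle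
  exact (ENNReal.ofReal_le_ofReal_iff (integral_nonneg hH0)).1 hle

/-- The telescoped descent inequality along one run. -/
lemma sum_step_sq_le (hRetr : IsRetraction Retr) {M₂ : ℝ}
    (hRetr₂ : ∀ X ∈ stiefel d r, ∀ ξ ∈ tangent X, ‖Retr X ξ - (X + ξ)‖ ≤ M₂ * ‖ξ‖ ^ 2)
    {U : Set (Amb d r)} {ρ : ℝ} {Xs : Amb d r} {cE LH LR G Lh Δ : ℝ}
    (hp : ProblemAssumptions Retr f fbar h U ρ Xs cE LH LR G Lh) (hLR : 0 ≤ LR) (hLh : 0 ≤ Lh)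
    (hX₀ : X₀ ∈ stiefel d r) (hΔ : (fbar X₀ + h X₀) - (fbar Xs + h Xs) ≤ Δ)
    (hη0 : 0 < η) (hη1 : η ≤ 1) (hη : η * (LR / 2 + Lh * M₂) ≤ 1 / 2) {S : ℕ → Multiset ι} {T : ℕ}
    (hstay : StaysIn Retr U (spbRun Retr Γ f h η (2 / 5) q X₀ S) T) :
    3 / (8 * η) * ∑ t ∈ Finset.range T, ‖(spbRun Retr Γ f h η (2 / 5) q X₀ S (t + 1)).step‖ ^ 2 ≤
      Δ + 2 * η * ∑ t ∈ Finset.range T,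
        ‖tangentError fbar (spbRun Retr Γ f h η (2 / 5) q X₀ S (t + 1))‖ ^ 2 := by
  set run := spbRun Retr Γ f h η (2 / 5) q X₀ S
  have hmem : ∀ t, (run t).X ∈ stiefel d r :=
    fun t => spbRun_X_mem hRetr hp.h_convex (by norm_num) hX₀ t
  have hstep : ∀ t < T, fbar (run (t + 1)).X + h (run (t + 1)).X
      + 3 / (8 * η) * ‖(run (t + 1)).step‖ ^ 2 ≤ fbar (run t).X + h (run t).X +
        2 * η * ‖tangentError fbar (run (t + 1))‖ ^ 2 := fun t ht =>
    spb_descent hRetr hRetr₂ hp.smooth_mean hLR hLh hp.retr_hessian_upper hp.h_convex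
      hp.h_lipschitz hη0 hη1 hη (hmem t) (run (t + 1)).V (hstay t ht)
  have hsum : ∀ n ≤ T, fbar (run n).X + h (run n).X
      + 3 / (8 * η) * ∑ t ∈ Finset.range n, ‖(run (t + 1)).step‖ ^ 2 ≤ fbar X₀ + h X₀ +
        2 * η * ∑ t ∈ Finset.range n, ‖tangentError fbar (run (t + 1))‖ ^ 2 := by
    intro n
    induction n with
    | zero => intro _; simp [run, spbRun]
    | succ n ih =>
      intro hn
      have h1 := ih (by omega)
      have h2 := hstep n (by omega)
      rw [Finset.sum_range_succ, Finset.sum_range_succ]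
      linarith
  linarith [hsum T le_rfl, hp.optimum _ (hmem T)]

/-- Two coupled bounds, steps by errors (descent) and errors by steps (recursion), decouple under
`16 q κ η² ≤ 1`. Each stationarity measure is at most `M₁ (5/2 ‖ζ_t‖ + ‖e_t‖)` by nonexpansiveness
of the proximal map. -/
lemma sum_integral_gradMap_sq_le [IsProbabilityMeasure μ] (hRetr : IsRetraction Retr)
    (hΓ : IsIsometricTransport Retr Γ) {M₁ M₂ : ℝ} (hM₁ : 0 < M₁)
    (hRetr₁ : ∀ X ∈ stiefel d r, ∀ ξ ∈ tangent X, ‖Retr X ξ - X‖ ≤ M₁ * ‖ξ‖)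
    (hRetr₂ : ∀ X ∈ stiefel d r, ∀ ξ ∈ tangent X, ‖Retr X ξ - (X + ξ)‖ ≤ M₂ * ‖ξ‖ ^ 2)
    {U : Set (Amb d r)} {ρ : ℝ} {Xs : Amb d r} {cE LH LR G Lh Δ : ℝ}
    (hp : ProblemAssumptions Retr f fbar h U ρ Xs cE LH LR G Lh) (hG : 0 ≤ G) (hLR : 0 ≤ LR)
    (hLh : 0 ≤ Lh) (hX₀ : X₀ ∈ stiefel d r) (hΔ0 : 0 ≤ Δ)
    (hΔ : (fbar X₀ + h X₀) - (fbar Xs + h Xs) ≤ Δ)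
    (hη0 : 0 < η) (hη1 : η ≤ 1) (hη : η * (LR / 2 + Lh * M₂) ≤ 1 / 2) (hq : 1 ≤ q)
    {κ v : ℝ} (hκ0 : 0 ≤ κ) (hκ : 16 * (q * κ) * η ^ 2 ≤ 1) (hv : 0 ≤ v)
    (hs : IsBatchSampling Retr Γ f fbar q μ B W m κ v) {T : ℕ}
    (hstay : ∀ᵐ ω ∂μ, StaysIn Retr U
      (spbRun Retr Γ f h η (2 / 5) q X₀ fun t => B t (W t ω)) T) :
    ∑ t ∈ Finset.range T, ∫ ω, ‖gradMap Retr fbar h (2 / 5)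
      (spbRun Retr Γ f h η (2 / 5) q X₀ (fun t => B t (W t ω)) t).X‖ ^ 2 ∂μ ≤
    104 * M₁ ^ 2 * (Δ / η + T * v) := by
  have hγ : (0 : ℝ) < 2 / 5 := by norm_num
  have hc := hp.h_convex
  set run := fun ω => spbRun Retr Γ f h η (2 / 5) q X₀ fun t => B t (W t ω)
  have hmem : ∀ ω t, (run ω t).Xprev ∈ stiefel d r ∧ (run ω t).step ∈ tangent (run ω t).Xprev ∧
      (run ω t).X = Retr (run ω t).Xprev (run ω t).step :=
    fun ω t => spbRun_mem hRetr hc hγ hX₀ t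
  have hXmem : ∀ ω t, (run ω t).X ∈ stiefel d r := fun ω t => spbRun_X_mem hRetr hc hγ hX₀ t
  have hmeas := fun t => measurable_spbRun (η := η) (q := q) hRetr hΓ hc hγ hX₀ hs.mono
    hs.measurable hs.measurable_grad t
  have hVn : ∀ ω t, ‖(run ω t).V‖ ≤ 2 * t * G :=
    fun ω t => norm_spbRun_V_le hRetr hΓ hc hγ hX₀ hG hp.gradient_bound t
  obtain ⟨Gb, hGb⟩ := (isCompact_stiefel (d := d) (r := r)).exists_bound_of_continuousOn
    (contDiff_gradient hp.smooth_mean).continuous.continuousOn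
  obtain ⟨C, hC0, hC⟩ := exists_norm_proxDir_le (d := d) (r := r) hc hγ
  have herr : ∀ t, Integrable (fun ω => ‖tangentError fbar (run ω t)‖ ^ 2) μ := fun t =>
    Integrable.sq_norm_of_bounded ((measurable_tangentError hp.smooth_mean (hmeas t).1
      (hmeas t).2.2.1 fun ω => (hmem ω t).1).mono (hs.le t) le_rfl) (C := 2 * t * G + Gb)
      fun ω => ((Submodule.norm_starProjection_apply_le _ _).trans (norm_sub_le _ _)).trans
        (add_le_add (hVn ω t) (hGb _ (hmem ω t).1))
  have hstp : ∀ t, Integrable (fun ω => ‖(run ω (t + 1)).step‖ ^ 2) μ := fun t =>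
    Integrable.sq_norm_of_bounded ((hmeas (t + 1)).2.1.mono (hs.le _) le_rfl)
      (C := η * (1 + 2 * (2 / 5) * (2 * (t + 1 : ℕ) * G + C))) fun ω => by
        change ‖η • proxDir h (2 / 5) (run ω t).X (run ω (t + 1)).V‖ ≤ _
        rw [norm_smul, Real.norm_of_nonneg hη0.le]
        refine mul_le_mul_of_nonneg_left ((hC _ (hXmem ω t) _).trans ?_) hη0.le
        have := hVn ω (t + 1)
        linarith
  set a : ℕ → ℝ := fun t => ∫ ω, ‖tangentError fbar (run ω (t + 1))‖ ^ 2 ∂μ with ha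
  set z : ℕ → ℝ := fun t => ∫ ω, ‖(run ω (t + 1)).step‖ ^ 2 ∂μ with hz
  have hz0 : ∀ t, 0 ≤ z t := fun t => integral_nonneg fun ω => sq_nonneg _
  have hsum : ∑ t ∈ Finset.range T, a t ≤ T * v + q * κ * ∑ t ∈ Finset.range T, z t := by
    refine sum_le_of_restarted_recursion hq hκ0 hz0 T (fun t _ ht => ?_) fun t _ ht => ?_
    · have h1 := lintegral_error_restart (h := h) (η := η) hRetr hΓ hc hγ hX₀ hp.smooth_mean hs.le
        hs.mono hs.measurable hs.indep hs.measurable_grad ht (hs.restart t ht)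
      have h2 := integral_le_of_lintegral_ofReal_le (herr (t + 1)) (integrable_const v)
        (fun ω => sq_nonneg _) (fun _ => hv) (by simpa using h1)
      simpa using h2
    · have h1 := lintegral_error_recursion (h := h) (η := η) hRetr hΓ hc hγ hX₀ hp.smooth_mean hs.le
        hs.mono hs.measurable hs.indep hs.measurable_grad ht (hs.recursion _ ht)
      have h2 := integral_le_of_lintegral_ofReal_le (herr (t + 1 + 1))
        ((herr (t + 1)).add ((hstp t).const_mul κ)) (fun ω => sq_nonneg _)
        (fun ω => by simp only [Pi.add_apply]; positivity) h1
      simp only [Pi.add_apply] at h2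
      rwa [integral_add (herr (t + 1)) ((hstp t).const_mul κ), integral_const_mul] at h2
  have hdesc : 3 / (8 * η) * ∑ t ∈ Finset.range T, z t ≤
      Δ + 2 * η * ∑ t ∈ Finset.range T, a t := by
    have h1 : ∀ᵐ ω ∂μ, 3 / (8 * η) * ∑ t ∈ Finset.range T, ‖(run ω (t + 1)).step‖ ^ 2 ≤
        Δ + 2 * η * ∑ t ∈ Finset.range T, ‖tangentError fbar (run ω (t + 1))‖ ^ 2 := by
      filter_upwards [hstay] with ω hω
      exact sum_step_sq_le hRetr hRetr₂ hp hLR hLh hX₀ hΔ hη0 hη1 hη hω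
    have hi1 := integrable_finsetSum (Finset.range T) fun t _ => hstp t
    have hi2 := integrable_finsetSum (Finset.range T) fun t _ => herr (t + 1)
    have h2 := integral_mono_ae (hi1.const_mul (3 / (8 * η)))
      ((integrable_const Δ).add (hi2.const_mul (2 * η))) h1
    simp only [Pi.add_apply] at h2
    rw [integral_const_mul, integral_add (integrable_const Δ) (hi2.const_mul (2 * η)),
      integral_const_mul, integral_finsetSum _ fun t _ => hstp t,
      integral_finsetSum _ fun t _ => herr (t + 1)] at h2
    simpa using h2
  set Z := ∑ t ∈ Finset.range T, z t
  set A := ∑ t ∈ Finset.range T, a t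
  have hZ0 : 0 ≤ Z := Finset.sum_nonneg fun t _ => hz0 t
  have hT0 : (0 : ℝ) ≤ T := Nat.cast_nonneg T
  -- Descent reads `3 Z ≤ 8 η Δ + 16 η² A`; inserting `A ≤ T v + q κ Z`, the term `16 q κ η² Z` is
  -- at most `Z` and moves to the left.
  have hZ : Z ≤ 4 * η * (Δ + 2 * η * (T * v)) := by
    have h1 : 3 * Z ≤ 8 * η * (Δ + 2 * η * A) := by
      have := mul_le_mul_of_nonneg_left hdesc (by positivity : 0 ≤ 8 * η)
      have e : 8 * η * (3 / (8 * η) * Z) = 3 * Z := by field_simp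
      linarith
    have h2 := mul_le_mul_of_nonneg_left hsum (by positivity : 0 ≤ 16 * η ^ 2)
    have h3 := mul_le_mul_of_nonneg_right hκ hZ0
    nlinarith
  have hA : η * A ≤ 3 / 2 * η * (T * v) + Δ / 4 := by
    have h3 := mul_le_mul_of_nonneg_right hκ (by positivity : 0 ≤ Δ + 2 * η * (T * v))
    have h4 := mul_le_mul_of_nonneg_left hZ (by positivity : 0 ≤ η * (q * κ))
    have h5 := mul_le_mul_of_nonneg_left hsum hη0.le
    nlinarith
  have hpt : ∀ t, ∫ ω, ‖gradMap Retr fbar h (2 / 5) (run ω t).X‖ ^ 2 ∂μ ≤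
      2 * M₁ ^ 2 * (25 / 4 * (z t / η ^ 2) + a t) := by
    intro t
    have hb : ∀ ω, ‖gradMap Retr fbar h (2 / 5) (run ω t).X‖ ^ 2 ≤
        2 * M₁ ^ 2 * (25 / 4 * (1 / η ^ 2 * ‖(run ω (t + 1)).step‖ ^ 2) +
          ‖tangentError fbar (run ω (t + 1))‖ ^ 2) := by
      intro ω
      have h1 := norm_gradMap_le (fbar := fbar) hM₁ hRetr₁ hc hγ (hXmem ω t) (run ω (t + 1)).V
      have h2 : ‖(run ω (t + 1)).step‖
          = η * ‖proxDir h (2 / 5) (run ω t).X (run ω (t + 1)).V‖ := by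
        change ‖η • proxDir h (2 / 5) (run ω t).X (run ω (t + 1)).V‖ = _
        rw [norm_smul, Real.norm_of_nonneg hη0.le]
      have h3 : tangentError fbar (run ω (t + 1)) = (tangent (run ω t).X).starProjection
          ((run ω (t + 1)).V - gradient fbar (run ω t).X) := rfl
      rw [← h3] at h1
      set p := ‖proxDir h (2 / 5) (run ω t).X (run ω (t + 1)).V‖
      set e := ‖tangentError fbar (run ω (t + 1))‖
      have h4 : 1 / η ^ 2 * ‖(run ω (t + 1)).step‖ ^ 2 = p ^ 2 := by
        rw [h2]; field_simp
      rw [h4]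
      refine (pow_le_pow_left₀ (norm_nonneg _) h1 2).trans ?_
      have e1 : ((2 / 5 : ℝ)⁻¹ * (M₁ * (p + 2 / 5 * e))) ^ 2 = M₁ ^ 2 * (5 / 2 * p + e) ^ 2 := by
        ring
      rw [e1]
      nlinarith [mul_nonneg (sq_nonneg M₁) (sq_nonneg (5 / 2 * p - e))]
    have hi := (((hstp t).const_mul (1 / η ^ 2)).const_mul (25 / 4)).add (herr (t + 1))
    have h1 := integral_mono_of_nonneg (Eventually.of_forall fun ω => sq_nonneg _)
      (hi.const_mul (2 * M₁ ^ 2)) (Eventually.of_forall hb)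
    refine h1.trans (le_of_eq ?_)
    simp only [Pi.add_apply]
    rw [integral_const_mul, integral_add (((hstp t).const_mul (1 / η ^ 2)).const_mul (25 / 4))
      (herr (t + 1)), integral_const_mul, integral_const_mul]
    simp only [hz, ha]
    ring
  refine (Finset.sum_le_sum fun t _ => hpt t).trans ?_
  rw [← Finset.mul_sum, Finset.sum_add_distrib, ← Finset.mul_sum, ← Finset.sum_div]
  have h1 : Z / η ^ 2 ≤ 4 * (Δ / η) + 8 * (T * v) := by
    rw [div_le_iff₀ (by positivity)]
    refine hZ.trans (le_of_eq ?_)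
    field_simp
    ring
  have h2 : A ≤ 3 / 2 * (T * v) + 1 / 4 * (Δ / η) := by
    have h3 : A ≤ (3 / 2 * η * (T * v) + Δ / 4) / η := by
      rw [le_div_iff₀ hη0]; linarith
    refine h3.trans (le_of_eq ?_)
    field_simp
  have h3 : 25 / 4 * (Z / η ^ 2) + A ≤ 52 * (Δ / η + T * v) := by
    have : 0 ≤ Δ / η := by positivity
    have : 0 ≤ T * v := by positivity
    linarith
  have := mul_le_mul_of_nonneg_left h3 (by positivity : 0 ≤ 2 * M₁ ^ 2)
  linarith

/-- The mean of a bounded function of a process at an independent uniform index. -/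
lemma integral_uniformIndex [IsProbabilityMeasure μ] {ν : Ω → ℕ} {T : ℕ}
    (hν : IsUniformIndex μ ν T) {φ : ℕ → Ω → ℝ} {C : ℝ} (hm : ∀ t, m t ≤ mΩ)
    (hφ : ∀ t, Measurable[m t] (φ t)) (hφC : ∀ t ω, ‖φ t ω‖ ≤ C)
    (hind : ∀ t, Indep (MeasurableSpace.comap ν inferInstance) (m t) μ) :
    Integrable (fun ω => φ (ν ω) ω) μ ∧
      ∫ ω, φ (ν ω) ω ∂μ = (T : ℝ)⁻¹ * ∑ k ∈ Finset.Icc 1 T, ∫ ω, φ k ω ∂μ := by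
  obtain ⟨hνm, hνmem, hνk⟩ := hν
  have hi : ∀ k, Integrable (φ k) μ := fun k =>
    Integrable.of_bound ((hφ k).mono (hm k) le_rfl).aestronglyMeasurable C
      (Eventually.of_forall (hφC k))
  have hsplit : (fun ω => φ (ν ω) ω)
      = fun ω => ∑ k ∈ Finset.Icc 1 T, (ν ⁻¹' {k}).indicator (φ k) ω := by
    funext ω
    rw [Finset.sum_eq_single (ν ω)]
    · simp
    · intro k _ hk
      exact indicator_of_notMem (by simpa using hk.symm) _
    · intro hk
      exact absurd (Finset.mem_Icc.2 (hνmem ω)) hk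
  have hset : ∀ k, MeasurableSet (ν ⁻¹' {k}) := fun k => hνm (measurableSet_singleton k)
  have hI : ∀ k, Integrable (fun ω => (ν ⁻¹' {k}).indicator (φ k) ω) μ :=
    fun k => (hi k).indicator (hset k)
  refine ⟨hsplit ▸ integrable_finsetSum _ fun k _ => hI k, ?_⟩
  rw [hsplit, integral_finsetSum _ fun k _ => hI k, Finset.mul_sum]
  refine Finset.sum_congr rfl fun k hk => ?_
  have hprod : (fun ω => (ν ⁻¹' {k}).indicator (φ k) ω)
      = fun ω => ((ν ⁻¹' {k}).indicator (fun _ => (1 : ℝ)) ω) * φ k ω := by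
    funext ω
    by_cases hω : ω ∈ ν ⁻¹' {k}
    · rw [indicator_of_mem hω, indicator_of_mem hω, one_mul]
    · rw [indicator_of_notMem hω, indicator_of_notMem hω, zero_mul]
  have hν1 : Measurable[MeasurableSpace.comap ν inferInstance]
      ((ν ⁻¹' {k}).indicator fun _ => (1 : ℝ)) :=
    measurable_const.indicator ⟨{k}, measurableSet_singleton k, rfl⟩
  have hIF : IndepFun ((ν ⁻¹' {k}).indicator fun _ => (1 : ℝ)) (φ k) μ := by
    rw [IndepFun_iff_Indep]
    exact indep_of_indep_of_le_left (indep_of_indep_of_le_right (hind k) (hφ k).comap_le)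
      hν1.comap_le
  rw [hprod, hIF.integral_fun_mul_eq_mul_integral
    (measurable_const.indicator (hset k)).aestronglyMeasurable (hi k).aestronglyMeasurable,
    integral_indicator_const _ (hset k)]
  simp [measureReal_def, hνk k (Finset.mem_Icc.1 hk)]

lemma measurable_norm_gradMap {m : MeasurableSpace Ω} (hRetr : IsRetraction Retr)
    (hfbar : ContDiff ℝ 2 fbar) (hc : ConvexOn ℝ univ h) (hγ : 0 < γ) {X : Ω → Amb d r}
    (hX : Measurable[m] X) (hmem : ∀ ω, X ω ∈ stiefel d r) :
    Measurable[m] fun ω => ‖gradMap Retr fbar h γ (X ω)‖ :=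
  (measurable_comp_of_continuousOn (g := gradMap Retr fbar h γ)
    (continuousOn_gradMap hRetr hfbar hc hγ) hX hmem).norm

/-- The lower bound on `T` collects `4 * 104 M₁² Δ / η` from the descent sum, `4 * 5√r` for the last
iterate, and `1` to force `T > 0`; the variance condition keeps `104 M₁² v` below `ε² / 4`. -/
lemma isEpsStochStationary_spbRun [IsProbabilityMeasure μ] (hRetr : IsRetraction Retr)
    (hΓ : IsIsometricTransport Retr Γ) {M₁ M₂ : ℝ} (hM₁ : 0 < M₁)
    (hRetr₁ : ∀ X ∈ stiefel d r, ∀ ξ ∈ tangent X, ‖Retr X ξ - X‖ ≤ M₁ * ‖ξ‖)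
    (hRetr₂ : ∀ X ∈ stiefel d r, ∀ ξ ∈ tangent X, ‖Retr X ξ - (X + ξ)‖ ≤ M₂ * ‖ξ‖ ^ 2)
    {U : Set (Amb d r)} {ρ : ℝ} {Xs : Amb d r} {cE LH LR G Lh Δ : ℝ}
    (hp : ProblemAssumptions Retr f fbar h U ρ Xs cE LH LR G Lh) (hG : 0 ≤ G) (hLR : 0 ≤ LR)
    (hLh : 0 ≤ Lh) (hX₀ : X₀ ∈ stiefel d r) (hΔ0 : 0 ≤ Δ)
    (hΔ : (fbar X₀ + h X₀) - (fbar Xs + h Xs) ≤ Δ)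
    (hη0 : 0 < η) (hη1 : η ≤ 1) (hη : η * (LR / 2 + Lh * M₂) ≤ 1 / 2) (hq : 1 ≤ q)
    {κ v : ℝ} (hκ0 : 0 ≤ κ) (hκ : 16 * (q * κ) * η ^ 2 ≤ 1) (hv : 0 ≤ v)
    (hs : IsBatchSampling Retr Γ f fbar q μ B W m κ v) {T : ℕ}
    (hstay : ∀ᵐ ω ∂μ, StaysIn Retr U
      (spbRun Retr Γ f h η (2 / 5) q X₀ fun t => B t (W t ω)) T)
    {ν : Ω → ℕ} (hν : IsUniformIndex μ ν T)
    (hνind : ∀ t, Indep (MeasurableSpace.comap ν inferInstance) (m t) μ)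
    {ε : ℝ} (hε0 : 0 < ε) (hε1 : ε ≤ 1)
    (hT : (1 + 416 * M₁ ^ 2 * (Δ / η) + 20 * √r) / ε ^ 2 ≤ T)
    (hvε : 416 * M₁ ^ 2 * v ≤ ε ^ 2) :
    IsEpsStochStationary μ Retr fbar h (2 / 5) ε
      (fun ω => (spbRun Retr Γ f h η (2 / 5) q X₀ (fun t => B t (W t ω)) (ν ω)).X) := by
  have hγ : (0 : ℝ) < 2 / 5 := by norm_num
  have hc := hp.h_convex
  set run := fun ω => spbRun Retr Γ f h η (2 / 5) q X₀ fun t => B t (W t ω)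
  have hXmem : ∀ ω t, (run ω t).X ∈ stiefel d r := fun ω t => spbRun_X_mem hRetr hc hγ hX₀ t
  have hmeas := fun t => measurable_spbRun (η := η) (q := q) hRetr hΓ hc hγ hX₀ hs.mono
    hs.measurable hs.measurable_grad t
  set φ : ℕ → Ω → ℝ := fun t ω => ‖gradMap Retr fbar h (2 / 5) (run ω t).X‖ with hφdef
  have hφ : ∀ t, Measurable[m t] (φ t) := fun t =>
    measurable_norm_gradMap hRetr hp.smooth_mean hc hγ (hmeas t).2.2.2 fun ω => hXmem ω t
  have hφC : ∀ t ω, ‖φ t ω‖ ≤ 5 * √r := by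
    intro t ω
    rw [norm_norm]
    refine (norm_gradMap_le_sqrt hRetr hc hγ (hXmem ω t)).trans (le_of_eq ?_)
    ring
  obtain ⟨h1, h2⟩ := integral_uniformIndex hν hs.le hφ hφC hνind
  refine ⟨h1, ?_⟩
  change ∫ ω, φ (ν ω) ω ∂μ ≤ ε
  rw [h2]
  have hε2 : 0 < ε ^ 2 := by positivity
  have hDη : 0 ≤ Δ / η := by positivity
  have hsr := Real.sqrt_nonneg (r : ℝ)
  rw [div_le_iff₀ hε2] at hT
  have hTpos : (0 : ℝ) < T := by
    by_contra hcon
    have h3 : (T : ℝ) * ε ^ 2 ≤ 0 := mul_nonpos_of_nonpos_of_nonneg (not_lt.1 hcon) hε2.le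
    nlinarith [mul_nonneg (sq_nonneg M₁) hDη]
  have hT1 : 1 ≤ T := by exact_mod_cast hTpos
  have hφ0 : ∀ t, 0 ≤ ∫ ω, φ t ω ∂μ := fun t => integral_nonneg fun ω => norm_nonneg _
  have hmain := sum_integral_gradMap_sq_le hRetr hΓ hM₁ hRetr₁ hRetr₂ hp hG hLR hLh hX₀ hΔ0 hΔ hη0
    hη1 hη hq hκ0 hκ hv hs hstay
  have hiφ : ∀ t, Integrable (φ t) μ := fun t =>
    Integrable.of_bound ((hφ t).mono (hs.le t) le_rfl).aestronglyMeasurable _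
      (Eventually.of_forall (hφC t))
  have hiφ2 : ∀ t, Integrable (fun ω => φ t ω ^ 2) μ := fun t =>
    Integrable.of_bound (((hφ t).mono (hs.le t) le_rfl).pow_const 2).aestronglyMeasurable
      ((5 * √r) ^ 2) (Eventually.of_forall fun ω => by
        rw [norm_pow]; exact pow_le_pow_left₀ (norm_nonneg _) (hφC t ω) 2)
  -- Young's inequality in place of Jensen's: it is linear in the second moments, so it can be
  -- summed directly.
  have hpt : ∀ t, ∫ ω, φ t ω ∂μ ≤ ε / 4 + ε⁻¹ * ∫ ω, φ t ω ^ 2 ∂μ := by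
    intro t
    have h3 := integral_mono (hiφ t) ((integrable_const (ε / 4)).add ((hiφ2 t).const_mul ε⁻¹))
      (fun ω => by
        simp only [Pi.add_apply]
        rw [← div_eq_inv_mul, ← sub_nonneg]
        have : ε / 4 + φ t ω ^ 2 / ε - φ t ω = (ε / 2 - φ t ω) ^ 2 / ε := by
          field_simp; ring
        rw [this]; positivity)
    simp only [Pi.add_apply] at h3
    rw [integral_add (integrable_const _) ((hiφ2 t).const_mul ε⁻¹), integral_const_mul] at h3
    simpa using h3
  -- The output index runs over `1, …, T` but the sum of squares over `0, …, T - 1`, so the iterate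
  -- `X_T` is bounded separately.
  have hlast : ∫ ω, φ T ω ∂μ ≤ 5 * √r := by
    have h3 := integral_mono (hiφ T) (integrable_const (5 * √r))
      fun ω => (le_abs_self _).trans (hφC T ω)
    simpa using h3
  have hsum : ∑ k ∈ Finset.Icc 1 T, ∫ ω, φ k ω ∂μ ≤
      T * (ε / 4) + ε⁻¹ * (104 * M₁ ^ 2 * (Δ / η + T * v)) + 5 * √r := by
    have h3 : Finset.Icc 1 T = Finset.Ico 1 (T + 1) := by ext k; simp
    rw [h3, Finset.sum_Ico_succ_top hT1]
    refine add_le_add ?_ hlast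
    calc ∑ k ∈ Finset.Ico 1 T, ∫ ω, φ k ω ∂μ
        ≤ ∑ k ∈ Finset.range T, ∫ ω, φ k ω ∂μ :=
          Finset.sum_le_sum_of_subset_of_nonneg
            (fun k hk => Finset.mem_range.2 (Finset.mem_Ico.1 hk).2) fun k _ _ => hφ0 k
      _ ≤ ∑ k ∈ Finset.range T, (ε / 4 + ε⁻¹ * ∫ ω, φ k ω ^ 2 ∂μ) :=
          Finset.sum_le_sum fun k _ => hpt k
      _ ≤ _ := by
          rw [Finset.sum_add_distrib, Finset.sum_const, Finset.card_range, nsmul_eq_mul,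
            ← Finset.mul_sum]
          gcongr
  rw [inv_mul_le_iff₀ hTpos]
  refine hsum.trans ?_
  have h4 : ε⁻¹ * (104 * M₁ ^ 2 * (Δ / η + T * v)) ≤ ε⁻¹ * (T * ε ^ 2 / 2 - 5 * √r - 1 / 4) := by
    refine mul_le_mul_of_nonneg_left ?_ (by positivity)
    have := mul_le_mul_of_nonneg_left hvε hTpos.le
    nlinarith
  have h5 : ε⁻¹ * (T * ε ^ 2 / 2 - 5 * √r - 1 / 4) = T * ε / 2 - ε⁻¹ * (5 * √r + 1 / 4) := by
    field_simp
    ring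
  have h6 : 1 ≤ ε⁻¹ := (one_le_inv₀ hε0).2 hε1
  have h7 := mul_le_mul_of_nonneg_right h6 (by positivity : 0 ≤ 5 * √r + 1 / 4)
  nlinarith [mul_pos hTpos hε0]

end Convergence

/-! ### Variance of mini-batch means, without and with replacement. -/

section Sampling

/-- The mean of `φ` over a mini-batch. -/
noncomputable def batchMean {ι H : Type*} [AddCommGroup H] [Module ℝ H] (φ : ι → H)
    (S : Multiset ι) : H :=
  (S.card : ℝ)⁻¹ • (S.map φ).sum

lemma map_batchMean {ι H H' : Type*} [NormedAddCommGroup H] [NormedSpace ℝ H]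
    [NormedAddCommGroup H'] [NormedSpace ℝ H'] (L : H →L[ℝ] H') (φ : ι → H) (S : Multiset ι) :
    L (batchMean φ S) = batchMean (fun i => L (φ i)) S := by
  rw [batchMean, batchMean, map_smul, map_multiset_sum, Multiset.map_map]
  rfl

lemma batchMean_sub {ι H : Type*} [AddCommGroup H] [Module ℝ H] (φ ψ : ι → H)
    (S : Multiset ι) : batchMean φ S - batchMean ψ S = batchMean (fun i => φ i - ψ i) S := by
  rw [batchMean, batchMean, batchMean, ← smul_sub, Multiset.sum_map_sub]

lemma batchMean_onlineBatch {D H : Type*} [AddCommGroup H] [Module ℝ H] (φ : D → H) (k : ℕ)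
    (x : ℕ → D) : batchMean φ (onlineBatch k x) = (k : ℝ)⁻¹ • ∑ j ∈ Finset.range k, φ (x j) := by
  rw [batchMean, onlineBatch, Multiset.card_map, Multiset.card_range, Multiset.map_map]
  rfl

section WithoutReplacement

variable {H : Type*} [NormedAddCommGroup H] [InnerProductSpace ℝ H]

/-- The variance of the mean of a random `k`-element subset of a centred family is at most that of
`k` independent draws. -/
lemma sum_powersetCard_norm_sq_le {n k : ℕ} (hk : 1 ≤ k) (hkn : k ≤ n) (c : Fin n → H)
    (hc : ∑ i, c i = 0) (a : H) :
    ∑ A ∈ Finset.powersetCard k (Finset.univ : Finset (Fin n)),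
      ‖a + (k : ℝ)⁻¹ • ∑ i ∈ A, c i‖ ^ 2 ≤
    (n.choose k : ℝ) * (‖a‖ ^ 2 + (k : ℝ)⁻¹ * ((n : ℝ)⁻¹ * ∑ i, ‖c i‖ ^ 2)) := by
  set 𝒜 := Finset.powersetCard k (Finset.univ : Finset (Fin n)) with h𝒜
  set p : ℝ := (((n - 1).choose (k - 1) : ℕ) : ℝ) with hp
  -- `p` and `p₂` count the `k`-subsets containing a given element and a given pair. For `k = 1`
  -- truncated subtraction would give `1` for `p₂`, hence the case split.
  set p₂ : ℝ := if 2 ≤ k then (((n - 2).choose (k - 2) : ℕ) : ℝ) else 0 with hp₂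
  have hp₂0 : 0 ≤ p₂ := by rw [hp₂]; split_ifs <;> positivity
  have hk0 : (0 : ℝ) < k := by exact_mod_cast hk
  have hn0 : (0 : ℝ) < n := by exact_mod_cast hk.trans hkn
  have hnp : (n : ℝ) * p = n.choose k * k := by
    have := Nat.add_one_mul_choose_eq (n - 1) (k - 1)
    rw [Nat.sub_add_cancel (hk.trans hkn), Nat.sub_add_cancel hk] at this
    rw [hp]
    exact_mod_cast this
  have hcount : ∀ i j : Fin n, ∑ A ∈ 𝒜, (if i ∈ A ∧ j ∈ A then (1 : ℝ) else 0)
      = p₂ + if i = j then p - p₂ else 0 := by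
    intro i j
    have hset : ({A ∈ 𝒜 | i ∈ A ∧ j ∈ A} : Finset (Finset (Fin n)))
        = {A ∈ 𝒜 | ({i, j} : Finset (Fin n)) ⊆ A} := by
      ext A; simp [Finset.insert_subset_iff]
    rw [Finset.sum_boole, hset]
    by_cases hij : i = j
    · subst hij
      rw [if_pos rfl, Finset.pair_eq_singleton, h𝒜, Finset.card_filter_powersetCard_subset _ _ _
        (Finset.subset_univ _) (by simpa using hk)]
      simp [hp]
    · rw [if_neg hij, add_zero]
      by_cases hk2 : 2 ≤ k
      · rw [h𝒜, Finset.card_filter_powersetCard_subset _ _ _ (Finset.subset_univ _)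
          (by rw [Finset.card_pair hij]; exact hk2), Finset.card_pair hij]
        simp [hp₂, hk2]
      · rw [hp₂, if_neg hk2, Finset.filter_false_of_mem]
        · simp
        · intro A hA hsub
          have h1 := Finset.card_le_card hsub
          rw [Finset.card_pair hij, (Finset.mem_powersetCard.1 hA).2] at h1
          exact hk2 h1
  have hsumA : ∀ A : Finset (Fin n), ∑ i ∈ A, c i = ∑ i, (if i ∈ A then (1 : ℝ) else 0) • c i := by
    intro A
    simp [ite_smul]
  have hlin : ∑ A ∈ 𝒜, ∑ i ∈ A, c i = 0 := by
    simp_rw [hsumA]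
    rw [Finset.sum_comm]
    simp_rw [← Finset.sum_smul]
    have : ∀ i, ∑ A ∈ 𝒜, (if i ∈ A then (1 : ℝ) else 0) = p := by
      intro i
      have := hcount i i
      simpa using this
    simp_rw [this]
    rw [← Finset.smul_sum, hc, smul_zero]
  have hquad : ∑ A ∈ 𝒜, ‖∑ i ∈ A, c i‖ ^ 2 ≤ p * ∑ i, ‖c i‖ ^ 2 := by
    have h1 : ∀ A : Finset (Fin n), ‖∑ i ∈ A, c i‖ ^ 2
        = ∑ i, ∑ j, (if i ∈ A ∧ j ∈ A then (1 : ℝ) else 0) * inner ℝ (c i) (c j) := by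
      intro A
      rw [← real_inner_self_eq_norm_sq, hsumA, sum_inner]
      refine Finset.sum_congr rfl fun i _ => ?_
      rw [inner_sum]
      refine Finset.sum_congr rfl fun j _ => ?_
      rw [inner_smul_left, inner_smul_right]
      by_cases hi : i ∈ A <;> by_cases hj : j ∈ A <;> simp [hi, hj]
    -- Since the family is centred, the part of the double sum with constant weight `p₂` vanishes
    -- and only the diagonal is left. Dropping `-p₂` then gives the bound for independent draws.
    have h2 : ∑ A ∈ 𝒜, ‖∑ i ∈ A, c i‖ ^ 2 = (p - p₂) * ∑ i, ‖c i‖ ^ 2 := by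
      simp_rw [h1]
      rw [Finset.sum_comm]
      simp_rw [Finset.sum_comm (s := 𝒜), ← Finset.sum_mul, hcount, add_mul, Finset.sum_add_distrib]
      simp_rw [← Finset.mul_sum, ← inner_sum, hc, inner_zero_right]
      simp [Finset.mul_sum]
    rw [h2]
    have := Finset.sum_nonneg fun i (_ : i ∈ Finset.univ) => sq_nonneg ‖c i‖
    nlinarith
  have hexp : ∀ A : Finset (Fin n), ‖a + (k : ℝ)⁻¹ • ∑ i ∈ A, c i‖ ^ 2
      = ‖a‖ ^ 2 + 2 * (k : ℝ)⁻¹ * inner ℝ a (∑ i ∈ A, c i)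
        + (k : ℝ)⁻¹ ^ 2 * ‖∑ i ∈ A, c i‖ ^ 2 := by
    intro A
    rw [norm_add_sq_real, inner_smul_right, norm_smul, mul_pow, Real.norm_eq_abs, sq_abs]
    ring
  simp_rw [hexp]
  rw [Finset.sum_add_distrib, Finset.sum_add_distrib, ← Finset.mul_sum, ← Finset.mul_sum,
    ← inner_sum, hlin, inner_zero_right, mul_zero, add_zero, Finset.sum_const, h𝒜,
    Finset.card_powersetCard, Finset.card_univ, Fintype.card_fin, nsmul_eq_mul, mul_add]
  refine add_le_add le_rfl ?_
  calc (k : ℝ)⁻¹ ^ 2 * ∑ A ∈ 𝒜, ‖∑ i ∈ A, c i‖ ^ 2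
      ≤ (k : ℝ)⁻¹ ^ 2 * (p * ∑ i, ‖c i‖ ^ 2) := by gcongr
    _ = (k : ℝ)⁻¹ ^ 2 * (n : ℝ)⁻¹ * (n * p) * ∑ i, ‖c i‖ ^ 2 := by field_simp
    _ = _ := by rw [hnp]; field_simp

end WithoutReplacement

variable {d r : ℕ} {Ω : Type*} {mΩ : MeasurableSpace Ω} {μ : Measure Ω}

lemma lintegral_uniformSubset {n k : ℕ} {S : Ω → Finset (Fin n)} (hS : IsUniformSubset μ S k)
    (F : Finset (Fin n) → ENNReal) :
    ∫⁻ A, F A ∂(μ.map S) = ∑ A ∈ Finset.powersetCard k (Finset.univ : Finset (Fin n)),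
      F A * ((n.choose k : ℕ) : ENNReal)⁻¹ := by
  have : MeasurableSingletonClass (Finset (Fin n)) := ⟨fun _ => trivial⟩
  rw [lintegral_fintype]
  symm
  rw [← Finset.sum_subset (Finset.subset_univ (Finset.powersetCard k Finset.univ))]
  · refine Finset.sum_congr rfl fun A hA => ?_
    rw [Measure.map_apply hS.1 (measurableSet_singleton A),
      hS.2.2 A (Finset.mem_powersetCard.1 hA).2]
  · intro A _ hA
    rw [Measure.map_apply hS.1 (measurableSet_singleton A)]
    have : S ⁻¹' {A} = ∅ := by
      ext ω
      simp only [mem_preimage, mem_singleton_iff, mem_empty_iff_false, iff_false]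
      intro h
      exact hA (Finset.mem_powersetCard.2 ⟨Finset.subset_univ _, h ▸ hS.2.1 ω⟩)
    rw [this, measure_empty, mul_zero]

/-- The second moment of a mini-batch mean drawn without replacement. -/
lemma lintegral_uniformSubset_mean_le {n k : ℕ} (hk : 1 ≤ k) (hkn : k ≤ n)
    {S : Ω → Finset (Fin n)} (hS : IsUniformSubset μ S k) (φ : Fin n → Amb d r) (a : Amb d r) :
    ∫⁻ A, ENNReal.ofReal (‖a + (batchMean φ A.val - (n : ℝ)⁻¹ • ∑ i, φ i)‖ ^ 2) ∂(μ.map S) ≤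
      ENNReal.ofReal (‖a‖ ^ 2 +
        (k : ℝ)⁻¹ * ((n : ℝ)⁻¹ * ∑ j, ‖φ j - (n : ℝ)⁻¹ • ∑ i, φ i‖ ^ 2)) := by
  rw [lintegral_uniformSubset hS, ← Finset.sum_mul]
  set φb := (n : ℝ)⁻¹ • ∑ i, φ i with hφb
  have hk0 : (0 : ℝ) < k := by exact_mod_cast hk
  have hn0 : (0 : ℝ) < n := by exact_mod_cast hk.trans hkn
  have hcen : ∑ i, (φ i - φb) = 0 := by
    rw [Finset.sum_sub_distrib, Finset.sum_const, Finset.card_univ, Fintype.card_fin,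
      ← Nat.cast_smul_eq_nsmul ℝ, hφb, smul_smul, mul_inv_cancel₀ hn0.ne', one_smul, sub_self]
  have hmean : ∀ A ∈ Finset.powersetCard k (Finset.univ : Finset (Fin n)),
      batchMean φ A.val - φb = (k : ℝ)⁻¹ • ∑ i ∈ A, (φ i - φb) := by
    intro A hA
    have hcard := (Finset.mem_powersetCard.1 hA).2
    rw [batchMean, Finset.card_val, hcard, Finset.sum_sub_distrib, Finset.sum_const, hcard,
      smul_sub, ← Nat.cast_smul_eq_nsmul ℝ, smul_smul, inv_mul_cancel₀ hk0.ne', one_smul]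
    rfl
  have hN : (0 : ℝ) < n.choose k := by exact_mod_cast Nat.choose_pos hkn
  have key := sum_powersetCard_norm_sq_le hk hkn (fun i => φ i - φb) hcen a
  rw [← ENNReal.ofReal_sum_of_nonneg fun A _ => sq_nonneg _,
    ← ENNReal.ofReal_natCast (n.choose k), ← ENNReal.ofReal_inv_of_pos hN,
    ← ENNReal.ofReal_mul (Finset.sum_nonneg fun A _ => sq_nonneg _)]
  refine ENNReal.ofReal_le_ofReal ?_
  rw [Finset.sum_congr rfl fun A hA => by rw [hmean A hA], ← div_eq_mul_inv, div_le_iff₀ hN]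
  linarith

section WithReplacement

variable [IsProbabilityMeasure μ] {D : Type*} [MeasurableSpace D] {P : Measure D}

/-- The second moment of a mini-batch mean of independent samples. -/
lemma lintegral_onlineBatch_mean_le {k : ℕ} (hk : 1 ≤ k) {Z : ℕ → Ω → D}
    (hZ : ∀ j, Measurable (Z j)) (hlaw : ∀ j, μ.map (Z j) = P)
    (hind : ∀ i j, i ≠ j → IndepFun (Z i) (Z j) μ) {φ : D → Amb d r} (hφ : Measurable φ) {C : ℝ}
    (hC : ∀ z, ‖φ z‖ ≤ C) (a : Amb d r) :
    ∫⁻ x, ENNReal.ofReal (‖a + (batchMean φ (onlineBatch k x) - ∫ z, φ z ∂P)‖ ^ 2)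
      ∂(μ.map fun ω j => Z j ω) ≤
      ENNReal.ofReal (‖a‖ ^ 2 + (k : ℝ)⁻¹ * ∫ z, ‖φ z - ∫ z, φ z ∂P‖ ^ 2 ∂P) := by
  have hP : IsProbabilityMeasure P := by
    rw [← hlaw 0]; exact Measure.isProbabilityMeasure_map (hZ 0).aemeasurable
  set φb := ∫ z, φ z ∂P with hφb
  have hk0 : (0 : ℝ) < k := by exact_mod_cast hk
  have hZm : Measurable fun ω j => Z j ω := measurable_pi_lambda _ hZ
  have hmean : ∀ x : ℕ → D, a + (batchMean φ (onlineBatch k x) - φb)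
      = a + (k : ℝ)⁻¹ • ∑ j ∈ Finset.range k, (φ (x j) - φb) := by
    intro x
    rw [batchMean_onlineBatch, Finset.sum_sub_distrib, Finset.sum_const, Finset.card_range,
      smul_sub, ← Nat.cast_smul_eq_nsmul ℝ, smul_smul, inv_mul_cancel₀ hk0.ne', one_smul]
  simp_rw [hmean]
  have hcm : Measurable fun z => φ z - φb := hφ.sub measurable_const
  rw [lintegral_map (by fun_prop) hZm]
  set c : ℕ → Ω → Amb d r := fun j ω => φ (Z j ω) - φb with hc
  have hcmeas : ∀ j, Measurable (c j) := fun j => hcm.comp (hZ j)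
  have hcb : ∀ j ω, ‖c j ω‖ ≤ C + ‖φb‖ := fun j ω =>
    (norm_sub_le _ _).trans (add_le_add (hC _) le_rfl)
  have hci : ∀ j, Integrable (c j) μ := fun j =>
    Integrable.of_bound (hcmeas j).aestronglyMeasurable _ (Eventually.of_forall (hcb j))
  have hφi : Integrable φ P :=
    Integrable.of_bound hφ.aestronglyMeasurable _ (Eventually.of_forall hC)
  have hc0 : ∀ j, ∫ ω, c j ω ∂μ = 0 := by
    intro j
    have h1 : ∫ ω, c j ω ∂μ = ∫ z, (φ z - φb) ∂P := by
      rw [← hlaw j, integral_map (hZ j).aemeasurable hcm.aestronglyMeasurable]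
    rw [h1, integral_sub hφi (integrable_const _)]
    simp [hφb]
  have hcv : ∀ j, ∫ ω, inner ℝ (c j ω) (c j ω) ∂μ = ∫ z, ‖φ z - φb‖ ^ 2 ∂P := by
    intro j
    simp_rw [real_inner_self_eq_norm_sq]
    rw [← hlaw j, integral_map (hZ j).aemeasurable
      (hcm.norm.pow_const 2).aestronglyMeasurable]
  -- Cross terms vanish because the samples are pairwise independent and centred.
  have hcij : ∀ i j, i ≠ j → ∫ ω, inner ℝ (c i ω) (c j ω) ∂μ = 0 := by
    intro i j hij
    have h1 : IndepFun (c i) (c j) μ := (hind i j hij).comp hcm hcm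
    have h2 := h1.integral_bilin (hci i) (hci j) (innerSL ℝ)
    rw [hc0 i] at h2
    exact h2.trans (by simp)
  have hiij : ∀ i j, Integrable (fun ω => inner ℝ (c i ω) (c j ω)) μ := fun i j =>
    Integrable.of_bound ((hcmeas i).inner (hcmeas j)).aestronglyMeasurable
      ((C + ‖φb‖) * (C + ‖φb‖)) (Eventually.of_forall fun ω => by
        rw [Real.norm_eq_abs]
        exact (abs_real_inner_le_norm _ _).trans (mul_le_mul (hcb i ω) (hcb j ω) (norm_nonneg _)
          ((norm_nonneg _).trans (hcb i ω))))
  have hexp : ∀ ω, ‖a + (k : ℝ)⁻¹ • ∑ j ∈ Finset.range k, c j ω‖ ^ 2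
      = ‖a‖ ^ 2 + 2 * (k : ℝ)⁻¹ * inner ℝ a (∑ j ∈ Finset.range k, c j ω)
        + (k : ℝ)⁻¹ ^ 2 * ∑ i ∈ Finset.range k, ∑ j ∈ Finset.range k,
          inner ℝ (c i ω) (c j ω) := by
    intro ω
    rw [norm_add_sq_real, inner_smul_right, norm_smul, mul_pow, Real.norm_eq_abs, sq_abs,
      ← real_inner_self_eq_norm_sq (∑ j ∈ Finset.range k, c j ω), sum_inner]
    simp_rw [inner_sum]
    ring
  have hsi : Integrable (fun ω => ∑ j ∈ Finset.range k, c j ω) μ :=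
    integrable_finsetSum _ fun j _ => hci j
  have hqi : Integrable (fun ω => ∑ i ∈ Finset.range k, ∑ j ∈ Finset.range k,
      inner ℝ (c i ω) (c j ω)) μ :=
    integrable_finsetSum _ fun i _ => integrable_finsetSum _ fun j _ => hiij i j
  have hai := hsi.const_inner (𝕜 := ℝ) a
  have hlini : Integrable (fun ω => ‖a‖ ^ 2 +
      2 * (k : ℝ)⁻¹ * inner ℝ a (∑ j ∈ Finset.range k, c j ω)) μ :=
    (integrable_const _).add (hai.const_mul _)
  have hint : Integrable (fun ω => ‖a + (k : ℝ)⁻¹ • ∑ j ∈ Finset.range k, c j ω‖ ^ 2) μ := by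
    simp_rw [hexp]
    exact hlini.add (hqi.const_mul _)
  rw [← ofReal_integral_eq_lintegral_ofReal hint (Eventually.of_forall fun ω => sq_nonneg _)]
  refine ENNReal.ofReal_le_ofReal (le_of_eq ?_)
  simp_rw [hexp]
  rw [integral_add hlini (hqi.const_mul _),
    integral_add (integrable_const _) (hai.const_mul _), integral_const_mul, integral_const_mul,
    integral_inner hsi, integral_finsetSum _ fun j _ => hci j,
    integral_finsetSum _ fun i _ => integrable_finsetSum _ fun j _ => hiij i j]
  simp_rw [hc0]
  have hrow : ∀ i ∈ Finset.range k, ∫ ω, ∑ j ∈ Finset.range k, inner ℝ (c i ω) (c j ω) ∂μ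
      = ∫ z, ‖φ z - φb‖ ^ 2 ∂P := by
    intro i hi
    rw [integral_finsetSum _ fun j _ => hiij i j, Finset.sum_eq_single i]
    · exact hcv i
    · intro j _ hj; exact hcij i j hj.symm
    · intro h; exact absurd hi h
  rw [Finset.sum_congr rfl hrow]
  simp only [Finset.sum_const_zero, inner_zero_right, mul_zero, add_zero, integral_const,
    probReal_univ, smul_eq_mul, one_mul, Finset.sum_const, Finset.card_range, nsmul_eq_mul]
  field_simp

end WithReplacement

end Sampling

/-! ### The two sampling schemes satisfy the moment bounds. -/

section Samplers

variable {d r : ℕ} {Retr : Amb d r → Amb d r → Amb d r}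
  {Γ : Amb d r → Amb d r → Amb d r → Amb d r} {ι : Type*} {f : ι → Amb d r → ℝ}
  {fbar h : Amb d r → ℝ} {E Ω : Type*} [MeasurableSpace E] {mΩ : MeasurableSpace Ω} {μ : Measure Ω}

lemma integral_norm_sub_integral_sq_le {ι : Type*} [MeasurableSpace ι] {P : Measure ι}
    [IsProbabilityMeasure P] {φ : ι → Amb d r} (hφ : Measurable φ) {C : ℝ}
    (hC : ∀ z, ‖φ z‖ ≤ C) : ∫ z, ‖φ z - ∫ z, φ z ∂P‖ ^ 2 ∂P ≤ C ^ 2 := by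
  set φb := ∫ z, φ z ∂P
  have hi : Integrable φ P :=
    Integrable.of_bound hφ.aestronglyMeasurable C (Eventually.of_forall hC)
  have hi2 := Integrable.sq_norm_of_bounded (μ := P) hφ hC
  have hi3 := (hi.const_inner (𝕜 := ℝ) φb).const_mul 2
  have hb : ∫ z, inner ℝ φb (φ z) ∂P = ‖φb‖ ^ 2 := by
    rw [integral_inner hi, real_inner_self_eq_norm_sq]
  have hexp : ∀ z, ‖φ z - φb‖ ^ 2 = ‖φ z‖ ^ 2 - 2 * inner ℝ φb (φ z) + ‖φb‖ ^ 2 := fun z => by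
    rw [norm_sub_sq_real, real_inner_comm]
  have hle : ∫ z, ‖φ z‖ ^ 2 ∂P ≤ C ^ 2 := by
    have := integral_mono hi2 (integrable_const (C ^ 2))
      fun z => pow_le_pow_left₀ (norm_nonneg _) (hC z) 2
    simpa using this
  simp_rw [hexp]
  have hsub : Integrable (fun z => ‖φ z‖ ^ 2 - 2 * inner ℝ φb (φ z)) P := hi2.sub hi3
  rw [integral_add hsub (integrable_const _), integral_sub hi2 hi3, integral_const_mul, hb]
  simp only [integral_const, probReal_univ, smul_eq_mul, one_mul]
  nlinarith [sq_nonneg ‖φb‖]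

/-- The transport of the tangential component, as a linear map on the ambient space. -/
lemma IsIsometricTransport.exists_clm (hΓ : IsIsometricTransport Retr Γ) {X ξ : Amb d r}
    (hX : X ∈ stiefel d r) (hξ : ξ ∈ tangent X) :
    ∃ A : Amb d r →L[ℝ] Amb d r, ∀ g, A g = Γ X ξ ((tangent X).starProjection g) := by
  let A : Amb d r →ₗ[ℝ] Amb d r :=
    { toFun := fun g => Γ X ξ ((tangent X).starProjection g)
      map_add' := fun g g' => by
        rw [map_add, hΓ.add X hX ξ hξ _ (Submodule.starProjection_apply_mem _ _) _
          (Submodule.starProjection_apply_mem _ _)]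
      map_smul' := fun c g => by
        rw [map_smul, hΓ.smul X hX ξ hξ _ _ (Submodule.starProjection_apply_mem _ _)]
        rfl }
  exact ⟨A.toContinuousLinearMap, fun g => rfl⟩

/-- The mini-batches `B` have the second moments of `k` independent draws from `P`. -/
def HasSampleVariance [MeasurableSpace ι] (P : Measure ι) (lam : Measure E) (B : E → Multiset ι)
    (k : ℕ) (d r : ℕ) : Prop :=
  ∀ (φ : ι → Amb d r) (C : ℝ) (a : Amb d r), Measurable φ → (∀ z, ‖φ z‖ ≤ C) →
    ∫⁻ e, ENNReal.ofReal (‖a + (batchMean φ (B e) - ∫ z, φ z ∂P)‖ ^ 2) ∂lam ≤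
      ENNReal.ofReal (‖a‖ ^ 2 + (k : ℝ)⁻¹ * ∫ z, ‖φ z - ∫ z, φ z ∂P‖ ^ 2 ∂P)

variable [MeasurableSpace ι] {P : Measure ι} [IsProbabilityMeasure P] {lam : Measure E}
  {B : E → Multiset ι} {k : ℕ}

/-- The variance of a recursive step. -/
lemma HasSampleVariance.recursion (hB : HasSampleVariance P lam B k d r) (hRetr : IsRetraction Retr)
    (hΓ : IsIsometricTransport Retr Γ) {M₂ : ℝ}
    (hRetr₂ : ∀ X ∈ stiefel d r, ∀ ξ ∈ tangent X, ‖Retr X ξ - (X + ξ)‖ ≤ M₂ * ‖ξ‖ ^ 2)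
    (hf : ∀ i, ContDiff ℝ 2 (f i)) (hfbar : ContDiff ℝ 2 fbar)
    (hm : ∀ X, Measurable fun z => f z X) (hi : ∀ X, Integrable (fun z => f z X) P)
    (hmean : ∀ X, fbar X = ∫ z, f z X ∂P) {G K : ℝ}
    (hG : ∀ i, ∀ X ∈ stiefel d r, ‖gradient (f i) X‖ ≤ G)
    (hK : ∀ i, ∀ X ∈ stiefel d r, ∀ ξ ∈ tangent X,
      ‖(tangent (Retr X ξ)).starProjection (gradient (f i) (Retr X ξ)) -
        Γ X ξ ((tangent X).starProjection (gradient (f i) X))‖ ≤ K * ‖ξ‖)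
    {X ξ : Amb d r} (hX : X ∈ stiefel d r) (hξ : ξ ∈ tangent X) (a : Amb d r) :
    ∫⁻ e, ENNReal.ofReal (‖a +
      (((tangent (Retr X ξ)).starProjection (batchGrad f (B e) (Retr X ξ)) -
          Γ X ξ ((tangent X).starProjection (batchGrad f (B e) X))) -
        ((tangent (Retr X ξ)).starProjection (gradient fbar (Retr X ξ)) -
          Γ X ξ ((tangent X).starProjection (gradient fbar X))))‖ ^ 2) ∂lam ≤
      ENNReal.ofReal (‖a‖ ^ 2 + K ^ 2 / k * ‖ξ‖ ^ 2) := by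
  obtain ⟨A, hA⟩ := hΓ.exists_clm hX hξ
  set Y := Retr X ξ with hY
  have hYm : Y ∈ stiefel d r := hRetr.mapsTo X hX ξ hξ
  set φ : ι → Amb d r := fun z => (tangent Y).starProjection (gradient (f z) Y) -
    A (gradient (f z) X) with hφ
  have hφm : Measurable φ :=
    ((tangent Y).starProjection.continuous.measurable.comp (measurable_gradient_apply hf hm Y)).sub
      (A.continuous.measurable.comp (measurable_gradient_apply hf hm X))
  have hφK : ∀ z, ‖φ z‖ ≤ K * ‖ξ‖ := fun z => by
    have := hK z X hX ξ hξ
    rwa [← hA] at this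
  have hbatch : ∀ e, (tangent Y).starProjection (batchGrad f (B e) Y) -
      Γ X ξ ((tangent X).starProjection (batchGrad f (B e) X)) = batchMean φ (B e) := by
    intro e
    rw [← hA]
    change (tangent Y).starProjection (batchMean (fun i => gradient (f i) Y) (B e)) -
      A (batchMean (fun i => gradient (f i) X) (B e)) = _
    rw [map_batchMean, map_batchMean, batchMean_sub]
  have hint : ∀ {Z : Amb d r}, Z ∈ stiefel d r → Integrable (fun z => gradient (f z) Z) P :=
    fun hZ => integrable_gradient hf hm hG hZ
  have hAP : ∀ g, A ((tangent X).starProjection g) = A g := fun g => by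
    rw [hA, hA, Submodule.starProjection_eq_self_iff.2 (Submodule.starProjection_apply_mem _ _)]
  have hfull : (tangent Y).starProjection (gradient fbar Y) -
      Γ X ξ ((tangent X).starProjection (gradient fbar X)) = ∫ z, φ z ∂P := by
    rw [← hA, ← hAP, starProjection_gradient_mean hRetr hRetr₂ hf hfbar hm hi hmean hG hYm,
      starProjection_gradient_mean hRetr hRetr₂ hf hfbar hm hi hmean hG hX,
      ← A.integral_comp_comm ((tangent X).starProjection.integrable_comp (hint hX)),
      ← integral_sub ((tangent Y).starProjection.integrable_comp (hint hYm))
        (A.integrable_comp ((tangent X).starProjection.integrable_comp (hint hX)))]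
    simp_rw [hAP]
    rfl
  simp_rw [hbatch, hfull]
  refine (hB φ _ a hφm hφK).trans (ENNReal.ofReal_le_ofReal ?_)
  have h1 := integral_norm_sub_integral_sq_le (P := P) hφm hφK
  have h2 : (k : ℝ)⁻¹ * ∫ z, ‖φ z - ∫ z, φ z ∂P‖ ^ 2 ∂P ≤ (k : ℝ)⁻¹ * (K * ‖ξ‖) ^ 2 := by gcongr
  calc _ ≤ ‖a‖ ^ 2 + (k : ℝ)⁻¹ * (K * ‖ξ‖) ^ 2 := by gcongr
    _ = _ := by ring

/-- The variance of a restart. -/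
lemma HasSampleVariance.restart (hB : HasSampleVariance P lam B k d r) (hRetr : IsRetraction Retr)
    {M₂ : ℝ} (hRetr₂ : ∀ X ∈ stiefel d r, ∀ ξ ∈ tangent X, ‖Retr X ξ - (X + ξ)‖ ≤ M₂ * ‖ξ‖ ^ 2)
    (hf : ∀ i, ContDiff ℝ 2 (f i)) (hfbar : ContDiff ℝ 2 fbar)
    (hm : ∀ X, Measurable fun z => f z X) (hi : ∀ X, Integrable (fun z => f z X) P)
    (hmean : ∀ X, fbar X = ∫ z, f z X ∂P) {G σ : ℝ}
    (hG : ∀ i, ∀ X ∈ stiefel d r, ‖gradient (f i) X‖ ≤ G)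
    {X : Amb d r} (hX : X ∈ stiefel d r)
    (hσ : ∫ z, ‖gradient (f z) X - gradient fbar X‖ ^ 2 ∂P ≤ σ ^ 2) :
    ∫⁻ e, ENNReal.ofReal (‖(tangent X).starProjection
      (batchGrad f (B e) X - gradient fbar X)‖ ^ 2) ∂lam ≤ ENNReal.ofReal (σ ^ 2 / k) := by
  set φ : ι → Amb d r := fun z => (tangent X).starProjection (gradient (f z) X) with hφ
  have hgm := measurable_gradient_apply hf hm X
  have hφm : Measurable φ := (tangent X).starProjection.continuous.measurable.comp hgm
  have hφG : ∀ z, ‖φ z‖ ≤ G := fun z =>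
    (Submodule.norm_starProjection_apply_le _ _).trans (hG z X hX)
  have hfull := starProjection_gradient_mean hRetr hRetr₂ hf hfbar hm hi hmean hG hX
  have hbatch : ∀ e, (tangent X).starProjection (batchGrad f (B e) X - gradient fbar X)
      = 0 + (batchMean φ (B e) - ∫ z, φ z ∂P) := by
    intro e
    rw [map_sub, hfull, zero_add]
    change (tangent X).starProjection (batchMean (fun i => gradient (f i) X) (B e)) - _ = _
    rw [map_batchMean]
  simp_rw [hbatch]
  refine (hB φ G 0 hφm hφG).trans (ENNReal.ofReal_le_ofReal ?_)
  have h1 : ∫ z, ‖φ z - ∫ z, φ z ∂P‖ ^ 2 ∂P ≤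
      ∫ z, ‖gradient (f z) X - gradient fbar X‖ ^ 2 ∂P := by
    rw [← hfull]
    have hb : ∀ z, ‖gradient (f z) X - gradient fbar X‖ ≤ G + ‖gradient fbar X‖ := fun z =>
      (norm_sub_le _ _).trans (add_le_add (hG z X hX) le_rfl)
    refine integral_mono_of_nonneg (Eventually.of_forall fun z => sq_nonneg _)
      (Integrable.sq_norm_of_bounded (hgm.sub measurable_const) hb)
      (Eventually.of_forall fun z => ?_)
    change ‖(tangent X).starProjection _ - _‖ ^ 2 ≤ _
    rw [← map_sub]
    exact pow_le_pow_left₀ (norm_nonneg _) (Submodule.norm_starProjection_apply_le _ _) 2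
  calc _ = (k : ℝ)⁻¹ * ∫ z, ‖φ z - ∫ z, φ z ∂P‖ ^ 2 ∂P := by simp
    _ ≤ (k : ℝ)⁻¹ * σ ^ 2 := by gcongr; exact h1.trans hσ
    _ = _ := by ring

/-- Integration against the uniform distribution on `Fin n`. -/
lemma integral_uniform_fin {n : ℕ} [NeZero n] {H : Type*} [NormedAddCommGroup H] [NormedSpace ℝ H]
    [CompleteSpace H] (φ : Fin n → H) :
    ∫ i, φ i ∂(PMF.uniformOfFintype (Fin n)).toMeasure = (n : ℝ)⁻¹ • ∑ i, φ i := by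
  rw [PMF.integral_eq_sum, Finset.smul_sum]
  simp

lemma HasSampleVariance.uniformSubset {n k : ℕ} [NeZero n] (hk : 1 ≤ k) (hkn : k ≤ n)
    {S : Ω → Finset (Fin n)} (hS : IsUniformSubset μ S k) :
    HasSampleVariance (PMF.uniformOfFintype (Fin n)).toMeasure (μ.map S)
      (fun A : Finset (Fin n) => A.val) k d r := by
  intro φ C a _ _
  simp_rw [integral_uniform_fin]
  exact lintegral_uniformSubset_mean_le hk hkn hS φ a

/-- The past at time `t` of a family of random variables, each observed at its own time. -/
@[reducible] def past {κ β : Type*} [MeasurableSpace β] (time : κ → ℕ) (V : κ → Ω → β)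
    (t : ℕ) : MeasurableSpace Ω :=
  ⨆ p ∈ {p | time p < t}, MeasurableSpace.comap (V p) inferInstance

section Past

variable {κ β : Type*} [MeasurableSpace β] {time : κ → ℕ} {V : κ → Ω → β}

lemma past_le (hV : ∀ p, Measurable (V p)) (t : ℕ) : past time V t ≤ mΩ :=
  iSup₂_le fun p _ => (hV p).comap_le

lemma past_mono (t : ℕ) : past time V t ≤ past time V (t + 1) :=
  biSup_mono fun _ hp => Nat.lt_succ_of_lt hp

lemma comap_le_past {p : κ} {t : ℕ} (hp : time p < t) :
    MeasurableSpace.comap (V p) inferInstance ≤ past time V t :=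
  le_iSup₂ (f := fun p (_ : p ∈ {p | time p < t}) =>
    MeasurableSpace.comap (V p) inferInstance) p hp

/-- Disjoint groups of an independent family are independent. Grouping by time covers both one
subset per iteration and a whole sequence of samples per iteration. -/
lemma indep_past (hV : ∀ p, Measurable (V p)) (hind : iIndepFun V μ) (t : ℕ) :
    Indep (past time V t)
      (⨆ p ∈ {p | time p = t}, MeasurableSpace.comap (V p) inferInstance) μ :=
  indep_iSup_of_disjoint (fun p => (hV p).comap_le) hind.iIndep
    (Set.disjoint_left.2 fun p hp hp' => by
      simp only [mem_ofPred_eq] at hp hp'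
      omega)

lemma indep_index_past {ν : Ω → ℕ} (hind : IndepFun ν (fun ω p => V p ω) μ) (t : ℕ) :
    Indep (MeasurableSpace.comap ν inferInstance) (past time V t) μ := by
  refine indep_of_indep_of_le_right ((IndepFun_iff_Indep _ _ _).1 hind) (iSup₂_le fun p _ => ?_)
  have : V p = (fun x : κ → β => x p) ∘ fun ω p => V p ω := rfl
  rw [this, ← MeasurableSpace.comap_comp]
  exact MeasurableSpace.comap_mono (measurable_pi_apply p).comap_le

end Past

/-- Batches of size `q` give `κ = K² / q`, so `q κ` does not depend on `q`. A restart uses all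
components and has no error. -/
lemma isBatchSampling_finite (hRetr : IsRetraction Retr) (hΓ : IsIsometricTransport Retr Γ)
    {M₂ : ℝ} (hRetr₂ : ∀ X ∈ stiefel d r, ∀ ξ ∈ tangent X, ‖Retr X ξ - (X + ξ)‖ ≤ M₂ * ‖ξ‖ ^ 2)
    {n q : ℕ} (hn : 1 ≤ n) (hq : 1 ≤ q) (hqn : q ≤ n) {f : Fin n → Amb d r → ℝ}
    (hf : ∀ i, ContDiff ℝ 2 (f i)) (hfbar : ContDiff ℝ 2 fbar)
    (hmean : ∀ X, fbar X = (1 / (n : ℝ)) * ∑ i, f i X) {G K : ℝ}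
    (hG : ∀ i, ∀ X ∈ stiefel d r, ‖gradient (f i) X‖ ≤ G)
    (hK : ∀ i, ∀ X ∈ stiefel d r, ∀ ξ ∈ tangent X,
      ‖(tangent (Retr X ξ)).starProjection (gradient (f i) (Retr X ξ)) -
        Γ X ξ ((tangent X).starProjection (gradient (f i) X))‖ ≤ K * ‖ξ‖)
    {S : ℕ → Ω → Finset (Fin n)} (hS : ∀ t, IsUniformSubset μ (S t) (if t % q = 0 then n else q))
    (hind : iIndepFun S μ) :
    IsBatchSampling Retr Γ f fbar q μ (fun _ A => A.val) S (past id S) (K ^ 2 / q) 0 := by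
  have : NeZero n := ⟨by omega⟩
  have hsing : MeasurableSingletonClass (Finset (Fin n)) := ⟨fun _ => trivial⟩
  have hSm : ∀ t, Measurable (S t) := fun t => (hS t).1
  have hm : ∀ X, Measurable fun z => f z X := fun X => measurable_from_top
  have hi : ∀ X, Integrable (fun z => f z X) (PMF.uniformOfFintype (Fin n)).toMeasure :=
    fun X => Integrable.of_finite
  have hmean' : ∀ X, fbar X = ∫ z, f z X ∂(PMF.uniformOfFintype (Fin n)).toMeasure := fun X => by
    rw [hmean, integral_uniform_fin, smul_eq_mul, one_div]
  refine ⟨past_le hSm, past_mono, fun t => ?_, fun t => ?_, fun t => ?_, fun t ht X hX => ?_,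
    fun t ht X hX ξ hξ a => ?_⟩
  · exact measurable_iff_comap_le.2 (comap_le_past (V := S) (time := id) (Nat.lt_succ_self t))
  · refine indep_of_indep_of_le_right (indep_past (time := id) hSm hind t) ?_
    exact le_iSup₂ (f := fun p (_ : p ∈ {p | id p = t}) =>
      MeasurableSpace.comap (S p) inferInstance) t rfl
  · refine measurable_from_prod_countable_left fun A => ?_
    have : (fun X : Amb d r => batchGrad f A.val X)
        = fun X => (A.card : ℝ)⁻¹ • ∑ i ∈ A, gradient (f i) X := rfl
    rw [this]
    have hc : Continuous fun X : Amb d r => ∑ i ∈ A, gradient (f i) X :=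
      continuous_finsetSum _ fun i _ => (contDiff_gradient (hf i)).continuous
    exact (hc.const_smul (A.card : ℝ)⁻¹).measurable
  · have hSt := hS t
    rw [if_pos ht] at hSt
    -- The only `n`-element subset is everything, and its tangential batch gradient is that of the
    -- mean.
    rw [lintegral_uniformSubset hSt, ENNReal.ofReal_zero, nonpos_iff_eq_zero]
    refine Finset.sum_eq_zero fun A hA => ?_
    have hA' : A = Finset.univ := by
      rw [← Finset.card_eq_iff_eq_univ, (Finset.mem_powersetCard.1 hA).2, Fintype.card_fin]
    have : (tangent X).starProjection (batchGrad f A.val X - gradient fbar X) = 0 := by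
      rw [map_sub, starProjection_gradient_mean hRetr hRetr₂ hf hfbar hm hi hmean' hG hX,
        integral_uniform_fin, hA']
      change (tangent X).starProjection (batchMean (fun i => gradient (f i) X) _) - _ = _
      rw [map_batchMean, batchMean, Finset.card_val, Finset.card_univ, Fintype.card_fin]
      exact sub_self _
    rw [this]
    simp
  · have hSt := hS t
    rw [if_neg ht] at hSt
    exact (HasSampleVariance.uniformSubset hq hqn hSt).recursion hRetr hΓ hRetr₂ hf hfbar hm hi
      hmean' hG hK hX hξ a

/-- The recursive steps are as for a finite sum. A restart has tangential variance at most `σ² / s`,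
since projection does not increase deviations. -/
lemma isBatchSampling_online [IsProbabilityMeasure μ] (hRetr : IsRetraction Retr)
    (hΓ : IsIsometricTransport Retr Γ) {M₂ : ℝ}
    (hRetr₂ : ∀ X ∈ stiefel d r, ∀ ξ ∈ tangent X, ‖Retr X ξ - (X + ξ)‖ ≤ M₂ * ‖ξ‖ ^ 2)
    {q s : ℕ} (hq : 1 ≤ q) (hs : 1 ≤ s)
    (hf : ∀ i, ContDiff ℝ 2 (f i)) (hfbar : ContDiff ℝ 2 fbar)
    (hm : ∀ X, Measurable fun z => f z X) (hi : ∀ X, Integrable (fun z => f z X) P)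
    (hmean : ∀ X, fbar X = ∫ z, f z X ∂P) {G K σ : ℝ}
    (hG : ∀ i, ∀ X ∈ stiefel d r, ‖gradient (f i) X‖ ≤ G)
    (hK : ∀ i, ∀ X ∈ stiefel d r, ∀ ξ ∈ tangent X,
      ‖(tangent (Retr X ξ)).starProjection (gradient (f i) (Retr X ξ)) -
        Γ X ξ ((tangent X).starProjection (gradient (f i) X))‖ ≤ K * ‖ξ‖)
    (hσ : ∀ X ∈ stiefel d r, ∫ z, ‖gradient (f z) X - gradient fbar X‖ ^ 2 ∂P ≤ σ ^ 2)
    {Z : ℕ → ℕ → Ω → ι} (hZ : ∀ t j, Measurable (Z t j) ∧ μ.map (Z t j) = P)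
    (hind : iIndepFun (fun p : ℕ × ℕ => Z p.1 p.2) μ) :
    IsBatchSampling Retr Γ f fbar q μ (fun t x => onlineBatch (if t % q = 0 then s else q) x)
      (fun t ω j => Z t j ω) (past Prod.fst fun p : ℕ × ℕ => Z p.1 p.2) (K ^ 2 / q)
      (σ ^ 2 / s) := by
  have hZm : ∀ p : ℕ × ℕ, Measurable (Z p.1 p.2) := fun p => (hZ p.1 p.2).1
  have hB : ∀ t k, 1 ≤ k →
      HasSampleVariance P (μ.map fun ω j => Z t j ω) (onlineBatch k) k d r := by
    intro t k hk φ C a hφ hC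
    exact lintegral_onlineBatch_mean_le hk (fun j => (hZ t j).1) (fun j => (hZ t j).2)
      (fun i j hij => hind.indepFun (i := (t, i)) (j := (t, j)) (by simpa using hij)) hφ hC a
  refine ⟨past_le hZm, past_mono, fun t => ?_, fun t => ?_, fun t => ?_, fun t ht X hX => ?_,
    fun t ht X hX ξ hξ a => ?_⟩
  · refine @measurable_pi_lambda _ _ _ (past Prod.fst (fun p : ℕ × ℕ => Z p.1 p.2) (t + 1)) _ _
      fun j => ?_
    exact measurable_iff_comap_le.2 (comap_le_past (V := fun p : ℕ × ℕ => Z p.1 p.2)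
      (time := Prod.fst) (p := (t, j)) (Nat.lt_succ_self t))
  · refine indep_of_indep_of_le_right (indep_past (time := Prod.fst) hZm hind t) ?_
    refine measurable_iff_comap_le.1 (@measurable_pi_lambda _ _ _ (⨆ p ∈ {p : ℕ × ℕ | p.1 = t},
      MeasurableSpace.comap (Z p.1 p.2) inferInstance) _ _ fun j => ?_)
    exact measurable_iff_comap_le.2 (le_iSup₂ (f := fun (p : ℕ × ℕ)
      (_ : p ∈ {p : ℕ × ℕ | p.1 = t}) => MeasurableSpace.comap (Z p.1 p.2) inferInstance) (t, j) rfl)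
  · have : (fun p : Amb d r × (ℕ → ι) =>
        batchGrad f (onlineBatch (if t % q = 0 then s else q) p.2) p.1) = fun p =>
        ((if t % q = 0 then s else q : ℕ) : ℝ)⁻¹ •
          ∑ j ∈ Finset.range (if t % q = 0 then s else q), gradient (f (p.2 j)) p.1 :=
      funext fun p => batchMean_onlineBatch (fun i => gradient (f i) p.1) _ _
    rw [this]
    have hsum : Measurable fun p : Amb d r × (ℕ → ι) =>
        ∑ j ∈ Finset.range (if t % q = 0 then s else q), gradient (f (p.2 j)) p.1 :=
      Finset.measurable_fun_sum _ fun j _ => (measurable_gradient_uncurry hf hm).comp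
        (measurable_fst.prodMk ((measurable_pi_apply j).comp measurable_snd))
    exact hsum.const_smul ((if t % q = 0 then s else q : ℕ) : ℝ)⁻¹
  · simp only [if_pos ht]
    exact (hB t s hs).restart hRetr hRetr₂ hf hfbar hm hi hmean hG hX (hσ X hX)
  · simp only [if_neg ht]
    exact (hB t q hq).recursion hRetr hΓ hRetr₂ hf hfbar hm hi hmean hG hK hX hξ a

end Samplers

/-! ### Step size, rounding and oracle counts. -/

section Parameters

lemma spbEta_pos {LR Lh M₂ cE Θ : ℝ} (hLR : 0 < LR) (hLh : 0 ≤ Lh) (hM₂ : 0 < M₂) (hcE : 0 < cE)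
    (hΘ : 0 < Θ) : 0 < spbEta LR Lh M₂ cE Θ :=
  lt_min (by positivity) (by positivity)

lemma spbEta_mul_le {LR Lh M₂ cE Θ : ℝ} (hLR : 0 < LR) (hLh : 0 ≤ Lh) (hM₂ : 0 < M₂) :
    spbEta LR Lh M₂ cE Θ * (LR / 2 + Lh * M₂) ≤ 1 / 2 := by
  have hpos : 0 < LR / 2 + Lh * M₂ := by positivity
  calc _ ≤ 1 / (2 * (LR / 2 + Lh * M₂)) * (LR / 2 + Lh * M₂) := by gcongr; exact min_le_left _ _
    _ = 1 / 2 := by field_simp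

lemma spbEta_sq_le {LR Lh M₂ cE Θ c : ℝ} (hLR : 0 < LR) (hLh : 0 ≤ Lh) (hM₂ : 0 < M₂)
    (hcE : 0 < cE) (hc : 0 < c) (hΘ : √(c / (2 * cE)) ≤ Θ) :
    c * spbEta LR Lh M₂ cE Θ ^ 2 ≤ 1 := by
  have hΘ0 : 0 < Θ := (Real.sqrt_pos.2 (by positivity)).trans_le hΘ
  have h1 : c ≤ 2 * cE * Θ ^ 2 := by
    have h := (Real.sqrt_le_left hΘ0.le).1 hΘ
    rw [div_le_iff₀ (by positivity)] at h
    linarith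
  calc c * spbEta LR Lh M₂ cE Θ ^ 2
      ≤ 2 * cE * Θ ^ 2 * (1 / √(2 * cE * Θ ^ 2)) ^ 2 := by
        gcongr
        · exact (spbEta_pos hLR hLh hM₂ hcE hΘ0).le
        · exact min_le_right _ _
    _ = 1 := by
        rw [div_pow, one_pow, Real.sq_sqrt (by positivity)]
        exact mul_one_div_cancel (by positivity)

lemma ceil_div_sq_le {C ε : ℝ} (hC : 0 ≤ C) (hε : 0 < ε) (hε1 : ε ≤ 1) :
    (⌈C / ε ^ 2⌉₊ : ℝ) ≤ (C + 1) / ε ^ 2 := by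
  have h1 : (1 : ℝ) ≤ 1 / ε ^ 2 := by
    rw [le_div_iff₀ (by positivity)]
    nlinarith
  have h2 := (Nat.ceil_lt_add_one (show 0 ≤ C / ε ^ 2 by positivity)).le
  rw [add_div]
  linarith

lemma sqrt_rounding {n q : ℕ} (hn : 1 ≤ n) (hq : q = ⌊√(n : ℝ)⌋₊ ∨ q = ⌈√(n : ℝ)⌉₊) :
    1 ≤ q ∧ q ≤ n ∧ √(n : ℝ) ≤ 2 * q ∧ (q : ℝ) ≤ 2 * √n := by
  have hn1 : (1 : ℝ) ≤ n := by exact_mod_cast hn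
  have h1 : (1 : ℝ) ≤ √n := Real.one_le_sqrt.2 hn1
  have hle : √(n : ℝ) ≤ n := (Real.sqrt_le_left (by positivity)).2 (by nlinarith)
  have hfc : ⌊√(n : ℝ)⌋₊ ≤ q ∧ q ≤ ⌈√(n : ℝ)⌉₊ := by
    rcases hq with rfl | rfl
    · exact ⟨le_rfl, Nat.floor_le_ceil _⟩
    · exact ⟨Nat.floor_le_ceil _, le_rfl⟩
  have hq1 : 1 ≤ q := (Nat.le_floor (by exact_mod_cast h1)).trans hfc.1
  have hq1' : (1 : ℝ) ≤ q := by exact_mod_cast hq1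
  refine ⟨hq1, hfc.2.trans (Nat.ceil_le.2 hle), ?_, ?_⟩
  · have h2 := Nat.lt_floor_add_one √(n : ℝ)
    have h3 : (⌊√(n : ℝ)⌋₊ : ℝ) ≤ q := by exact_mod_cast hfc.1
    linarith
  · have h2 := Nat.ceil_lt_add_one (Real.sqrt_nonneg (n : ℝ))
    have h3 : (q : ℝ) ≤ ⌈√(n : ℝ)⌉₊ := by exact_mod_cast hfc.2
    linarith

/-- With `q` within a factor `2` of `√n`, restarts cost at most `2 √n T + n` and recursive steps at
most `4 √n T`; hence the `6`. -/
lemma finite_calls_bound {n q : ℕ} (hn : 1 ≤ n) (hq : 1 ≤ q) (hq1 : √(n : ℝ) ≤ 2 * q)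
    (hq2 : (q : ℝ) ≤ 2 * √n) {T A ε : ℝ} (hε : 0 < ε) (hA : 0 ≤ A) (hT0 : 0 ≤ T)
    (hT : T ≤ A / ε ^ 2) :
    (T / q + 1) * n + 2 * q * T ≤ (6 * A + 1) * (n + √n / ε ^ 2) := by
  have hq0 : (0 : ℝ) < q := by exact_mod_cast hq
  have hs : √(n : ℝ) * √n = n := Real.mul_self_sqrt (by positivity)
  have h1 : T / q * n ≤ 2 * √n * T := by
    rw [div_mul_eq_mul_div, div_le_iff₀ hq0]
    calc T * n = T * (√n * √n) := by rw [hs]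
      _ ≤ T * (√n * (2 * q)) := by gcongr
      _ = _ := by ring
  have h2 : √n * T ≤ √n * (A / ε ^ 2) := by gcongr
  have h3 : 2 * q * T ≤ 2 * (2 * √n) * T := by gcongr
  have h4 : (6 * A + 1) * (n + √n / ε ^ 2) = 6 * (√n * (A / ε ^ 2)) + n + 6 * A * n + √n / ε ^ 2 := by
    ring
  have h5 : 0 ≤ 6 * A * n := by positivity
  have h6 : 0 ≤ √n / ε ^ 2 := by positivity
  rw [h4]
  nlinarith

lemma online_calls_bound {q s T A b a₁ a₂ ε : ℝ} (ha₁ : 0 < a₁) (ha₂ : 0 < a₂) (hb : 0 < b)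
    (hA : 0 ≤ A) (hε : 0 < ε) (hε1 : ε ≤ 1) (hq1 : a₁ / ε ≤ q) (hq2 : q ≤ a₂ / ε) (hs0 : 0 ≤ s)
    (hs : s ≤ b / ε ^ 2) (hT0 : 0 ≤ T) (hT : T ≤ A / ε ^ 2) :
    (T / q + 1) * s + 2 * q * T ≤ (A * b / a₁ + b + 2 * a₂ * A) / ε ^ 3 := by
  have h0 : 0 < a₁ / ε := by positivity
  have h1 : T / q ≤ A / ε ^ 2 / (a₁ / ε) := by gcongr
  have h2 : (1 : ℝ) ≤ 1 / ε := by rwa [le_div_iff₀ hε, one_mul]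
  calc (T / q + 1) * s + 2 * q * T
      ≤ (A / ε ^ 2 / (a₁ / ε) + 1 / ε) * (b / ε ^ 2) + 2 * (a₂ / ε) * (A / ε ^ 2) := by
        have hq0 : 0 ≤ q := h0.le.trans hq1
        gcongr
    _ = _ := by field_simp

end Parameters

/-! ### Choice of the constants and conclusion. -/

theorem theorem2 {d r : ℕ}
    (Retr : Amb d r → Amb d r → Amb d r) (hRetr : IsRetraction Retr)
    (Γ : Amb d r → Amb d r → Amb d r → Amb d r) (hΓ : IsIsometricTransport Retr Γ)
    (M₁ M₂ : ℝ) (hM₁ : 0 < M₁) (hM₂ : 0 < M₂)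
    (hRetr₁ : ∀ X ∈ stiefel d r, ∀ ξ ∈ tangent X, ‖Retr X ξ - X‖ ≤ M₁ * ‖ξ‖)
    (hRetr₂ : ∀ X ∈ stiefel d r, ∀ ξ ∈ tangent X, ‖Retr X ξ - (X + ξ)‖ ≤ M₂ * ‖ξ‖ ^ 2)
    (cE LH G : ℝ) (hcE : 0 < cE) (hLH : 0 ≤ LH) (hG : 0 ≤ G) :
    ∃ Θ₀ : ℝ, 0 < Θ₀ ∧ ∀ Θ : ℝ, Θ₀ ≤ Θ → ∀ LR Lh Δ : ℝ, 0 < LR → 0 ≤ Lh → 0 ≤ Δ →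
      -- the finite-sum case
      (∃ C₁ C₂ : ℝ, 0 < C₁ ∧ 0 < C₂ ∧
        ∀ (n : ℕ) (f : Fin n → Amb d r → ℝ) (h : Amb d r → ℝ)
          (U : Set (Amb d r)) (ρ : ℝ) (Xs X₀ : Amb d r) (fbar : Amb d r → ℝ),
          1 ≤ n →
          (∀ X, fbar X = (1 / (n : ℝ)) * ∑ i, f i X) →
          ProblemAssumptions Retr f fbar h U ρ Xs cE LH LR G Lh →
          X₀ ∈ stiefel d r →
          (fbar X₀ + h X₀) - (fbar Xs + h Xs) ≤ Δ →
          ∀ (ε : ℝ) (q T : ℕ), 0 < ε → ε ≤ 1 →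
            (q = ⌊Real.sqrt n⌋₊ ∨ q = ⌈Real.sqrt n⌉₊) →
            C₁ / ε ^ 2 ≤ T →
            ∀ (Ω : Type*) [MeasurableSpace Ω] (μ : Measure Ω) [IsProbabilityMeasure μ]
              (S : ℕ → Ω → Finset (Fin n)) (ν : Ω → ℕ) (run : Ω → ℕ → SPBState d r),
              (∀ t, IsUniformSubset μ (S t) (if t % q = 0 then n else q)) →
              iIndepFun S μ →
              IsUniformIndex μ ν T →
              IndepFun ν (fun ω t => S t ω) μ →
              (∀ ω, run ω = spbRun Retr Γ f h (spbEta LR Lh M₂ cE Θ) (2 / 5) q X₀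
                (fun t => (S t ω).val)) →
              (∀ᵐ ω ∂μ, StaysIn Retr U (run ω) T) →
              IsEpsStochStationary μ Retr fbar h (2 / 5) ε (fun ω => (run ω (ν ω)).X) ∧
              (T = ⌈C₁ / ε ^ 2⌉₊ →
                ∀ ω, ((run ω T).calls : ℝ) ≤ C₂ * (n + Real.sqrt n / ε ^ 2))) ∧
      -- the online case
      (∀ σ a₁ a₂ : ℝ, 0 ≤ σ → 0 < a₁ → 0 < a₂ →
        ∃ b₀ C₁ : ℝ, 0 < b₀ ∧ 0 < C₁ ∧ ∀ b : ℝ, b₀ ≤ b → ∃ C₂ : ℝ, 0 < C₂ ∧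
        ∀ (D : Type*) [MeasurableSpace D] (P : Measure D) [IsProbabilityMeasure P]
          (f : D → Amb d r → ℝ) (h : Amb d r → ℝ)
          (U : Set (Amb d r)) (ρ : ℝ) (Xs X₀ : Amb d r) (fbar : Amb d r → ℝ),
          (∀ X, Measurable fun z => f z X) →
          (∀ X, Integrable (fun z => f z X) P) →
          (∀ X, fbar X = ∫ z, f z X ∂P) →
          ProblemAssumptions Retr f fbar h U ρ Xs cE LH LR G Lh →
          (∀ X ∈ stiefel d r, ∫ z, ‖gradient (f z) X - gradient fbar X‖ ^ 2 ∂P ≤ σ ^ 2) →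
          X₀ ∈ stiefel d r →
          (fbar X₀ + h X₀) - (fbar Xs + h Xs) ≤ Δ →
          ∀ (ε : ℝ) (q s T : ℕ), 0 < ε → ε ≤ 1 →
            a₁ / ε ≤ q → q ≤ a₂ / ε →
            b₀ / ε ^ 2 ≤ s → s ≤ b / ε ^ 2 →
            C₁ / ε ^ 2 ≤ T →
            ∀ (Ω : Type*) [MeasurableSpace Ω] (μ : Measure Ω) [IsProbabilityMeasure μ]
              (Z : ℕ → ℕ → Ω → D) (ν : Ω → ℕ) (run : Ω → ℕ → SPBState d r),
              (∀ t j, Measurable (Z t j) ∧ μ.map (Z t j) = P) →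
              iIndepFun (fun p : ℕ × ℕ => Z p.1 p.2) μ →
              IsUniformIndex μ ν T →
              IndepFun ν (fun ω (p : ℕ × ℕ) => Z p.1 p.2 ω) μ →
              (∀ ω, run ω = spbRun Retr Γ f h (spbEta LR Lh M₂ cE Θ) (2 / 5) q X₀
                (fun t => onlineBatch (if t % q = 0 then s else q) (fun j => Z t j ω))) →
              (∀ᵐ ω ∂μ, StaysIn Retr U (run ω) T) →
              IsEpsStochStationary μ Retr fbar h (2 / 5) ε (fun ω => (run ω (ν ω)).X) ∧
              (T = ⌈C₁ / ε ^ 2⌉₊ →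
                ∀ ω, ((run ω T).calls : ℝ) ≤ C₂ / ε ^ 3)) := by
  obtain ⟨K, hK0, hK⟩ := exists_transport_lipschitz hRetr hΓ hM₁ hRetr₁ hLH hG
  -- This makes `(1 + 16 K²) η² ≤ 1`: the summand `1` yields `η ≤ 1`, and `16 K²` lets the error
  -- recursion be absorbed by the descent.
  refine ⟨√((1 + 16 * K ^ 2) / (2 * cE)), by positivity,
    fun Θ hΘ LR Lh Δ hLR hLh hΔ0 => ?_⟩
  have hΘ0 : 0 < Θ := lt_of_lt_of_le (by positivity) hΘ
  set η := spbEta LR Lh M₂ cE Θ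
  have hη0 : 0 < η := spbEta_pos hLR hLh hM₂ hcE hΘ0
  have hη : η * (LR / 2 + Lh * M₂) ≤ 1 / 2 := spbEta_mul_le hLR hLh hM₂
  have hηsq : (1 + 16 * K ^ 2) * η ^ 2 ≤ 1 := spbEta_sq_le hLR hLh hM₂ hcE (by positivity) hΘ
  have hη1 : η ≤ 1 := by nlinarith [mul_nonneg (sq_nonneg K) (sq_nonneg η)]
  have hκ : ∀ q : ℕ, 1 ≤ q → 16 * (q * (K ^ 2 / q)) * η ^ 2 ≤ 1 := fun q hq => by
    have hq0 : (q : ℝ) ≠ 0 := by positivity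
    rw [mul_div_cancel₀ _ hq0]
    nlinarith [sq_nonneg η]
  set C₁ : ℝ := 1 + 416 * M₁ ^ 2 * (Δ / η) + 20 * √r
  have hC₁ : 0 < C₁ := by positivity
  -- Rounding `C₁ / ε²` up costs at most `1 / ε²`, whence `C₁ + 1` in the call counts. The online
  -- `b₀` is what makes `416 M₁² σ² / s ≤ ε²`; its summand `1` keeps it positive when `σ = 0`.
  refine ⟨⟨C₁, 6 * (C₁ + 1) + 1, hC₁, by positivity, ?_⟩, fun σ a₁ a₂ _ ha₁ ha₂ =>
    ⟨1 + 416 * M₁ ^ 2 * σ ^ 2, C₁, by positivity, hC₁, fun b hb => ?_⟩⟩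
  · intro n f h U ρ Xs X₀ fbar hn hmean hp hX₀ hΔ ε q T hε hε1 hq hT Ω _ μ _ S ν run hS hind hν
      hνind hrun hstay
    obtain ⟨hq1, hqn, hql, hqu⟩ := sqrt_rounding hn hq
    obtain rfl : run = fun ω => spbRun Retr Γ f h η (2 / 5) q X₀ fun t => (S t ω).val :=
      funext hrun
    refine ⟨?_, fun hTC ω => ?_⟩
    · have hs := isBatchSampling_finite hRetr hΓ hRetr₂ hn hq1 hqn hp.smooth_component
        hp.smooth_mean hmean hp.gradient_bound (fun i => hK _ (hp.smooth_component i)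
        (hp.hessian_bound i) (hp.gradient_bound i)) hS hind
      exact isEpsStochStationary_spbRun hRetr hΓ hM₁ hRetr₁ hRetr₂ hp hG hLR.le hLh hX₀ hΔ0 hΔ hη0
        hη1 hη hq1 (by positivity) (hκ q hq1) le_rfl hs hstay hν (indep_index_past hνind) hε hε1 hT
        (by rw [mul_zero]; positivity)
    · have hTA : (T : ℝ) ≤ (C₁ + 1) / ε ^ 2 := hTC ▸ ceil_div_sq_le hC₁.le hε hε1
      exact (calls_le hq1 (fun t => by simpa using (hS t).2.1 ω) T).trans
        (finite_calls_bound hn hq1 hql hqu hε (by positivity) (by positivity) hTA)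
  · have hb0 : 0 < b := lt_of_lt_of_le (by positivity) hb
    refine ⟨(C₁ + 1) * b / a₁ + b + 2 * a₂ * (C₁ + 1), by positivity, ?_⟩
    intro D _ P _ f h U ρ Xs X₀ fbar hm hi hmean hp hσ hX₀ hΔ ε q s T hε hε1 hql hqu hsl hsu hT Ω _
      μ _ Z ν run hZ hind hν hνind hrun hstay
    have hq1 : 1 ≤ q := by
      have : (0 : ℝ) < q := lt_of_lt_of_le (by positivity) hql
      exact_mod_cast this
    have hs0 : (0 : ℝ) < s := lt_of_lt_of_le (by positivity) hsl
    have hs1 : 1 ≤ s := by exact_mod_cast hs0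
    obtain rfl : run = fun ω => spbRun Retr Γ f h η (2 / 5) q X₀ fun t =>
      onlineBatch (if t % q = 0 then s else q) (fun j => Z t j ω) := funext hrun
    refine ⟨?_, fun hTC ω => ?_⟩
    · have hs := isBatchSampling_online hRetr hΓ hRetr₂ hq1 hs1 hp.smooth_component
        hp.smooth_mean hm hi hmean hp.gradient_bound (fun i => hK _ (hp.smooth_component i)
        (hp.hessian_bound i) (hp.gradient_bound i)) hσ hZ hind
      refine isEpsStochStationary_spbRun hRetr hΓ hM₁ hRetr₁ hRetr₂ hp hG hLR.le hLh hX₀ hΔ0 hΔ hη0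
        hη1 hη hq1 (by positivity) (hκ q hq1) (by positivity) hs hstay hν (indep_index_past hνind)
        hε hε1 hT ?_
      rw [div_le_iff₀ (by positivity)] at hsl
      rw [← mul_div_assoc, div_le_iff₀ hs0]
      linarith
    · have hTA : (T : ℝ) ≤ (C₁ + 1) / ε ^ 2 := hTC ▸ ceil_div_sq_le hC₁.le hε hε1
      exact (calls_le hq1 (fun t => by simp [onlineBatch]) T).trans
        (online_calls_bound ha₁ ha₂ hb0 (by positivity) hε hε1 hql hqu hs0.le hsu
          (by positivity) hTA)
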